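/- **Theorem (Decomposition of the two-copy representation).** Let $q\ge 1$, $d=2^q$, and let $\mathcal M_d$ be the space of complex $d\times d$ matrices. Let $X,Z,Y=iZX$ be the $2\times 2$ Pauli matrices, let $\mathcal P_q\subset U(d)$ be the group of all $q$-fold tensor products of elements of $\langle X,Z,i\mathbb 1_2\rangle$, and let $\mathcal C_q$ be the normalizer of $\mathcal P_q$ in $U(d)$, modulo $U(1)$ (the $q$-qubit Clifford group). The two-copy representation $\varphi^{\otimes 2}$ of $\mathcal C_q$ on $\mathcal M_d^{\otimes 2}=\mathcal M_d\otimes\mathcal M_d$ is given by $\varphi^{\otimes2}(C)(A\otimes B)=(CAC^\dagger)\otimes(CBC^\dagger)$. Let $\sigma_0=\mathbb 1/\sqrt d$, let $\boldsymbol\sigma$ be the set of all $P/\sqrt d$ with $P\ne\mathbb 1$ a $q$-fold tensor product of $\mathbb 1,X,Y,Z$, and $\hat{\boldsymbol\sigma}=\boldsymbol\sigma\cup\{\sigma_0\}$. Write $\sigma\cdot\tau=\sqrt d\,\sigma\tau$ for the normalized product, and $\sigma\tau$ for $\sigma\otimes\tau$ when an element of $\mathcal M_d^{\otimes 2}$ is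 meant. For $\tau\in\boldsymbol\sigma$ put $$N_\tau=\{\sigma\in\boldsymbol\sigma:\sigma\tau=-\tau\sigma \text{ in } \mathcal M_d\},\quad C_\tau=\{\sigma\in\boldsymbol\sigma\setminus\{\tau\}:\sigma\tau=\tau\sigma \text{ in } \mathcal M_d\},\quad \hat C_\tau=C_\tau\cup\{\sigma_0,\tau\}.$$ For $A,B\in\mathcal M_d$ put $S_{A,B}=\frac1{\sqrt2}(A\otimes B+B\otimes A)$ and $A_{A,B}=\frac1{\sqrt2}(A\otimes B-B\otimes A)$. Define subspaces of $\mathcal M_d^{\otimes2}$, with $\sigma,\tau$ ranging over $\boldsymbol\sigma$ and coefficients $\lambda_\sigma\in\mathbb C$: - $V_{\mathrm{id}}=\mathrm{span}\{\sigma_0\sigma_0\}$, $V_{\mathrm r}=\mathrm{span}\{\sigma_0\tau\}$, $V_{\mathrm l}=\mathrm{span}\{\tau\sigma_0\}$. - $V_{\{\mathrm S\}}=\mathrm{span}\{S_{\sigma,\tau}:\sigma\in N_\tau\}$, $V_{[\mathrm A]}=\mathrm{span}\{A_{\sigma,\tau}:\sigma\in C_\tau\}$, $V_{\{\mathrm A\}}=\mathrm{span}\{A_{\sigma,\tau}:\sigma\in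 N_\tau\}$. - $V_0=\mathrm{span}\{\sum_{\sigma}\sigma\sigma\}$; $V_1$ (resp. $V_2$) is the space of all $\sum_\sigma\lambda_\sigma\sigma\sigma$ with $\sum_\sigma\lambda_\sigma=0$ and, for all $\tau\in\boldsymbol\sigma$, $\sum_{\sigma\in N_\tau}\lambda_\sigma=-\frac d2\lambda_\tau$ (resp. $=+\frac d2\lambda_\tau$). - $V_{[\mathrm{adj}]}=\mathrm{span}\{\sum_{\sigma\in C_\tau}S_{\sigma,\sigma\cdot\tau}:\tau\in\boldsymbol\sigma\}$, $V_{\{\mathrm{adj}\}}=\mathrm{span}\{\sum_{\sigma\in N_\tau}A_{\sigma,i\sigma\cdot\tau}:\tau\in\boldsymbol\sigma\}$, and $V^\perp_{\{\mathrm{adj}\}}$ is the orthogonal complement of $V_{\{\mathrm{adj}\}}$ in $V_{\{\mathrm A\}}$ for the Hilbert–Schmidt inner product. - $V_{[1]}=\bigoplus_\tau V_{[1]}^\tau$ and $V_{[2]}=\bigoplus_\tau V_{[2]}^\tau$, where $V_{[1]}^\tau$ (resp. $V_{[2]}^\tau$) is the space of all $\sum_{\sigma\in C_\tau}\lambda_\sigma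 S_{\sigma,\sigma\cdot\tau}$ such that, for all $\nu\in C_\tau$, $\sum_{\sigma\in C_\tau\cap N_\nu}\lambda_\sigma=-\frac d2\lambda_\nu$ (resp. $=+\frac d2\lambda_\nu$). - $V_{\{1\}}=\bigoplus_\tau V_{\{1\}}^\tau$ and $V_{\{2\}}=\bigoplus_\tau V_{\{2\}}^\tau$, where $V_{\{1\}}^\tau$ (resp. $V_{\{2\}}^\tau$) is the space of all $\sum_{\sigma\in N_\tau}\lambda_\sigma S_{\sigma,i\sigma\cdot\tau}$ such that, for all $\nu\in N_\tau$, $\sum_{\sigma\in N_\tau\cap\hat C_\nu}\lambda_\sigma-\sum_{\sigma\in N_\tau\cap N_\nu}\lambda_\sigma=d\,\lambda_\nu$ (resp. $=-d\,\lambda_\nu$). Then $\mathcal M_d^{\otimes 2}$ is the direct sum of the following subspaces, each of which carries an irreducible subrepresentation of $\varphi^{\otimes 2}$: - for $q=1$ (7 summands): $V_{\mathrm{id}}\oplus V_{\mathrm r}\oplus V_{\mathrm l}\oplus V_0\oplus V_1\oplus V_{\{\mathrm S\}}\oplus V_{\{\mathrm A\}}$; - for $q=2$ (13 summands): $V_{\mathrm{id}}\oplus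 V_{\mathrm r}\oplus V_{\mathrm l}\oplus V_0\oplus V_1\oplus V_2\oplus V_{[\mathrm{adj}]}\oplus V_{[1]}\oplus V_{\{\mathrm{adj}\}}\oplus V_{\{1\}}\oplus V_{\{2\}}\oplus V_{[\mathrm A]}\oplus V^\perp_{\{\mathrm{adj}\}}$; - for $q\ge3$ (14 summands): $V_{\mathrm{id}}\oplus V_{\mathrm r}\oplus V_{\mathrm l}\oplus V_0\oplus V_1\oplus V_2\oplus V_{[\mathrm{adj}]}\oplus V_{[1]}\oplus V_{[2]}\oplus V_{\{\mathrm{adj}\}}\oplus V_{\{1\}}\oplus V_{\{2\}}\oplus V_{[\mathrm A]}\oplus V^\perp_{\{\mathrm{adj}\}}$. Moreover, the equivalences among the summands are exactly these: $V_{\mathrm{id}}\cong V_0$ (the trivial representation); $V_{\mathrm r}\cong V_{\mathrm l}\cong V_{\{\mathrm A\}}$ for $q=1$, and $V_{\mathrm r}\cong V_{\mathrm l}\cong V_{[\mathrm{adj}]}\cong V_{\{\mathrm{adj}\}}$ and $V_{[\mathrm A]}\cong V^\perp_{\{\mathrm{adj}\}}$ for $q\ge2$. All other pairs of distinct summands are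 inequivalent. -/

import Mathlib

open scoped TensorProduct

noncomputable section

namespace Clifford

/-! ### Pauli matrices, the Pauli group and the Clifford group -/

/-- The Pauli matrix `X`, given by `X v_l = v_{l+1}`. -/
def pauliX : Matrix (Fin 2) (Fin 2) ℂ := !![0, 1; 1, 0]

/-- The Pauli matrix `Z`, given by `Z v_l = (-1)^l v_l`. -/
def pauliZ : Matrix (Fin 2) (Fin 2) ℂ := !![1, 0; 0, -1]

/-- The Pauli matrix `Y = i Z X`. -/
def pauliY : Matrix (Fin 2) (Fin 2) ℂ := Complex.I • (pauliZ * pauliX)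

/-- The index set of the standard basis of `(ℂ²)^{⊗ q} = ℂ^d`, where `d = 2 ^ q`. -/
abbrev Ind (q : ℕ) : Type := Fin q → Fin 2

/-- The space `M_d` of linear operators on `ℂ^d`, where `d = 2 ^ q`. -/
abbrev Op (q : ℕ) : Type := Matrix (Ind q) (Ind q) ℂ

/-- The unitary group `U(2 ^ q)`. -/
abbrev U (q : ℕ) : Type := Matrix.unitaryGroup (Ind q) ℂ

/-- The tensor product `A 0 ⊗ A 1 ⊗ ⋯ ⊗ A (q - 1)` of single-qubit operators. -/
def tensorOp {q : ℕ} (A : Fin q → Matrix (Fin 2) (Fin 2) ℂ) : Op q :=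
  Matrix.of fun a b => ∏ j, A j (a j) (b j)

theorem tensorOp_mul {q : ℕ} (A B : Fin q → Matrix (Fin 2) (Fin 2) ℂ) :
    tensorOp (fun j => A j * B j) = tensorOp A * tensorOp B := by
  ext a b
  simp only [tensorOp, Matrix.of_apply, Matrix.mul_apply]
  rw [Finset.prod_univ_sum, Fintype.piFinset_univ]
  simp only [Finset.prod_mul_distrib]

theorem tensorOp_one {q : ℕ} :
    tensorOp (fun _ : Fin q => (1 : Matrix (Fin 2) (Fin 2) ℂ)) = 1 := by
  ext a b
  simp only [tensorOp, Matrix.of_apply, Matrix.one_apply]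
  by_cases h : a = b
  · simp [h]
  · obtain ⟨j, hj⟩ := Function.ne_iff.mp h
    rw [if_neg h]
    exact Finset.prod_eq_zero (Finset.mem_univ j) (if_neg hj)

theorem tensorOp_star {q : ℕ} (A : Fin q → Matrix (Fin 2) (Fin 2) ℂ) :
    star (tensorOp A) = tensorOp (fun j => star (A j)) := by
  ext a b
  simp [tensorOp, Matrix.star_apply]

theorem tensorOp_mem {q : ℕ} (A : Fin q → Matrix.unitaryGroup (Fin 2) ℂ) :
    tensorOp (fun j => (A j : Matrix (Fin 2) (Fin 2) ℂ)) ∈ Matrix.unitaryGroup (Ind q) ℂ := by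
  rw [Matrix.mem_unitaryGroup_iff, tensorOp_star, ← tensorOp_mul]
  have h : (fun j => (A j : Matrix (Fin 2) (Fin 2) ℂ) * star (A j : Matrix (Fin 2) (Fin 2) ℂ))
      = fun _ => 1 := funext fun j => Matrix.mem_unitaryGroup_iff.mp (A j).2
  rw [h, tensorOp_one]

/-- The tensor product of single-qubit unitaries, as a group homomorphism. -/
def tensorU (q : ℕ) : (Fin q → Matrix.unitaryGroup (Fin 2) ℂ) →* U q where
  toFun A := ⟨tensorOp fun j => (A j : Matrix (Fin 2) (Fin 2) ℂ), tensorOp_mem A⟩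
  map_one' := Subtype.ext tensorOp_one
  map_mul' _ _ := Subtype.ext (tensorOp_mul _ _)

theorem pauliX_mem : pauliX ∈ Matrix.unitaryGroup (Fin 2) ℂ := by
  rw [Matrix.mem_unitaryGroup_iff]
  ext i j
  fin_cases i <;> fin_cases j <;> simp [pauliX, Matrix.mul_apply, Matrix.star_apply]

theorem pauliZ_mem : pauliZ ∈ Matrix.unitaryGroup (Fin 2) ℂ := by
  rw [Matrix.mem_unitaryGroup_iff]
  ext i j
  fin_cases i <;> fin_cases j <;> simp [pauliZ, Matrix.mul_apply, Matrix.star_apply]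

theorem iOne_mem : Complex.I • (1 : Matrix (Fin 2) (Fin 2) ℂ) ∈ Matrix.unitaryGroup (Fin 2) ℂ := by
  rw [Matrix.mem_unitaryGroup_iff]
  ext i j
  fin_cases i <;> fin_cases j <;> simp [Matrix.mul_apply]

/-- The single-qubit Pauli group `⟨X, Z, i 1⟩`. -/
def pauliGroupOne : Subgroup (Matrix.unitaryGroup (Fin 2) ℂ) :=
  Subgroup.closure {⟨pauliX, pauliX_mem⟩, ⟨pauliZ, pauliZ_mem⟩, ⟨Complex.I • 1, iOne_mem⟩}

/-- The `q`-qubit Pauli group: all `q`-fold tensor products of elements of `⟨X, Z, i 1⟩`. -/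
def pauliGroup (q : ℕ) : Subgroup (U q) :=
  (Subgroup.pi Set.univ fun _ : Fin q => pauliGroupOne).map (tensorU q)

/-- The normalizer of the Pauli group in `U(2 ^ q)`. -/
def cliffordUnitaries (q : ℕ) : Subgroup (U q) :=
  Subgroup.normalizer (pauliGroup q : Set (U q))

/-- The subgroup `U(1)` of scalar matrices in the normalizer of the Pauli group. -/
def phases (q : ℕ) : Subgroup (cliffordUnitaries q) where
  carrier := {V | ∃ c : ℂ, ((V : U q) : Op q) = c • 1}
  one_mem' := ⟨1, by simp⟩
  mul_mem' := by
    rintro V W ⟨c, hc⟩ ⟨e, he⟩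
    exact ⟨c * e, by simp [hc, he, smul_smul, mul_comm]⟩
  inv_mem' := by
    rintro V ⟨c, hc⟩
    refine ⟨star c, ?_⟩
    have h : (((V⁻¹ : cliffordUnitaries q) : U q) : Op q) = star ((V : U q) : Op q) := rfl
    rw [h, hc, star_smul, star_one]

instance phases_normal (q : ℕ) : (phases q).Normal where
  conj_mem := by
    rintro V ⟨c, hc⟩ W
    refine ⟨c, ?_⟩
    have h : ((W : U q) : Op q) * star ((W : U q) : Op q) = 1 :=
      Matrix.mem_unitaryGroup_iff.mp (W : U q).2
    have h2 : (((W * V * W⁻¹ : cliffordUnitaries q) : U q) : Op q)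
        = ((W : U q) : Op q) * ((V : U q) : Op q) * star ((W : U q) : Op q) := rfl
    rw [h2, hc, Matrix.mul_smul, mul_one, Matrix.smul_mul, h]

/-- The `q`-qubit Clifford group: the normalizer of the Pauli group, modulo `U(1)`. -/
abbrev CliffordGroup (q : ℕ) : Type := cliffordUnitaries q ⧸ phases q

/-! ### The one-copy and the two-copy representation -/

/-- The action `A ↦ V A V†` of the normalizer of the Pauli group on `M_d`. -/
def conjRep (q : ℕ) : Representation ℂ (cliffordUnitaries q) (Op q) where
  toFun V :=
    { toFun := fun A => ((V : U q) : Op q) * A * star ((V : U q) : Op q)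
      map_add' := fun A B => by rw [mul_add, add_mul]
      map_smul' := fun c A => by simp }
  map_one' := by
    ext1 A
    simp
  map_mul' V W := by
    ext1 A
    simp [mul_assoc]

theorem phases_le_ker (q : ℕ) : phases q ≤ (conjRep q).ker := by
  rintro V ⟨c, hc⟩
  rw [MonoidHom.mem_ker]
  refine LinearMap.ext fun A => ?_
  have h : ((V : U q) : Op q) * star ((V : U q) : Op q) = 1 :=
    Matrix.mem_unitaryGroup_iff.mp (V : U q).2
  change ((V : U q) : Op q) * A * star ((V : U q) : Op q) = A
  have h2 : ((V : U q) : Op q) * A = A * ((V : U q) : Op q) := by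
    rw [hc]
    simp
  rw [h2, mul_assoc, h, mul_one]

/-- The one-copy representation `φ(C) A = C A C†` of the Clifford group on `M_d`. -/
def oneCopy (q : ℕ) : Representation ℂ (CliffordGroup q) (Op q) :=
  QuotientGroup.lift (phases q) (conjRep q) (phases_le_ker q)

/-- The space `M_d ⊗ M_d`. -/
abbrev Op2 (q : ℕ) : Type := Op q ⊗[ℂ] Op q

/-- The two-copy representation `φ ⊗ φ` of the Clifford group on `M_d ⊗ M_d`. -/
def twoCopy (q : ℕ) : Representation ℂ (CliffordGroup q) (Op2 q) :=
  (oneCopy q).tprod (oneCopy q)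

/-! ### Normalized Pauli operators -/

/-- Labels of the `q`-fold tensor products of `1, X, Y, Z` (numbered `0, 1, 2, 3`);
the label `0` is that of the identity. -/
abbrev PauliString (q : ℕ) : Type := Fin q → Fin 4

/-- The dimension `d = 2 ^ q` as a complex number. -/
def dim (q : ℕ) : ℂ := 2 ^ q

/-- The complex number `√d`. -/
def sqrtDim (q : ℕ) : ℂ := (Real.sqrt (2 ^ q) : ℝ)

/-- The normalized Pauli operator `P / √d` with the given label; `nP 0 = 1 / √d` is `σ_0`, and
`σ ↦ nP σ` for `σ ≠ 0` runs through the normalized non-identity Pauli operators. -/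
def nP {q : ℕ} (σ : PauliString q) : Op q :=
  (sqrtDim q)⁻¹ • tensorOp fun j => ![1, pauliX, pauliY, pauliZ] (σ j)

/-- The normalized product `σ · τ = √d σ τ`. -/
def nMul {q : ℕ} (σ τ : PauliString q) : Op q := sqrtDim q • (nP σ * nP τ)

open Classical in
/-- All non-identity Pauli labels. -/
def nonId (q : ℕ) : Finset (PauliString q) := Finset.univ.filter fun σ => σ ≠ 0

open Classical in
/-- `N_τ`: the non-identity Pauli operators that anti-commute with `τ`. -/
def antiComm {q : ℕ} (τ : PauliString q) : Finset (PauliString q) :=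
  (nonId q).filter fun σ => nP σ * nP τ + nP τ * nP σ = 0

open Classical in
/-- `C_τ`: the non-identity Pauli operators other than `τ` that commute with `τ`. -/
def commOther {q : ℕ} (τ : PauliString q) : Finset (PauliString q) :=
  (nonId q).filter fun σ => σ ≠ τ ∧ nP σ * nP τ - nP τ * nP σ = 0

open Classical in
/-- `Ĉ_τ`: all Pauli operators (including the identity and `τ`) that commute with `τ`. -/
def commAll {q : ℕ} (τ : PauliString q) : Finset (PauliString q) :=
  Finset.univ.filter fun σ => nP σ * nP τ - nP τ * nP σ = 0

/-! ### Subspaces of `M_d ⊗ M_d` -/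

/-- `S_{A,B} = (A ⊗ B + B ⊗ A) / √2`. -/
def symT {q : ℕ} (A B : Op q) : Op2 q :=
  ((Real.sqrt 2 : ℝ) : ℂ)⁻¹ • (A ⊗ₜ[ℂ] B + B ⊗ₜ[ℂ] A)

/-- `A_{A,B} = (A ⊗ B - B ⊗ A) / √2`. -/
def altT {q : ℕ} (A B : Op q) : Op2 q :=
  ((Real.sqrt 2 : ℝ) : ℂ)⁻¹ • (A ⊗ₜ[ℂ] B - B ⊗ₜ[ℂ] A)

/-- The identification of `M_d ⊗ M_d` with the operators on `ℂ^d ⊗ ℂ^d`, which maps `A ⊗ B` to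
the Kronecker product of `A` and `B`. -/
def toKron (q : ℕ) : Op2 q →ₗ[ℂ] Matrix (Ind q × Ind q) (Ind q × Ind q) ℂ :=
  TensorProduct.lift Matrix.kroneckerBilinear

/-- The Hilbert-Schmidt inner product `⟨v, w⟩ = tr (v† w)` on `M_d ⊗ M_d`, conjugate-linear in
the first argument. -/
def hsInner {q : ℕ} (v w : Op2 q) : ℂ :=
  ((toKron q v).conjTranspose * toKron q w).trace

theorem hsInner_tmul {q : ℕ} (A B A' B' : Op q) :
    hsInner (A ⊗ₜ[ℂ] B) (A' ⊗ₜ[ℂ] B') =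
      (A.conjTranspose * A').trace * (B.conjTranspose * B').trace := by
  have h : ∀ C D : Op q, toKron q (C ⊗ₜ[ℂ] D) =
      Matrix.kroneckerMap (fun x y => x * y) C D := fun C D => rfl
  rw [hsInner, h, h, Matrix.conjTranspose_kronecker, ← Matrix.mul_kronecker_mul,
    Matrix.trace_kronecker]

section
variable (q : ℕ)

/-- `V_id`. -/
def Vid : Submodule ℂ (Op2 q) := Submodule.span ℂ {nP 0 ⊗ₜ[ℂ] nP 0}

/-- `V_r`. -/
def Vr : Submodule ℂ (Op2 q) :=
  Submodule.span ℂ {v | ∃ τ ∈ nonId q, v = nP 0 ⊗ₜ[ℂ] nP τ}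

/-- `V_l`. -/
def Vl : Submodule ℂ (Op2 q) :=
  Submodule.span ℂ {v | ∃ τ ∈ nonId q, v = nP τ ⊗ₜ[ℂ] nP 0}

/-- `V_d`, the diagonal sector. -/
def Vdiag : Submodule ℂ (Op2 q) :=
  Submodule.span ℂ {v | ∃ τ ∈ nonId q, v = nP τ ⊗ₜ[ℂ] nP τ}

/-- `V_[S]`, the symmetric commuting sector. -/
def VsymComm : Submodule ℂ (Op2 q) :=
  Submodule.span ℂ {v | ∃ τ ∈ nonId q, ∃ σ ∈ commOther τ, v = symT (nP σ) (nP τ)}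

/-- `V_{S}`, the symmetric anti-commuting sector. -/
def VsymAnti : Submodule ℂ (Op2 q) :=
  Submodule.span ℂ {v | ∃ τ ∈ nonId q, ∃ σ ∈ antiComm τ, v = symT (nP σ) (nP τ)}

/-- `V_[A]`, the antisymmetric commuting sector. -/
def ValtComm : Submodule ℂ (Op2 q) :=
  Submodule.span ℂ {v | ∃ τ ∈ nonId q, ∃ σ ∈ commOther τ, v = altT (nP σ) (nP τ)}

/-- `V_{A}`, the antisymmetric anti-commuting sector. -/
def ValtAnti : Submodule ℂ (Op2 q) :=
  Submodule.span ℂ {v | ∃ τ ∈ nonId q, ∃ σ ∈ antiComm τ, v = altT (nP σ) (nP τ)}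

/-- `V_0`. -/
def V0 : Submodule ℂ (Op2 q) :=
  Submodule.span ℂ {v | v ∈ Vdiag q ∧
    v = ((Real.sqrt ((2 ^ q) ^ 2 - 1) : ℝ) : ℂ)⁻¹ • ∑ σ ∈ nonId q, nP σ ⊗ₜ[ℂ] nP σ}

/-- `V_1`. -/
def V1 : Submodule ℂ (Op2 q) :=
  Submodule.span ℂ {v | v ∈ Vdiag q ∧ ∃ c : PauliString q → ℂ,
    v = ∑ σ ∈ nonId q, c σ • (nP σ ⊗ₜ[ℂ] nP σ) ∧
    ∑ σ ∈ nonId q, c σ = 0 ∧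
    ∀ τ ∈ nonId q, ∑ σ ∈ antiComm τ, c σ = -(dim q / 2) * c τ}

/-- `V_2`. -/
def V2 : Submodule ℂ (Op2 q) :=
  Submodule.span ℂ {v | v ∈ Vdiag q ∧ ∃ c : PauliString q → ℂ,
    v = ∑ σ ∈ nonId q, c σ • (nP σ ⊗ₜ[ℂ] nP σ) ∧
    ∑ σ ∈ nonId q, c σ = 0 ∧
    ∀ τ ∈ nonId q, ∑ σ ∈ antiComm τ, c σ = (dim q / 2) * c τ}

/-- `V_[adj]`, the symmetric adjoint space. -/
def VadjComm : Submodule ℂ (Op2 q) :=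
  Submodule.span ℂ {v | v ∈ VsymComm q ∧ ∃ τ ∈ nonId q,
    v = ((Real.sqrt (2 * (commOther τ).card) : ℝ) : ℂ)⁻¹ •
      ∑ σ ∈ commOther τ, symT (nP σ) (nMul σ τ)}

/-- `V_{adj}`, the antisymmetric adjoint space. -/
def VadjAnti : Submodule ℂ (Op2 q) :=
  Submodule.span ℂ {v | v ∈ ValtAnti q ∧ ∃ τ ∈ nonId q,
    v = ((Real.sqrt (2 * (antiComm τ).card) : ℝ) : ℂ)⁻¹ •
      ∑ σ ∈ antiComm τ, altT (nP σ) (Complex.I • nMul σ τ)}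

/-- `V^⊥_{adj}`, the orthogonal complement of `V_{adj}` in `V_{A}`. -/
def VadjAntiPerp : Submodule ℂ (Op2 q) where
  carrier := {v | v ∈ ValtAnti q ∧ ∀ w ∈ VadjAnti q, hsInner w v = 0}
  zero_mem' := ⟨zero_mem _, fun w _ => by simp [hsInner]⟩
  add_mem' := by
    rintro v v' ⟨hv, hv0⟩ ⟨hv', hv0'⟩
    refine ⟨add_mem hv hv', fun w hw => ?_⟩
    have h := hv0 w hw
    have h' := hv0' w hw
    simp only [hsInner] at h h' ⊢
    rw [map_add, mul_add, Matrix.trace_add, h, h', add_zero]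
  smul_mem' := by
    rintro c v ⟨hv, hv0⟩
    refine ⟨Submodule.smul_mem _ c hv, fun w hw => ?_⟩
    have h := hv0 w hw
    simp only [hsInner] at h ⊢
    rw [map_smul, Matrix.mul_smul, Matrix.trace_smul, h, smul_zero]

variable {q} in
/-- `V_[1]^τ`. -/
def VsymComm1At (τ : PauliString q) : Submodule ℂ (Op2 q) :=
  Submodule.span ℂ {v | v ∈ VsymComm q ∧ ∃ c : PauliString q → ℂ,
    v = ∑ σ ∈ commOther τ, c σ • symT (nP σ) (nMul σ τ) ∧
    ∀ ν ∈ commOther τ, ∑ σ ∈ commOther τ ∩ antiComm ν, c σ = -(dim q / 2) * c ν}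

variable {q} in
/-- `V_[2]^τ`. -/
def VsymComm2At (τ : PauliString q) : Submodule ℂ (Op2 q) :=
  Submodule.span ℂ {v | v ∈ VsymComm q ∧ ∃ c : PauliString q → ℂ,
    v = ∑ σ ∈ commOther τ, c σ • symT (nP σ) (nMul σ τ) ∧
    ∀ ν ∈ commOther τ, ∑ σ ∈ commOther τ ∩ antiComm ν, c σ = (dim q / 2) * c ν}

/-- `V_[1]`. -/
def VsymComm1 : Submodule ℂ (Op2 q) := ⨆ τ ∈ nonId q, VsymComm1At τ

/-- `V_[2]`. -/
def VsymComm2 : Submodule ℂ (Op2 q) := ⨆ τ ∈ nonId q, VsymComm2At τ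

variable {q} in
/-- `V_{1}^τ`. -/
def VsymAnti1At (τ : PauliString q) : Submodule ℂ (Op2 q) :=
  Submodule.span ℂ {v | v ∈ VsymAnti q ∧ ∃ c : PauliString q → ℂ,
    v = ∑ σ ∈ antiComm τ, c σ • symT (nP σ) (Complex.I • nMul σ τ) ∧
    ∀ ν ∈ antiComm τ,
      ∑ σ ∈ antiComm τ ∩ commAll ν, c σ - ∑ σ ∈ antiComm τ ∩ antiComm ν, c σ = dim q * c ν}

variable {q} in
/-- `V_{2}^τ`. -/
def VsymAnti2At (τ : PauliString q) : Submodule ℂ (Op2 q) :=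
  Submodule.span ℂ {v | v ∈ VsymAnti q ∧ ∃ c : PauliString q → ℂ,
    v = ∑ σ ∈ antiComm τ, c σ • symT (nP σ) (Complex.I • nMul σ τ) ∧
    ∀ ν ∈ antiComm τ,
      ∑ σ ∈ antiComm τ ∩ commAll ν, c σ - ∑ σ ∈ antiComm τ ∩ antiComm ν, c σ = -dim q * c ν}

/-- `V_{1}`. -/
def VsymAnti1 : Submodule ℂ (Op2 q) := ⨆ τ ∈ nonId q, VsymAnti1At τ

/-- `V_{2}`. -/
def VsymAnti2 : Submodule ℂ (Op2 q) := ⨆ τ ∈ nonId q, VsymAnti2At τ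

end

/-! ### Decompositions into irreducible subrepresentations -/

/-- Names for the equivalence classes of the irreducible subrepresentations. -/
inductive IrrepClass : Type
  | triv | adjoint | diag1 | diag2 | symComm1 | symComm2 | symAnti | symAnti1 | symAnti2 | alt

/-- The space of `ρ` is the internal direct sum of the subspaces `W i`, each `W i` carries an
irreducible subrepresentation, and the subrepresentations carried by `W i` and `W j` are
equivalent if and only if `cls i = cls j`. -/
def IsIrreducibleDecomposition {G V : Type*} [Group G] [AddCommGroup V] [Module ℂ V]
    (ρ : Representation ℂ G V) {m : ℕ} (W : Fin m → Submodule ℂ V)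
    (cls : Fin m → IrrepClass) : Prop :=
  DirectSum.IsInternal W ∧
  ∃ S : Fin m → Subrepresentation ρ,
    (∀ i, (S i).toSubmodule = W i) ∧
    (∀ i, (S i).toRepresentation.IsIrreducible) ∧
    ∀ i j, Nonempty ((S i).toRepresentation.Equiv (S j).toRepresentation) ↔ cls i = cls j

end Clifford

end

open scoped TensorProduct

noncomputable section

namespace Clifford

/-! ### Symplectic labels of Pauli operators -/

/-! Label the Pauli operators `P_σ` by vectors `σ` of the symplectic space `F₂^{2q}`; two of them
commute exactly when `sp` vanishes on their labels. A Clifford unitary permutes the `P_σ`, up to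
signs, by a symplectic map. The basis `twin τ σ` of the two-copy space is proportional to `P_σ ⊗
P_{σ+τ}`, with the second factor normalised as a Hermitian product of `P_σ` and `P_τ`. With this
choice the signs of the two factors combine to a sign that depends on `τ` alone
(`ActsBy.hermSign_map`). In coordinates `f τ σ` the representation is therefore monomial
(`IsMonomial`): it moves both labels by the same symplectic map and multiplies by a factor depending
on `τ`.

Conjugation by Pauli operators multiplies the fibre over `τ` by a character determined by `τ`, so an
invariant subspace is the sum of its fibres (`IsMonomial.single_mem`). The quarter turns `(1 +
iP)/√2` act by symplectic transvections, which are transitive on non-zero `τ`, and carry no sign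
over `τ` when `P` commutes with `P_τ`. Everything reduces to functions `k` on labels, under the
transvections fixing one `τ`: once for `τ = 0` and once for `τ ≠ 0`.

On a fibre the support of `k` splits into `{0}`, `{τ}` and the remaining labels commuting or
anticommuting with `τ`. On either of the last two sets there are the constants, and among functions
of zero sum one separates the two parities under translation by `τ`. For one parity the symplectic
Fourier transform, which commutes with all symplectic maps and has square `4^q`, splits the space
further into its eigenspaces for `±2^q`; for the other parity it carries the commuting part to the
anticommuting part. These are the `Kind`s, and they give fourteen sectors (`iSupIndep_sectorAt`,
`iSup_sectorAt`).

Each kind is irreducible by a multiplicity-one argument (`Kind.space_le`): a function of a given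
kind that is invariant under the transvections fixing `τ` and a label `ρ` of the support is
determined by its value at `ρ` (`Kind.eq_zero_of_invariant`). Two orthogonal invariant subspaces
would both contain such a function with value `1` at `ρ`, hence the same one, which would be
orthogonal to itself.

Equivalences come from two families of intertwiners: spreading the value at `σ = 0` over another
support, and the Fourier transform. Inequivalences come from invariants that an equivalence must
preserve (`IsMonomial.eq_of_isEquivariant`): whether `τ = 0`, the scalar by which the sum of the
transvections fixing `τ` acts, and the scalar of the transvection along `τ`.

Finally the sectors are matched with the subspaces of the theorem. Swapping tensor factors
translates `σ` by `τ` with a sign, so symmetry types become parities, and the stated linear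
conditions become Fourier eigenvalue equations. For one or two qubits some sectors vanish because
few labels commute with two given ones (`mem_of_perp`). -/

/-- Labels of the Pauli operators by vectors of a symplectic space over `ZMod 2`. -/
abbrev Lab (q : ℕ) : Type := Fin q → ZMod 2 × ZMod 2

/-- The symplectic form on labels. -/
def sp {q : ℕ} (σ τ : Lab q) : ZMod 2 := ∑ j, ((σ j).1 * (τ j).2 + (σ j).2 * (τ j).1)

section labels
variable {q : ℕ}

theorem sp_comm (σ τ : Lab q) : sp σ τ = sp τ σ :=
  Finset.sum_congr rfl fun _ _ => by ring

@[simp] theorem sp_add_left (σ σ' τ : Lab q) : sp (σ + σ') τ = sp σ τ + sp σ' τ := by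
  simp only [sp, ← Finset.sum_add_distrib]
  exact Finset.sum_congr rfl fun _ _ => by simp; ring

@[simp] theorem sp_add_right (σ τ τ' : Lab q) : sp σ (τ + τ') = sp σ τ + sp σ τ' := by
  rw [sp_comm, sp_add_left, sp_comm τ, sp_comm τ']

@[simp] theorem sp_smul_left (c : ZMod 2) (σ τ : Lab q) : sp (c • σ) τ = c * sp σ τ := by
  simp only [sp, Finset.mul_sum]
  exact Finset.sum_congr rfl fun _ _ => by simp; ring

@[simp] theorem sp_smul_right (c : ZMod 2) (σ τ : Lab q) : sp σ (c • τ) = c * sp σ τ := by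
  rw [sp_comm, sp_smul_left, sp_comm]

theorem ZMod2.add_self (a : ZMod 2) : a + a = 0 := by revert a; decide

theorem ZMod2.cases (a : ZMod 2) : a = 0 ∨ a = 1 := by revert a; decide

@[simp] theorem Lab.add_self (σ : Lab q) : σ + σ = 0 := by
  ext j <;> exact ZMod2.add_self _

@[simp] theorem Lab.add_add_self (σ τ : Lab q) : σ + τ + τ = σ := by
  rw [add_assoc, Lab.add_self, add_zero]

theorem Lab.add_eq_iff {σ τ ν : Lab q} : σ + τ = ν ↔ σ = ν + τ := by
  constructor <;> rintro rfl <;> simp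

@[simp] theorem sp_self (σ : Lab q) : sp σ σ = 0 := by
  refine Finset.sum_eq_zero fun j _ => ?_
  rw [mul_comm (σ j).2]
  exact ZMod2.add_self _

@[simp] theorem sp_zero_left (σ : Lab q) : sp 0 σ = 0 := by simp [sp]

@[simp] theorem sp_zero_right (σ : Lab q) : sp σ 0 = 0 := by simp [sp]

/-- The functional `η ↦ sp η ν`. -/
def spL (ν : Lab q) : Lab q →ₗ[ZMod 2] ZMod 2 where
  toFun η := sp η ν
  map_add' _ _ := sp_add_left _ _ _
  map_smul' _ _ := sp_smul_left _ _ _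

theorem eq_zero_of_sp {ν : Lab q} (h : ∀ η, sp η ν = 0) : ν = 0 := by
  funext j
  have h1 := h (Pi.single j (1, 0))
  have h2 := h (Pi.single j (0, 1))
  rw [sp, Finset.sum_eq_single j (fun i _ hi => by simp [hi]) (by simp)] at h1 h2
  ext <;> simp_all

theorem eq_of_sp {ν ν' : Lab q} (h : ∀ η, sp η ν = sp η ν') : ν = ν' := by
  have : ν + ν' = 0 := eq_zero_of_sp fun η => by rw [sp_add_right, h, ZMod2.add_self]
  rw [Lab.add_eq_iff, zero_add] at this
  exact this

theorem exists_sp_eq_one {ν : Lab q} (h : ν ≠ 0) : ∃ η, sp η ν = 1 := by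
  by_contra! h'
  exact h (eq_zero_of_sp fun η => (ZMod2.cases _).resolve_right (h' η))

/-- If no such `η` exists, the functional `sp · ν` vanishes on the common kernel of `sp · τ` and `sp
· ρ`, so it is a combination of them. By nondegeneracy `ν` is then in the span of `τ` and `ρ`, which
over `ZMod 2` has only the four excluded elements. -/
theorem exists_perp {τ ρ ν : Lab q} (h0 : ν ≠ 0) (h1 : ν ≠ τ) (h2 : ν ≠ ρ) (h3 : ν ≠ ρ + τ) :
    ∃ η, sp η τ = 0 ∧ sp η ρ = 0 ∧ sp η ν = 1 := by
  by_contra! h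
  have hs : spL ν ∈ Submodule.span (ZMod 2) (Set.range ![spL τ, spL ρ]) := by
    apply mem_span_of_iInf_ker_le_ker
    intro η hη
    simp only [Submodule.mem_iInf, LinearMap.mem_ker] at hη
    exact (ZMod2.cases _).resolve_right (h η (hη 0) (hη 1))
  simp only [Matrix.range_cons, Matrix.range_empty, Set.union_empty, Set.singleton_union] at hs
  obtain ⟨a, b, hab⟩ := Submodule.mem_span_pair.mp hs
  have hν : a • τ + b • ρ = ν := eq_of_sp fun η => by
    rw [sp_add_right, sp_smul_right, sp_smul_right]
    exact LinearMap.congr_fun hab η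
  rcases ZMod2.cases a with rfl | rfl <;> rcases ZMod2.cases b with rfl | rfl <;>
    simp at hν
  · exact h0 hν.symm
  · exact h2 hν.symm
  · exact h1 hν.symm
  · exact h3 (by rw [← hν, add_comm])

/-! ### Transvections and their orbits on labels -/

/-- The transvection with direction `P`. -/
def transv (P : Lab q) (σ : Lab q) : Lab q := σ + sp P σ • P

theorem transv_of_eq_zero {P σ : Lab q} (h : sp P σ = 0) : transv P σ = σ := by
  simp [transv, h]

theorem transv_of_eq_one {P σ : Lab q} (h : sp P σ = 1) : transv P σ = σ + P := by
  simp [transv, h]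

@[simp] theorem sp_transv_left (P σ ν : Lab q) : sp (transv P σ) ν = sp σ ν + sp P σ * sp P ν := by
  simp [transv]

@[simp] theorem sp_transv_right (P σ ν : Lab q) :
    sp σ (transv P ν) = sp σ ν + sp P ν * sp P σ := by
  rw [sp_comm, sp_transv_left, sp_comm ν]

@[simp] theorem transv_transv (P σ : Lab q) : transv P (transv P σ) = σ := by
  rw [transv, sp_transv_right]
  simp [transv, add_assoc, ← add_smul, ZMod2.add_self]

theorem sp_transv_transv (P σ ν : Lab q) : sp (transv P σ) (transv P ν) = sp σ ν := by
  rw [sp_transv_left, sp_transv_right, sp_transv_right, sp_self, mul_zero, add_zero, add_assoc,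
    mul_comm (sp P σ), ZMod2.add_self, add_zero]

theorem transv_add (P σ ν : Lab q) : transv P (σ + ν) = transv P σ + transv P ν := by
  simp only [transv, sp_add_right, add_smul]
  abel

/-- The transvection as a permutation of the labels. -/
def transvEquiv (P : Lab q) : Lab q ≃+ Lab q where
  toFun := transv P
  invFun := transv P
  left_inv := transv_transv P
  right_inv := transv_transv P
  map_add' := transv_add P

/-- A function that is invariant under the transvections that fix `τ` and `ρ` takes the same value
at two labels outside of `{0, τ, ρ, ρ + τ}` with the same products with `τ` and `ρ`. -/
theorem eq_of_invariant {α : Sort*} {τ ρ ν ν' : Lab q} (k : Lab q → α)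
    (hk : ∀ P, sp P τ = 0 → sp P ρ = 0 → ∀ ν, k (transv P ν) = k ν)
    (hτ : sp ν τ = sp ν' τ) (hρ : sp ν ρ = sp ν' ρ)
    (h0 : ν ≠ 0) (h1 : ν ≠ τ) (h2 : ν ≠ ρ) (h3 : ν ≠ ρ + τ)
    (h0' : ν' ≠ 0) (h1' : ν' ≠ τ) (h2' : ν' ≠ ρ) (h3' : ν' ≠ ρ + τ) : k ν = k ν' := by
  -- If `ν` and `ν'` anticommute, the transvection along `ν + ν'` sends `ν` to `ν'`. Equality of the
  -- products with `τ` and `ρ` says that this direction commutes with both.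
  have join : ∀ ν ν' : Lab q, sp ν τ = sp ν' τ → sp ν ρ = sp ν' ρ → sp ν ν' = 1 → k ν = k ν' := by
    intro ν ν' hτ hρ h
    have h' := hk (ν + ν') (by rw [sp_add_left, hτ, ZMod2.add_self])
      (by rw [sp_add_left, hρ, ZMod2.add_self]) ν
    rw [transv_of_eq_one (by simp [sp_comm ν', h])] at h'
    rw [← h', ← add_assoc, Lab.add_self, zero_add]
  rcases ZMod2.cases (sp ν ν') with h | h
  -- Commuting `ν` and `ν'` are joined through `ν + η`, which anticommutes with both. If the
  -- witnesses for `ν` and for `ν'` each detect only one of the two labels, their sum detects both.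
  · have : ∃ η, sp η τ = 0 ∧ sp η ρ = 0 ∧ sp η ν = 1 ∧ sp η ν' = 1 := by
      obtain ⟨η, a, b, c⟩ := exists_perp h0 h1 h2 h3
      obtain ⟨η', a', b', c'⟩ := exists_perp h0' h1' h2' h3'
      rcases ZMod2.cases (sp η ν') with e | e
      · rcases ZMod2.cases (sp η' ν) with e' | e'
        · exact ⟨η + η', by simp [a, a'], by simp [b, b'], by simp [c, e'], by simp [e, c']⟩
        · exact ⟨η', a', b', e', c'⟩
      · exact ⟨η, a, b, c, e⟩
    obtain ⟨η, a, b, c, e⟩ := this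
    refine (join ν (ν + η) (by simp [a]) (by simp [b]) (by simp [sp_comm ν, c])).trans
      (join _ _ (by simp [a, hτ]) (by simp [b, hρ]) (by simp [h, e]))
  · exact join ν ν' hτ hρ h

/-! ### Characters -/

/-- The character `(-1) ^ sp σ τ`. -/
def chi (σ τ : Lab q) : ℂ := if sp σ τ = 0 then 1 else -1

theorem chi_eq_one {σ τ : Lab q} (h : sp σ τ = 0) : chi σ τ = 1 := if_pos h

theorem chi_eq_neg_one {σ τ : Lab q} (h : sp σ τ = 1) : chi σ τ = -1 := by simp [chi, h]

theorem chi_comm (σ τ : Lab q) : chi σ τ = chi τ σ := by rw [chi, sp_comm, chi]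

theorem chi_add_left (σ σ' τ : Lab q) : chi (σ + σ') τ = chi σ τ * chi σ' τ := by
  simp only [chi, sp_add_left]
  rcases ZMod2.cases (sp σ τ) with h | h <;> rcases ZMod2.cases (sp σ' τ) with h' | h' <;>
    simp [h, h', ZMod2.add_self]

theorem chi_add_right (σ τ τ' : Lab q) : chi σ (τ + τ') = chi σ τ * chi σ τ' := by
  rw [chi_comm, chi_add_left, chi_comm τ, chi_comm τ']

@[simp] theorem chi_zero_left (τ : Lab q) : chi 0 τ = 1 := by simp [chi]

@[simp] theorem chi_zero_right (τ : Lab q) : chi τ 0 = 1 := by simp [chi]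

@[simp] theorem chi_self (τ : Lab q) : chi τ τ = 1 := by simp [chi]

@[simp] theorem chi_mul_self (σ τ : Lab q) : chi σ τ * chi σ τ = 1 := by
  rw [chi]; split_ifs <;> simp

theorem chi_eq_chi {σ τ σ' τ' : Lab q} : chi σ τ = chi σ' τ' ↔ sp σ τ = sp σ' τ' := by
  rcases ZMod2.cases (sp σ τ) with h | h <;> rcases ZMod2.cases (sp σ' τ') with h' | h' <;>
    norm_num [chi, h, h']

theorem sum_chi (ν : Lab q) : ∑ σ, chi σ ν = if ν = 0 then 4 ^ q else 0 := by
  split_ifs with h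
  · subst h
    simp
  · obtain ⟨η, hη⟩ := exists_sp_eq_one h
    have : ∑ σ, chi σ ν = ∑ σ, chi (σ + η) ν :=
      (Equiv.sum_comp (Equiv.addRight η) fun σ => chi σ ν).symm
    simp only [chi_add_left, chi_eq_neg_one hη, mul_neg_one, Finset.sum_neg_distrib] at this
    linear_combination this / 2

theorem sum_one : ∑ _σ : Lab q, (1 : ℂ) = 4 ^ q := by simp

/-- The symplectic Fourier transform. -/
def fourier (k : Lab q → ℂ) (ν : Lab q) : ℂ := ∑ σ, chi σ ν * k σ

/-- Orthogonality of characters. The absence of a reflection `ν ↦ -ν` is due to characteristic two,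
and it leaves `±2^q` as the only possible eigenvalues. -/
theorem fourier_fourier (k : Lab q → ℂ) (ν : Lab q) : fourier (fourier k) ν = 4 ^ q * k ν := by
  simp only [fourier, Finset.mul_sum]
  rw [Finset.sum_comm]
  have : ∀ σ, ∑ μ, chi μ ν * (chi σ μ * k σ) = if σ = ν then 4 ^ q * k σ else 0 := by
    intro σ
    have h : ∀ μ, chi μ ν * (chi σ μ * k σ) = chi μ (σ + ν) * k σ := fun μ => by
      rw [chi_add_right, chi_comm σ]; ring
    simp only [h]
    rw [← Finset.sum_mul, sum_chi]
    simp only [Lab.add_eq_iff, zero_add, ite_mul, zero_mul]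
  simp [this]

theorem fourier_zero (k : Lab q → ℂ) : fourier k 0 = ∑ σ, k σ := by simp [fourier]

theorem fourier_add (k k' : Lab q → ℂ) (ν : Lab q) :
    fourier (k + k') ν = fourier k ν + fourier k' ν := by
  simp [fourier, mul_add, Finset.sum_add_distrib]

theorem fourier_smul (c : ℂ) (k : Lab q → ℂ) (ν : Lab q) :
    fourier (c • k) ν = c * fourier k ν := by
  simp only [fourier, Finset.mul_sum]
  exact Finset.sum_congr rfl fun σ _ => by simp; ring

/-- If `k (σ + τ) = s * k σ` with `s ≠ chi τ ν` then the Fourier transform vanishes at `ν`. -/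
theorem fourier_eq_zero {k : Lab q → ℂ} {τ ν : Lab q} {s : ℂ} (h : ∀ σ, k (σ + τ) = s * k σ)
    (hs : chi τ ν * s = -1) : fourier k ν = 0 := by
  have : fourier k ν = ∑ σ, chi (σ + τ) ν * k (σ + τ) :=
    (Equiv.sum_comp (Equiv.addRight τ) fun σ => chi σ ν * k σ).symm
  have h' : ∀ σ, chi (σ + τ) ν * k (σ + τ) = -(chi σ ν * k σ) := fun σ => by
    rw [h, chi_add_left]; linear_combination chi σ ν * k σ * hs
  simp only [h', Finset.sum_neg_distrib] at this
  rw [← fourier] at this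
  linear_combination this / 2

/-- Symplectic permutations preserve the kernel `chi`. This makes the transform an intertwiner and
its eigenspaces invariant. -/
theorem fourier_comp {k : Lab q → ℂ} (g : Lab q ≃ Lab q) (hg : ∀ x y, sp (g x) (g y) = sp x y)
    (ν : Lab q) : fourier (fun σ => k (g σ)) ν = fourier k (g ν) := by
  rw [fourier, fourier, ← Equiv.sum_comp g fun σ => chi σ (g ν) * k σ]
  exact Finset.sum_congr rfl fun σ _ => by rw [chi, chi, hg]

/-- The number of labels commuting with `τ` and `ν`, where `τ`, `ν`, `ν + τ` are non-zero. -/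
theorem sum_perp_perp {τ ν : Lab q} (hν : ν ≠ 0) (hντ : ν ≠ τ) :
    ∑ P, (if sp P τ = 0 ∧ sp P ν = 0 then (1 : ℂ) else 0) =
      (if τ = 0 then 4 ^ q / 2 else 4 ^ q / 4) := by
  have h : ∀ P, (if sp P τ = 0 ∧ sp P ν = 0 then (1 : ℂ) else 0) =
      (1 + chi P τ + chi P ν + chi P (ν + τ)) / 4 := by
    intro P
    rw [chi_add_right]
    rcases ZMod2.cases (sp P τ) with h | h <;> rcases ZMod2.cases (sp P ν) with h' | h' <;>
      norm_num [chi, h, h']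
  simp only [h]
  rw [← Finset.sum_div, Finset.sum_add_distrib, Finset.sum_add_distrib, Finset.sum_add_distrib]
  simp only [sum_chi, Lab.add_eq_iff, hν, hντ, zero_add, sum_one, if_false]
  split_ifs <;> ring

theorem sum_perp (τ : Lab q) :
    ∑ P, (if sp P τ = 0 then (1 : ℂ) else 0) = (if τ = 0 then 4 ^ q else 4 ^ q / 2) := by
  have h : ∀ P, (if sp P τ = 0 then (1 : ℂ) else 0) = (1 + chi P τ) / 2 := by
    intro P
    rcases ZMod2.cases (sp P τ) with h | h <;> norm_num [chi, h]
  simp only [h]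
  rw [← Finset.sum_div, Finset.sum_add_distrib]
  simp only [sum_chi, sum_one]
  split_ifs <;> ring

end labels

/-! ### Kinds of functions on labels: the candidates for the irreducible parts of one fibre -/

section kinds
variable {q : ℕ}

/-- The labels other than `0` and `τ` whose product with `τ` is `b`. -/
def Orb (τ : Lab q) (b : ZMod 2) (σ : Lab q) : Prop := sp σ τ = b ∧ σ ≠ 0 ∧ σ ≠ τ

instance (τ : Lab q) (b : ZMod 2) : DecidablePred (Orb τ b) :=
  fun _ => inferInstanceAs (Decidable (_ ∧ _ ∧ _))

theorem orb_one {τ σ : Lab q} : Orb τ 1 σ ↔ sp σ τ = 1 := by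
  refine ⟨fun h => h.1, fun h => ⟨h, ?_, ?_⟩⟩ <;> rintro rfl <;> simp at h

theorem Orb.add {τ σ : Lab q} {b : ZMod 2} (h : Orb τ b σ) : Orb τ b (σ + τ) := by
  refine ⟨by simp [h.1], ?_, ?_⟩
  · rw [Ne, Lab.add_eq_iff, zero_add]; exact h.2.2
  · rw [Ne, Lab.add_eq_iff, Lab.add_self]; exact h.2.1

theorem orb_add_iff {τ σ : Lab q} {b : ZMod 2} : Orb τ b (σ + τ) ↔ Orb τ b σ :=
  ⟨fun h => by simpa using h.add, Orb.add⟩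

theorem orb_zero_right {σ : Lab q} : ¬ Orb (0 : Lab q) 1 σ := fun h => by simpa using h.1

/-- The sign `(-1) ^ b` for `e ≠ 0`, and `-(-1) ^ b` for `e = 0`. -/
def parity (b : ZMod 2) (e : ℤ) : ℂ := (if b = 0 then 1 else -1) * (if e = 0 then -1 else 1)

theorem parity_mul_self (b : ZMod 2) (e : ℤ) : parity b e * parity b e = 1 := by
  rw [parity]; split_ifs <;> norm_num

/-- The types of the subspaces into which functions on labels are decomposed. -/
inductive Kind : Type
  | point0 | pointT | const (b : ZMod 2) | spec (b : ZMod 2) (e : ℤ)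

/-- The support of the functions of a given kind. -/
def Kind.Supp (τ : Lab q) : Kind → Lab q → Prop
  | .point0, σ => σ = 0
  | .pointT, σ => σ = τ
  | .const b, σ => Orb τ b σ
  | .spec b _, σ => Orb τ b σ

/-- The condition that distinguishes the functions of a given kind. -/
def Kind.Cond (τ : Lab q) : Kind → (Lab q → ℂ) → Prop
  | .point0, _ => True
  | .pointT, _ => True
  | .const b, k => ∀ σ σ', Orb τ b σ → Orb τ b σ' → k σ = k σ'
  | .spec b e, k => (∀ σ, k (σ + τ) = parity b e * k σ) ∧ ∑ σ, k σ = 0 ∧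
      ∀ ν, Orb τ b ν → fourier k ν = e * 2 ^ q * k ν

/-- The functions on labels of a given kind. -/
def Kind.space (κ : Kind) (τ : Lab q) : Submodule ℂ (Lab q → ℂ) where
  carrier := {k | (∀ σ, ¬ κ.Supp τ σ → k σ = 0) ∧ κ.Cond τ k}
  zero_mem' := by
    refine ⟨fun _ _ => rfl, ?_⟩
    cases κ <;> simp [Kind.Cond, fourier]
  add_mem' := by
    rintro k k' ⟨h, h1⟩ ⟨h', h1'⟩
    refine ⟨fun σ hσ => by simp [h σ hσ, h' σ hσ], ?_⟩
    cases κ with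
    | point0 => trivial
    | pointT => trivial
    | const b => exact fun σ σ' a a' => by simp [h1 σ σ' a a', h1' σ σ' a a']
    | spec b e =>
      refine ⟨fun σ => by simp [h1.1 σ, h1'.1 σ, mul_add], ?_, fun ν hν => ?_⟩
      · simp [Finset.sum_add_distrib, h1.2.1, h1'.2.1]
      · rw [fourier_add, h1.2.2 ν hν, h1'.2.2 ν hν, Pi.add_apply, mul_add]
  smul_mem' := by
    rintro c k ⟨h, h1⟩
    refine ⟨fun σ hσ => by simp [h σ hσ], ?_⟩
    cases κ with
    | point0 => trivial
    | pointT => trivial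
    | const b => exact fun σ σ' a a' => by simp [h1 σ σ' a a']
    | spec b e =>
      refine ⟨fun σ => by simp [h1.1 σ, mul_left_comm], ?_, fun ν hν => ?_⟩
      · simp [← Finset.mul_sum, h1.2.1]
      · rw [fourier_smul, h1.2.2 ν hν, Pi.smul_apply, smul_eq_mul, mul_left_comm]

theorem orb_map {τ σ : Lab q} {b : ZMod 2} (g : Lab q ≃+ Lab q)
    (hg : ∀ x y, sp (g x) (g y) = sp x y) : Orb (g τ) b (g σ) ↔ Orb τ b σ := by
  simp [Orb, hg]

theorem Kind.supp_map {κ : Kind} {τ σ : Lab q} (g : Lab q ≃+ Lab q)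
    (hg : ∀ x y, sp (g x) (g y) = sp x y) : κ.Supp (g τ) (g σ) ↔ κ.Supp τ σ := by
  cases κ <;> simp [Kind.Supp, orb_map g hg]

/-- Every condition that defines a kind is phrased through `sp`, translation by `τ`, total sums and
the Fourier transform, all of which are transported by an additive symplectic map. -/
theorem Kind.comp_mem_space {κ : Kind} {τ : Lab q} {k : Lab q → ℂ} (g : Lab q ≃+ Lab q)
    (hg : ∀ x y, sp (g x) (g y) = sp x y) (hk : k ∈ κ.space (g τ)) :
    (fun σ => k (g σ)) ∈ κ.space τ := by
  refine ⟨fun σ hσ => hk.1 _ (by rwa [Kind.supp_map g hg]), ?_⟩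
  have h := hk.2
  cases κ with
  | point0 => trivial
  | pointT => trivial
  | const b => exact fun σ σ' a a' => h _ _ ((orb_map g hg).2 a) ((orb_map g hg).2 a')
  | spec b e =>
    refine ⟨fun σ => by simp [h.1], ?_, fun ν hν => ?_⟩
    · rw [← h.2.1]
      exact Equiv.sum_comp g.toEquiv k
    · have := fourier_comp (k := k) g.toEquiv hg ν
      exact this.trans (h.2.2 _ ((orb_map g hg).2 hν))

theorem Kind.transv_mem_space {κ : Kind} {τ : Lab q} {k : Lab q → ℂ} {P : Lab q}
    (hP : sp P τ = 0) (hk : k ∈ κ.space τ) : (fun σ => k (transv P σ)) ∈ κ.space τ :=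
  Kind.comp_mem_space (transvEquiv P) (sp_transv_transv P)
    (by rwa [show transvEquiv P τ = τ from transv_of_eq_zero hP])

theorem Orb.eq_of_invariant {α : Sort*} {τ ν ν' : Lab q} {b : ZMod 2} (k : Lab q → α)
    (hk : ∀ P, sp P τ = 0 → ∀ ν, k (transv P ν) = k ν) (h : Orb τ b ν) (h' : Orb τ b ν') :
    k ν = k ν' :=
  Clifford.eq_of_invariant (τ := τ) (ρ := 0) k (fun P hP _ => hk P hP) (h.1.trans h'.1.symm)
    (by simp) h.2.1 h.2.2 h.2.1 (by simpa using h.2.2) h'.2.1 h'.2.2 h'.2.1 (by simpa using h'.2.2)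

theorem Kind.eq_of_invariant {α : Sort*} {κ : Kind} {τ ν ν' : Lab q} (k : Lab q → α)
    (hk : ∀ P, sp P τ = 0 → ∀ ν, k (transv P ν) = k ν) (h : κ.Supp τ ν) (h' : κ.Supp τ ν') :
    k ν = k ν' := by
  cases κ with
  | point0 => rw [show ν = 0 from h, show ν' = 0 from h']
  | pointT => rw [show ν = τ from h, show ν' = τ from h']
  | const b => exact Orb.eq_of_invariant k hk h h'
  | spec b e => exact Orb.eq_of_invariant k hk h h'

/-- A function of a given kind that is invariant under the transvections fixing `τ` and `ρ` is
determined by its value at `ρ`. -/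
theorem Kind.eq_zero_of_invariant {κ : Kind} {τ ρ : Lab q} {k : Lab q → ℂ} (hk : k ∈ κ.space τ)
    (hρ : κ.Supp τ ρ) (hinv : ∀ P, sp P τ = 0 → sp P ρ = 0 → ∀ ν, k (transv P ν) = k ν)
    (h0 : k ρ = 0) : k = 0 := by
  have hs := hk.1
  funext ν
  by_cases hν : κ.Supp τ ν
  swap
  · exact hs ν hν
  have hc := hk.2
  cases κ with
  | point0 => rw [show ν = 0 from hν, ← show ρ = 0 from hρ, h0]; rfl
  | pointT => rw [show ν = τ from hν, ← show ρ = τ from hρ, h0]; rfl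
  | const b => rw [hc ν ρ hν hρ, h0]; rfl
  | spec b e =>
    by_cases h1 : ν = ρ
    · rw [h1, h0]; rfl
    by_cases h2 : ν = ρ + τ
    · rw [h2, hc.1, h0, mul_zero]; rfl
    have hf := hc.2.2 ρ hρ
    rw [h0, mul_zero] at hf
    -- The total sum is zero, and the eigenvalue equation at `ρ` with `k ρ = 0` makes the transform
    -- at `ρ` zero. Half the sum or difference of the two isolates the labels with a prescribed
    -- product with `ρ`.
    have key : ∑ σ, (if sp σ ρ = sp ν ρ then k σ else 0) = 0 := by
      have : ∀ σ, (if sp σ ρ = sp ν ρ then k σ else 0) =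
          (k σ + chi ν ρ * (chi σ ρ * k σ)) / 2 := fun σ => by
        by_cases h : sp σ ρ = sp ν ρ
        · rw [if_pos h, chi_eq_chi.2 h]
          linear_combination (-k σ / 2) * chi_mul_self ν ρ
        · rw [if_neg h]
          have : chi ν ρ * chi σ ρ = -1 := by
            rcases ZMod2.cases (sp σ ρ) with a | a <;> rcases ZMod2.cases (sp ν ρ) with a' | a' <;>
              simp [chi, a, a'] at h ⊢
          linear_combination (-k σ / 2) * this
      simp only [this]
      rw [← Finset.sum_div, Finset.sum_add_distrib, ← Finset.mul_sum, hc.2.1]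
      rw [fourier] at hf
      rw [hf]
      simp
    -- Off `ρ` and `ρ + τ`, where `k` vanishes, invariance makes `k` constant on each half of the
    -- support. The sum in `key` is thus a natural number times `k ν`, and that number is positive
    -- because `ν` itself is counted.
    have hterm : ∀ σ, (if sp σ ρ = sp ν ρ then k σ else 0) =
        (if Orb τ b σ ∧ σ ≠ ρ ∧ σ ≠ ρ + τ ∧ sp σ ρ = sp ν ρ then (1 : ℕ) else 0) • k ν := by
      intro σ
      by_cases a : Orb τ b σ ∧ σ ≠ ρ ∧ σ ≠ ρ + τ ∧ sp σ ρ = sp ν ρ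
      · rw [if_pos a, if_pos a.2.2.2, one_smul]
        exact Clifford.eq_of_invariant k hinv (a.1.1.trans hν.1.symm) a.2.2.2 a.1.2.1 a.1.2.2
          a.2.1 a.2.2.1 hν.2.1 hν.2.2 h1 h2
      · rw [if_neg a, zero_smul]
        split_ifs with h
        · by_cases a1 : Orb τ b σ
          · by_cases a2 : σ = ρ
            · rw [a2, h0]
            · have a3 : σ = ρ + τ := by
                by_contra a3
                exact a ⟨a1, a2, a3, h⟩
              rw [a3, hc.1, h0, mul_zero]
          · exact hs σ a1
        · rfl
    simp only [hterm] at key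
    rw [← Finset.sum_smul, smul_eq_zero] at key
    refine key.resolve_left fun h => ?_
    have := (Finset.sum_eq_zero_iff.1 h) ν (Finset.mem_univ ν)
    rw [if_pos ⟨hν, h1, h2, rfl⟩] at this
    exact one_ne_zero this

/-! ### Irreducibility of each kind under the stabilizer of `τ` -/

theorem exists_add_orthogonal {ι : Type*} [Fintype ι] (S : Submodule ℂ (ι → ℂ)) (k : ι → ℂ) :
    ∃ y ∈ S, ∃ z, k = y + z ∧ ∀ s ∈ S, ∑ i, star (s i) * z i = 0 := by
  set e := WithLp.linearEquiv 2 ℂ (ι → ℂ)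
  obtain ⟨y, hy, z, hz, h⟩ :=
    (S.comap e.toLinearMap).exists_add_mem_mem_orthogonal (e.symm k)
  refine ⟨e y, hy, e z, ?_, fun s hs => ?_⟩
  · rw [← map_add, ← h, LinearEquiv.apply_symm_apply]
  · have := hz (e.symm s) (by simpa using hs)
    rw [PiLp.inner_apply] at this
    rw [← this]
    exact Finset.sum_congr rfl fun i _ => by simp [e, mul_comm]

theorem eq_zero_of_sum_star_mul {ι : Type*} [Fintype ι] {k : ι → ℂ}
    (h : ∑ i, star (k i) * k i = 0) : k = 0 := by
  have h' : ∑ i, Complex.normSq (k i) = 0 := by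
    have : ((∑ i, Complex.normSq (k i) : ℝ) : ℂ) = 0 := by
      rw [← h, Complex.ofReal_sum]
      exact Finset.sum_congr rfl fun i _ => Complex.normSq_eq_conj_mul_self
    exact_mod_cast this
  funext i
  exact Complex.normSq_eq_zero.1
    ((Finset.sum_eq_zero_iff_of_nonneg fun _ _ => Complex.normSq_nonneg _).1 h' i
      (Finset.mem_univ i))

/-- Averaging over the group generated by the transvections that fix `τ` and `ρ`. -/
theorem exists_invariant {S : Submodule ℂ (Lab q → ℂ)} {τ ρ : Lab q} {k : Lab q → ℂ}
    (hS : ∀ P, sp P τ = 0 → ∀ k ∈ S, (fun σ => k (transv P σ)) ∈ S) (hk : k ∈ S) (hρ : k ρ ≠ 0) :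
    ∃ a ∈ S, a ρ = 1 ∧ ∀ P, sp P τ = 0 → sp P ρ = 0 → ∀ ν, a (transv P ν) = a ν := by
  classical
  let T : Set (Equiv.Perm (Lab q)) :=
    {g | ∃ P, sp P τ = 0 ∧ sp P ρ = 0 ∧ g = (transvEquiv P).toEquiv}
  let Γ : Subgroup (Equiv.Perm (Lab q)) := Subgroup.closure T
  have hmem : ∀ g ∈ Γ, (∀ k ∈ S, (fun σ => k (g σ)) ∈ S) ∧ g ρ = ρ := by
    intro g hg
    induction hg using Subgroup.closure_induction'' with
    | mem g hg =>
      obtain ⟨P, h1, h2, rfl⟩ := hg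
      exact ⟨hS P h1, transv_of_eq_zero h2⟩
    | inv_mem g hg =>
      obtain ⟨P, h1, h2, rfl⟩ := hg
      exact ⟨hS P h1, transv_of_eq_zero h2⟩
    | one => exact ⟨fun k hk => hk, rfl⟩
    | mul g g' _ _ h h' =>
      exact ⟨fun k hk => h'.1 _ (h.1 k hk), by rw [Equiv.Perm.mul_apply, h'.2, h.2]⟩
  have hcard : (Fintype.card Γ : ℂ) * k ρ ≠ 0 :=
    mul_ne_zero (Nat.cast_ne_zero.2 Fintype.card_ne_zero) hρ
  refine ⟨((Fintype.card Γ : ℂ) * k ρ)⁻¹ • ∑ g : Γ, fun σ => k ((g : Equiv.Perm (Lab q)) σ),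
    S.smul_mem _ (S.sum_mem fun g _ => (hmem g g.2).1 k hk), ?_, fun P h1 h2 ν => ?_⟩
  · have : ∀ g : Γ, (g : Equiv.Perm (Lab q)) ρ = ρ := fun g => (hmem g g.2).2
    simp only [Pi.smul_apply, Finset.sum_apply, this]
    simp only [Finset.sum_const, Finset.card_univ, nsmul_eq_mul, smul_eq_mul]
    exact inv_mul_cancel₀ hcard
  · simp only [Pi.smul_apply, Finset.sum_apply]
    congr 1
    let t : Γ := ⟨(transvEquiv P).toEquiv, Subgroup.subset_closure ⟨P, h1, h2, rfl⟩⟩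
    exact Equiv.sum_comp (Equiv.mulRight t) fun g : Γ => k ((g : Equiv.Perm (Lab q)) ν)

/-- The space of functions of a given kind is irreducible under the transvections that fix `τ`. -/
theorem Kind.space_le {κ : Kind} {τ : Lab q} {S : Submodule ℂ (Lab q → ℂ)}
    (hS : ∀ P, sp P τ = 0 → ∀ k ∈ S, (fun σ => k (transv P σ)) ∈ S) (hle : S ≤ κ.space τ)
    (hne : S ≠ ⊥) : κ.space τ ≤ S := by
  have exist : ∀ S' : Submodule ℂ (Lab q → ℂ),
      (∀ P, sp P τ = 0 → ∀ k ∈ S', (fun σ => k (transv P σ)) ∈ S') → S' ≤ κ.space τ →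
      ∀ k ∈ S', k ≠ 0 → ∀ ρ, κ.Supp τ ρ → ∃ a ∈ S', a ρ = 1 ∧
        ∀ P, sp P τ = 0 → sp P ρ = 0 → ∀ ν, a (transv P ν) = a ν := by
    intro S' hS' hle' k hk hk0 ρ hρ
    obtain ⟨ν, hν⟩ := Function.ne_iff.1 hk0
    have hνs : κ.Supp τ ν := by
      by_contra h
      exact hν ((hle' hk).1 ν h)
    -- The set of labels at which some function of `S'` is non-zero is invariant, hence contains the
    -- whole support as soon as it meets it.
    have := Kind.eq_of_invariant (κ := κ) (fun ν => ∃ k ∈ S', k ν ≠ 0) (fun P hP ν => by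
      refine propext ⟨?_, ?_⟩
      · rintro ⟨k, hk, h⟩
        exact ⟨_, hS' P hP k hk, h⟩
      · rintro ⟨k, hk, h⟩
        exact ⟨_, hS' P hP k hk, by simpa using h⟩) hνs hρ
    obtain ⟨k', hk', h'⟩ : ∃ k ∈ S', k ρ ≠ 0 := this ▸ ⟨k, hk, hν⟩
    exact exists_invariant hS' hk' h'
  obtain ⟨k₀, hk₀, hk₀0⟩ := S.ne_bot_iff.1 hne
  intro k hk
  obtain ⟨y, hy, z, rfl, hz⟩ := exists_add_orthogonal S k
  by_cases hz0 : z = 0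
  · rwa [hz0, add_zero]
  exfalso
  -- The orthogonal complement of `S` within the kind. It is stable because transvections are
  -- involutive permutations, so they preserve the inner product.
  let S' : Submodule ℂ (Lab q → ℂ) := κ.space τ ⊓
    { carrier := {z | ∀ s ∈ S, ∑ i, star (s i) * z i = 0}
      zero_mem' := fun s _ => by simp
      add_mem' := fun {a b} ha hb s hs => by
        simp [mul_add, Finset.sum_add_distrib] at ha hb ⊢
        rw [ha s hs, hb s hs, add_zero]
      smul_mem' := fun c a ha s hs => by
        have := ha s hs
        simp only [Pi.smul_apply, smul_eq_mul, mul_left_comm _ c, ← Finset.mul_sum, this,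
          mul_zero] }
  have hzS : z ∈ S' := ⟨by simpa using sub_mem hk (hle hy), hz⟩
  obtain ⟨ν, hν⟩ := Function.ne_iff.1 hz0
  have hνs : κ.Supp τ ν := by
    by_contra h
    exact hν (hzS.1.1 ν h)
  obtain ⟨a, ha, ha1, hainv⟩ := exist S hS hle k₀ hk₀ hk₀0 ν hνs
  obtain ⟨a', ha', ha1', hainv'⟩ := exist S' (fun P hP k hk =>
    ⟨Kind.transv_mem_space hP hk.1, fun s hs => by
      have := hk.2 _ (hS P hP s hs)
      rw [← Equiv.sum_comp (transvEquiv P).toEquiv] at this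
      rw [← this]
      refine Finset.sum_congr rfl fun i _ => ?_
      rw [show (transvEquiv P).toEquiv i = transv P i from rfl, transv_transv]⟩) inf_le_left
    z hzS hz0 ν hνs
  -- The two normalised invariant functions agree at `ν`, so their difference is an invariant
  -- function of the kind that vanishes there. Thus `a = a'` lies in `S` and is orthogonal to `S`.
  have heq : a - a' = 0 := Kind.eq_zero_of_invariant (sub_mem (hle ha) ha'.1) hνs
    (fun P h1 h2 μ => by simp [hainv P h1 h2, hainv' P h1 h2]) (by simp [ha1, ha1'])
  have h0 : a' = 0 := eq_zero_of_sum_star_mul (ha'.2 a' (by rwa [← sub_eq_zero.1 heq]))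
  rw [h0] at ha1'
  exact zero_ne_one ha1'

end kinds

/-! ### Splitting a fibre by parity under translation and by Fourier eigenvalue -/

section kinds
variable {q : ℕ}

theorem two_pow_ne_zero : (2 : ℂ) ^ q ≠ 0 := pow_ne_zero _ two_ne_zero

theorem four_pow_eq : (4 : ℂ) ^ q = 2 ^ q * 2 ^ q := by
  rw [← mul_pow]; norm_num

theorem Orb.chi_eq {τ σ : Lab q} {b : ZMod 2} (h : Orb τ b σ) : chi τ σ = parity b 1 := by
  have h := h.1
  rw [sp_comm] at h
  rcases ZMod2.cases b with rfl | rfl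
  · simp [parity, chi, h]
  · simp [parity, chi, h]

theorem chi_eq_neg_parity {τ σ : Lab q} {b : ZMod 2} (h : sp σ τ ≠ b) :
    chi τ σ = -parity b 1 := by
  rw [sp_comm] at h
  rcases ZMod2.cases b with rfl | rfl <;> rcases ZMod2.cases (sp τ σ) with h' | h' <;>
    simp [parity, chi, h'] at h ⊢

theorem parity_zero (b : ZMod 2) : parity b 0 = -parity b 1 := by simp [parity]

theorem parity_eq {b : ZMod 2} {e : ℤ} (he : e ≠ 0) : parity b e = parity b 1 := by
  simp [parity, he]

theorem sum_comp_add (k : Lab q → ℂ) (τ : Lab q) : ∑ σ, k (σ + τ) = ∑ σ, k σ :=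
  Equiv.sum_comp (Equiv.addRight τ) k

/-- The character of `τ` is constant, equal to `parity b 1`, on the support of `k`; dual to this,
translation by `τ` acts on the transform as that constant. -/
theorem fourier_comp_add {k : Lab q → ℂ} {τ : Lab q} {b : ZMod 2}
    (hs : ∀ σ, ¬ Orb τ b σ → k σ = 0) (ν : Lab q) :
    fourier k (ν + τ) = parity b 1 * fourier k ν := by
  rw [fourier, fourier, Finset.mul_sum]
  refine Finset.sum_congr rfl fun σ _ => ?_
  by_cases h : Orb τ b σ
  · rw [chi_add_right, chi_comm σ τ, h.chi_eq]; ring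
  · simp [hs σ h]

/-! ### Membership -/

/-- For this parity, translation by `τ` cancels the Fourier sum in pairs at every `ν` with product
`b` with `τ`. The eigenvalue condition of the case `e = 0`, which says that the transform vanishes
on the orbit, is thus automatic. -/
theorem alt_mem_space {k : Lab q → ℂ} {τ : Lab q} {b : ZMod 2}
    (hs : ∀ σ, ¬ Orb τ b σ → k σ = 0) (hk : ∀ σ, k (σ + τ) = -parity b 1 * k σ)
    (h0 : ∑ σ, k σ = 0) : k ∈ (Kind.spec b 0).space τ := by
  refine ⟨hs, fun σ => by rw [parity_zero, hk], h0, fun ν hν => ?_⟩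
  rw [fourier_eq_zero hk]
  · simp
  · rw [hν.chi_eq, mul_neg, parity_mul_self]

/-- Off the hyperplane or coset where the product with `τ` is `b`, the parity of `h` cancels the sum
in pairs. At `0` and `τ`, which matter only for `b = 0`, the transform is the total sum up to sign.
-/
theorem fourier_supp {h : Lab q → ℂ} {τ : Lab q} {b : ZMod 2}
    (hs : ∀ σ, ¬ Orb τ b σ → h σ = 0) (hh : ∀ σ, h (σ + τ) = parity b 1 * h σ)
    (h0 : ∑ σ, h σ = 0) {ν : Lab q} (hν : ¬ Orb τ b ν) : fourier h ν = 0 := by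
  by_cases hb : sp ν τ = b
  · have : ν = 0 ∨ ν = τ := by
      by_contra! h'
      exact hν ⟨hb, h'.1, h'.2⟩
    rcases this with rfl | rfl
    · rw [fourier_zero, h0]
    · have := fourier_comp_add hs 0
      rwa [zero_add, fourier_zero, h0, mul_zero] at this
  · refine fourier_eq_zero hh ?_
    rw [chi_eq_neg_parity hb, neg_mul, parity_mul_self]

/-- On functions of this parity and zero sum, the transform divided by `2^q` is an involution
preserving the support; the function in the statement is the image of `h` under its spectral
projection for `e`. -/
theorem half_mem_space {h : Lab q → ℂ} {τ : Lab q} {b : ZMod 2} {e : ℤ} (he : e = 1 ∨ e = -1)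
    (hs : ∀ σ, ¬ Orb τ b σ → h σ = 0) (hh : ∀ σ, h (σ + τ) = parity b 1 * h σ)
    (h0 : ∑ σ, h σ = 0) :
    (fun ν => (h ν + e * (fourier h ν / 2 ^ q)) / 2) ∈ (Kind.spec b e).space τ := by
  have he0 : e ≠ 0 := by rcases he with rfl | rfl <;> decide
  have he2 : (e : ℂ) * e = 1 := by rcases he with rfl | rfl <;> simp
  have hd := two_pow_ne_zero (q := q)
  refine ⟨fun σ hσ => by simp [hs σ hσ, fourier_supp hs hh h0 hσ], fun σ => ?_, ?_, fun ν _ => ?_⟩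
  · rw [parity_eq he0]
    simp only [hh, fourier_comp_add hs]
    ring
  · rw [← Finset.sum_div, Finset.sum_add_distrib, h0, ← Finset.mul_sum, ← Finset.sum_div,
      ← fourier_zero, fourier_fourier, hs 0 fun h => h.2.1 rfl]
    simp
  · have : (fun ν => (h ν + e * (fourier h ν / 2 ^ q)) / 2) =
        (1 / 2 : ℂ) • h + (e / 2 ^ q / 2 : ℂ) • fourier h := by
      funext ν
      simp
      ring
    rw [this, fourier_add, fourier_smul, fourier_smul, fourier_fourier, four_pow_eq]
    simp only [Pi.add_apply, Pi.smul_apply, smul_eq_mul]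
    field_simp
    linear_combination (-fourier h ν) * he2

/-- An eigenvector inherits its parity from its transform by `fourier_comp_add`. For `b = 1` that
parity is odd and forces the sum to vanish; for `b = 0` it is even and gives nothing, so the zero
sum is assumed there. -/
theorem spec_mem_space {k : Lab q → ℂ} {τ : Lab q} {b : ZMod 2} {e : ℤ} (he : e = 1 ∨ e = -1)
    (hs : ∀ σ, ¬ Orb τ b σ → k σ = 0) (hk : ∀ ν, Orb τ b ν → fourier k ν = e * 2 ^ q * k ν)
    (h0 : b = 0 → ∑ σ, k σ = 0) : k ∈ (Kind.spec b e).space τ := by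
  have he0 : e ≠ 0 := by rcases he with rfl | rfl <;> decide
  have hd : (e : ℂ) * 2 ^ q ≠ 0 := mul_ne_zero (by exact_mod_cast he0) two_pow_ne_zero
  have hsym : ∀ σ, k (σ + τ) = parity b e * k σ := by
    intro σ
    by_cases h : Orb τ b σ
    · apply mul_left_cancel₀ hd
      rw [← hk _ h.add, fourier_comp_add hs, hk _ h, parity_eq he0]
      ring
    · rw [hs σ h, hs _ (by rwa [orb_add_iff]), mul_zero]
  refine ⟨hs, hsym, ?_, hk⟩
  rcases ZMod2.cases b with hb | rfl
  · exact h0 hb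
  · have := sum_comp_add k τ
    simp only [hsym, ← Finset.mul_sum] at this
    simp [parity, he0] at this
    linear_combination (-1 / 2 : ℂ) * this

/-! ### The decomposition of functions on labels -/

/-- Subtract the mean over the orbit, split the rest by parity under translation by `τ`, and split
the part with sign `parity b 1` by the two projections of `half_mem_space`. -/
theorem exists_decomposition_of_supp {k : Lab q → ℂ} {τ : Lab q} {b : ZMod 2}
    (hs : ∀ σ, ¬ Orb τ b σ → k σ = 0) :
    ∃ a ∈ (Kind.const b).space τ, ∃ p ∈ (Kind.spec b 1).space τ,
      ∃ n ∈ (Kind.spec b (-1)).space τ, ∃ t ∈ (Kind.spec b 0).space τ, k = a + p + n + t := by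
  set c : ℂ := ∑ σ : Lab q, if Orb τ b σ then 1 else 0 with hc
  set a : Lab q → ℂ := fun σ => if Orb τ b σ then (∑ σ, k σ) / c else 0 with ha
  have hasum : ∑ σ, a σ = ∑ σ, k σ := by
    have : ∀ σ, a σ = (if Orb τ b σ then 1 else 0) * ((∑ σ, k σ) / c) := fun σ => by
      simp [ha]
    simp only [this, ← Finset.sum_mul, ← hc]
    by_cases h : c = 0
    -- For an empty orbit the mean is a division by zero, which yields `0`; this is right, as `k` is
    -- then zero too.
    · have : ∑ σ, k σ = 0 := Finset.sum_eq_zero fun σ _ => hs σ fun hσ => by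
        have hcard : c = ((Finset.univ.filter (Orb τ b)).card : ℂ) := by simp [hc]
        rw [hcard, Nat.cast_eq_zero, Finset.card_eq_zero] at h
        exact Finset.notMem_empty σ (h ▸ by simpa using hσ)
      rw [this, h, zero_mul]
    · exact mul_div_cancel₀ _ h
  set k' : Lab q → ℂ := fun σ => k σ - a σ with hk'
  have hk's : ∀ σ, ¬ Orb τ b σ → k' σ = 0 := fun σ hσ => by simp [hk', ha, hs σ hσ, hσ]
  have hk'0 : ∑ σ, k' σ = 0 := by simp [hk', Finset.sum_sub_distrib, hasum]
  set s := parity b 1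
  have hss : s * s = 1 := parity_mul_self b 1
  set h : Lab q → ℂ := fun σ => (k' σ + s * k' (σ + τ)) / 2 with hh
  set t : Lab q → ℂ := fun σ => (k' σ - s * k' (σ + τ)) / 2 with ht
  have hsupp : ∀ σ, ¬ Orb τ b σ → k' (σ + τ) = 0 := fun σ hσ => hk's _ (by rwa [orb_add_iff])
  have hh1 : ∀ σ, ¬ Orb τ b σ → h σ = 0 := fun σ hσ => by simp [hh, hk's σ hσ, hsupp σ hσ]
  have hh2 : ∀ σ, h (σ + τ) = s * h σ := fun σ => by
    simp only [hh, Lab.add_add_self]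
    linear_combination (-k' (σ + τ) / 2) * hss
  have hh3 : ∑ σ, h σ = 0 := by
    rw [← Finset.sum_div, Finset.sum_add_distrib, ← Finset.mul_sum, sum_comp_add, hk'0]
    simp
  refine ⟨a, ⟨fun σ hσ => if_neg hσ, fun σ σ' hσ hσ' => by simp [ha, hσ, hσ']⟩,
    _, half_mem_space (Or.inl rfl) hh1 hh2 hh3, _, half_mem_space (Or.inr rfl) hh1 hh2 hh3,
    t, alt_mem_space (fun σ hσ => by simp [ht, hk's σ hσ, hsupp σ hσ]) (fun σ => ?_) ?_, ?_⟩
  · simp only [ht, Lab.add_add_self]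
    linear_combination (-k' (σ + τ) / 2) * hss
  · rw [← Finset.sum_div, Finset.sum_sub_distrib, ← Finset.mul_sum, sum_comp_add, hk'0]
    simp
  · funext σ
    simp only [Pi.add_apply, hh, ht, hk']
    push_cast
    ring

/-- Summation isolates the constant, translation by `τ` isolates the part `t` of opposite parity,
and the remaining `p = -n` would have both eigenvalues `2^q` and `-2^q`. -/
theorem eq_zero_of_add_eq_zero {τ : Lab q} {b : ZMod 2} {a p n t : Lab q → ℂ}
    (ha : a ∈ (Kind.const b).space τ) (hp : p ∈ (Kind.spec b 1).space τ)
    (hn : n ∈ (Kind.spec b (-1)).space τ) (ht : t ∈ (Kind.spec b 0).space τ)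
    (h : ∀ σ, a σ + p σ + n σ + t σ = 0) : a = 0 ∧ p = 0 ∧ n = 0 ∧ t = 0 := by
  have ha0 : a = 0 := by
    have hsum : ∑ σ, a σ = 0 := by
      have : ∑ σ, (a σ + p σ + n σ + t σ) = 0 := Finset.sum_eq_zero fun σ _ => h σ
      rwa [Finset.sum_add_distrib, Finset.sum_add_distrib, Finset.sum_add_distrib, hp.2.2.1,
        hn.2.2.1, ht.2.2.1, add_zero, add_zero, add_zero] at this
    funext σ
    by_cases hσ : Orb τ b σ
    · have : ∀ σ', a σ' = (if Orb τ b σ' then (1 : ℕ) else 0) • a σ := fun σ' => by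
        split_ifs with h'
        · rw [one_smul]; exact ha.2 _ _ h' hσ
        · rw [zero_smul]; exact ha.1 _ h'
      rw [Finset.sum_congr rfl fun σ' _ => this σ', ← Finset.sum_smul, smul_eq_zero] at hsum
      refine hsum.resolve_left fun h' => ?_
      have := (Finset.sum_eq_zero_iff.1 h') σ (Finset.mem_univ σ)
      rw [if_pos hσ] at this
      exact one_ne_zero this
    · exact ha.1 _ hσ
  subst ha0
  simp only [Pi.zero_apply, zero_add] at h
  set s := parity b 1 with hs
  have hss : s * s = 1 := parity_mul_self b 1
  have ht0 : t = 0 := by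
    funext σ
    have h' := h (σ + τ)
    rw [hp.2.1, hn.2.1, ht.2.1, parity_zero, parity_eq (e := -1) (by decide), ← hs] at h'
    have h1 : p σ + n σ - t σ = 0 := by linear_combination s * h' - (p σ + n σ - t σ) * hss
    change t σ = 0
    linear_combination (1 / 2) * h σ - (1 / 2) * h1
  subst ht0
  have hpn : n = (-1 : ℂ) • p := by
    funext σ
    have := h σ
    simp at this ⊢
    linear_combination this
  have hp0 : p = 0 := by
    funext σ
    by_cases hσ : Orb τ b σ
    · have h1 := hp.2.2.2 σ hσ
      have h2 := hn.2.2.2 σ hσ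
      rw [hpn, fourier_smul, h1] at h2
      have hd := two_pow_ne_zero (q := q)
      have : (2 : ℂ) ^ q * p σ = 0 := by
        simp at h2
        linear_combination (-1 / 2) * h2
      exact (mul_eq_zero.1 this).resolve_left hd
    · exact hp.1 _ hσ
  exact ⟨rfl, hp0, by rw [hpn, hp0, smul_zero], rfl⟩

/-! ### Scalars by which transvections act -/

/-- The scalar by which the sum of the transvections that fix `τ` acts. -/
def Kind.zval (q : ℕ) (z : Prop) [Decidable z] : Kind → ℂ
  | .spec _ e => (if z then 4 ^ q / 2 else 4 ^ q / 4) - e * 2 ^ q / 2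
  | _ => if z then 4 ^ q else 4 ^ q / 2

/-- The scalar by which the transvection with direction `τ` acts. -/
def Kind.tval : Kind → ℂ
  | .spec b e => if b = 0 then 1 else parity b e
  | _ => 1

/-- The transvection along `τ` fixes the labels commuting with `τ` and translates the others by `τ`,
so its effect is trivial for `b = 0` and is the parity for `b = 1`. -/
theorem Kind.transv_self {κ : Kind} {τ : Lab q} {k : Lab q → ℂ} (hk : k ∈ κ.space τ)
    (ν : Lab q) : k (transv τ ν) = κ.tval * k ν := by
  rcases ZMod2.cases (sp τ ν) with h | h
  · rw [transv_of_eq_zero h]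
    cases κ with
    | point0 => simp [tval]
    | pointT => simp [tval]
    | const b => simp [tval]
    | spec b e =>
      rcases ZMod2.cases b with rfl | rfl
      · simp [tval]
      · rw [hk.1 ν]
        · simp
        · intro h'
          rw [sp_comm, h'.1] at h
          exact one_ne_zero h
  · rw [transv_of_eq_one h]
    have h1 : ν ≠ 0 := by rintro rfl; simp at h
    have h2 : ν ≠ τ := by rintro rfl; simp at h
    have h3 : Orb τ 1 ν := orb_one.2 (by rwa [sp_comm])
    cases κ with
    | point0 =>
      rw [hk.1 ν h1, hk.1 (ν + τ)]
      · simp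
      · exact h3.add.2.1
    | pointT =>
      rw [hk.1 ν h2, hk.1 (ν + τ)]
      · simp
      · exact h3.add.2.2
    | const b =>
      rcases ZMod2.cases b with rfl | rfl
      · rw [hk.1 ν, hk.1 (ν + τ)]
        · simp
        · exact fun h' => zero_ne_one (h'.1.symm.trans h3.add.1)
        · exact fun h' => zero_ne_one (h'.1.symm.trans h3.1)
      · rw [hk.2 _ _ h3.add h3]
        simp [tval]
    | spec b e =>
      rw [hk.2.1]
      rcases ZMod2.cases b with rfl | rfl
      · rw [hk.1 ν]
        · simp
        · exact fun h' => zero_ne_one (h'.1.symm.trans h3.1)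
      · simp [tval]

theorem Kind.transv_invariant {κ : Kind} {τ : Lab q} {k : Lab q → ℂ} (hk : k ∈ κ.space τ)
    (hκ : ∀ b e, κ ≠ .spec b e) {P : Lab q} (hP : sp P τ = 0) (ν : Lab q) :
    k (transv P ν) = k ν := by
  have hk' := Kind.transv_mem_space hP hk
  have hsupp : κ.Supp τ (transv P ν) ↔ κ.Supp τ ν := by
    have := Kind.supp_map (κ := κ) (τ := τ) (σ := ν) (transvEquiv P) (sp_transv_transv P)
    rwa [show transvEquiv P τ = τ from transv_of_eq_zero hP] at this
  by_cases h : κ.Supp τ ν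
  · have h' := hsupp.2 h
    cases κ with
    | point0 => rw [show transv P ν = 0 from h', show ν = 0 from h]
    | pointT => rw [show transv P ν = τ from h', show ν = τ from h]
    | const b => exact hk.2 _ _ h' h
    | spec b e => exact absurd rfl (hκ b e)
  · rw [hk.1 ν h, hk.1 _ (fun h' => h (hsupp.1 h'))]

/-- For the first three kinds each summand fixes `k`, so the scalar counts directions. For a
spectral kind, directions commuting with `ν` are counted by `sum_perp_perp`, and the others
contribute half the difference between the total sum, which is zero, and the transform at `ν`. -/
theorem Kind.sum_transv {κ : Kind} {τ : Lab q} {k : Lab q → ℂ} (hk : k ∈ κ.space τ)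
    (ν : Lab q) : ∑ P, (if sp P τ = 0 then k (transv P ν) else 0) = κ.zval q (τ = 0) * k ν := by
  by_cases hκ : ∀ b e, κ ≠ .spec b e
  · have : ∀ P, (if sp P τ = 0 then k (transv P ν) else 0) =
        (if sp P τ = 0 then 1 else 0) * k ν := fun P => by
      split_ifs with h
      · rw [Kind.transv_invariant hk hκ h, one_mul]
      · rw [zero_mul]
    simp only [this, ← Finset.sum_mul, sum_perp]
    cases κ with
    | point0 => rfl
    | pointT => rfl
    | const b => rfl
    | spec b e => exact absurd rfl (hκ b e)
  · push Not at hκ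
    obtain ⟨b, e, rfl⟩ := hκ
    by_cases hν : Orb τ b ν
    swap
    · rw [hk.1 ν hν, mul_zero]
      refine Finset.sum_eq_zero fun P _ => ?_
      split_ifs with h
      · exact (Kind.transv_mem_space h hk).1 ν hν
      · rfl
    -- A direction anticommuting with `ν` moves `ν` to `P + ν`; the substitution `σ = P + ν` turns
    -- these terms into a sum over labels with product `b` with `τ` and anticommuting with `ν`.
    have h1 : ∀ P, (if sp P τ = 0 then k (transv P ν) else 0) =
        (if sp P τ = 0 ∧ sp P ν = 0 then 1 else 0) * k ν +
        (if sp (P + ν) τ = b ∧ sp (P + ν) ν = 1 then k (P + ν) else 0) := fun P => by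
      have h2 : sp (P + ν) τ = b ↔ sp P τ = 0 := by
        rw [sp_add_left, hν.1]; exact add_eq_right
      have h3 : sp (P + ν) ν = sp P ν := by simp
      simp only [h2, h3]
      rcases ZMod2.cases (sp P ν) with h | h
      · simp [transv_of_eq_zero, h]
      · simp [transv_of_eq_one, h, add_comm]
    simp only [h1]
    have h5 : ∑ P, (if sp (P + ν) τ = b ∧ sp (P + ν) ν = 1 then k (P + ν) else 0) =
        ∑ σ, (if sp σ τ = b ∧ sp σ ν = 1 then k σ else 0) :=
      Equiv.sum_comp (Equiv.addRight ν) fun σ => if sp σ τ = b ∧ sp σ ν = 1 then k σ else 0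
    rw [Finset.sum_add_distrib, ← Finset.sum_mul, sum_perp_perp hν.2.1 hν.2.2, h5]
    have h4 : ∀ σ, (if sp σ τ = b ∧ sp σ ν = 1 then k σ else 0) = (k σ - chi σ ν * k σ) / 2 := by
      intro σ
      by_cases hσ : sp σ τ = b
      · rcases ZMod2.cases (sp σ ν) with h | h
        · simp [chi, h]
        · simp [chi, h, hσ]
      · rw [hk.1 σ fun h => hσ h.1]
        simp
    simp only [h4]
    rw [← Finset.sum_div, Finset.sum_sub_distrib, hk.2.2.1]
    have := hk.2.2.2 ν hν
    rw [fourier] at this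
    rw [this, zval]
    ring

end kinds

section kinds
variable {q : ℕ}

/-! ### Kinds that occur -/

/-- The function `δ_ρ + s δ_{ρ + τ}`. -/
def pairFn (s : ℂ) (τ ρ σ : Lab q) : ℂ := (if σ = ρ then 1 else 0) + if σ = ρ + τ then s else 0

theorem pairFn_supp {s : ℂ} {τ ρ : Lab q} {b : ZMod 2} (hρ : Orb τ b ρ) (σ : Lab q)
    (hσ : ¬ Orb τ b σ) : pairFn s τ ρ σ = 0 := by
  rw [pairFn, if_neg, if_neg, add_zero]
  · rintro rfl; exact hσ hρ.add
  · rintro rfl; exact hσ hρ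

theorem pairFn_add {s : ℂ} (hs : s * s = 1) (τ ρ σ : Lab q) :
    pairFn s τ ρ (σ + τ) = s * pairFn s τ ρ σ := by
  simp only [pairFn, Lab.add_eq_iff, Lab.add_add_self]
  split_ifs <;> simp [hs, mul_add, add_comm]

theorem sum_pairFn (s : ℂ) (τ ρ : Lab q) : ∑ σ, pairFn s τ ρ σ = 1 + s := by
  simp [pairFn, Finset.sum_add_distrib]

theorem fourier_pairFn {τ ρ ν : Lab q} {b : ZMod 2} (hν : Orb τ b ν) :
    fourier (pairFn (parity b 1) τ ρ) ν = 2 * chi ρ ν := by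
  simp only [fourier, pairFn, mul_add, Finset.sum_add_distrib, mul_ite, mul_one, mul_zero,
    Finset.sum_ite_eq', Finset.mem_univ, if_true, chi_add_left, hν.chi_eq]
  linear_combination chi ρ ν * parity_mul_self b 1

theorem point0_ne_bot (τ : Lab q) : Kind.point0.space τ ≠ ⊥ := by
  refine (Submodule.ne_bot_iff _).2 ⟨Pi.single 0 1, ⟨fun σ hσ => ?_, trivial⟩, ?_⟩
  · exact Pi.single_eq_of_ne hσ _
  · exact fun h => by simpa using congrFun h 0

theorem pointT_ne_bot (τ : Lab q) : Kind.pointT.space τ ≠ ⊥ := by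
  refine (Submodule.ne_bot_iff _).2 ⟨Pi.single τ 1, ⟨fun σ hσ => ?_, trivial⟩, ?_⟩
  · exact Pi.single_eq_of_ne hσ _
  · exact fun h => by simpa using congrFun h τ

theorem const_ne_bot {τ ρ : Lab q} {b : ZMod 2} (hρ : Orb τ b ρ) :
    (Kind.const b).space τ ≠ ⊥ := by
  refine (Submodule.ne_bot_iff _).2 ⟨fun σ => if Orb τ b σ then 1 else 0,
    ⟨fun σ hσ => if_neg hσ, fun σ σ' h h' => by simp only [if_pos h, if_pos h']⟩, fun h => ?_⟩
  have := congrFun h ρ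
  simp [hρ] at this

theorem alt_ne_bot {τ ρ ρ' : Lab q} {b : ZMod 2} (hτ : τ ≠ 0) (hρ : Orb τ b ρ)
    (hρ' : Orb τ b ρ') (h1 : ρ ≠ ρ') (h2 : ρ ≠ ρ' + τ) : (Kind.spec b 0).space τ ≠ ⊥ := by
  set s := -parity b 1 with hs
  have hss : s * s = 1 := by rw [hs, neg_mul_neg, parity_mul_self]
  refine (Submodule.ne_bot_iff _).2 ⟨fun σ => pairFn s τ ρ σ - pairFn s τ ρ' σ,
    alt_mem_space (fun σ hσ => ?_) (fun σ => ?_) ?_, fun h => ?_⟩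
  · rw [pairFn_supp hρ σ hσ, pairFn_supp hρ' σ hσ, sub_zero]
  · rw [pairFn_add hss, pairFn_add hss, mul_sub]
  · rw [Finset.sum_sub_distrib, sum_pairFn, sum_pairFn, sub_self]
  · have := congrFun h ρ
    simp [pairFn, h1, h2, hτ] at this

/-- Project `δ_ρ - δ_{ρ+τ}` to the eigenspace and evaluate at `ρ`: the result is `(1 + 2e/2^q)/2`,
which vanishes only for `e = -1` and one qubit. -/
theorem spec_one_ne_bot {τ ρ : Lab q} {e : ℤ} (he : e = 1 ∨ e = -1 ∧ 2 ≤ q) (hρ : Orb τ 1 ρ) :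
    (Kind.spec 1 e).space τ ≠ ⊥ := by
  have hp : parity 1 1 = -1 := by simp [parity]
  have hτ : τ ≠ 0 := by rintro rfl; exact orb_zero_right hρ
  refine (Submodule.ne_bot_iff _).2 ⟨_, half_mem_space (h := pairFn (parity 1 1) τ ρ)
    (he.imp_right And.left) (pairFn_supp hρ) (pairFn_add (parity_mul_self 1 1) τ ρ)
    (by rw [sum_pairFn, hp]; ring), fun h => ?_⟩
  have := congrFun h ρ
  simp only [fourier_pairFn hρ, chi_self, Pi.zero_apply] at this
  simp [pairFn, hτ] at this
  have hd := two_pow_ne_zero (q := q)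
  rcases he with rfl | ⟨rfl, h2⟩
  · field_simp at this
    have : ((2 ^ q + 2 : ℕ) : ℂ) = 0 := by push_cast; linear_combination this
    rw [Nat.cast_eq_zero] at this
    exact absurd this (by positivity)
  · field_simp at this
    have : ((2 ^ q : ℕ) : ℂ) = (2 : ℕ) := by push_cast at this ⊢; linear_combination this
    rw [Nat.cast_inj] at this
    have h4 : 2 ^ 2 ≤ 2 ^ q := Nat.pow_le_pow_right (by norm_num) h2
    omega

/-- The difference of two pair functions has zero sum. The value of its projection at `ρ` is a
positive term plus a nonnegative multiple of `1 - chi ρ' ρ`. -/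
theorem spec_zero_pos_ne_bot {τ ρ ρ' : Lab q} (hρ : Orb τ 0 ρ) (hρ' : Orb τ 0 ρ')
    (h1 : ρ ≠ ρ') (h2 : ρ ≠ ρ' + τ) : (Kind.spec 0 1).space τ ≠ ⊥ := by
  set s := parity 0 1
  have hss : s * s = 1 := parity_mul_self 0 1
  have hs1 : s = 1 := by simp [s, parity]
  refine (Submodule.ne_bot_iff _).2 ⟨_, half_mem_space (h := pairFn s τ ρ + (-1 : ℂ) • pairFn s τ ρ')
    (Or.inl rfl) (fun σ hσ => ?_) (fun σ => ?_) ?_, fun h => ?_⟩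
  · simp [pairFn_supp hρ σ hσ, pairFn_supp hρ' σ hσ]
  · simp [pairFn_add hss, mul_add]
    ring
  · simp [Finset.sum_add_distrib, sum_pairFn]
  · have := congrFun h ρ
    simp only [fourier_add, fourier_smul, s, fourier_pairFn hρ, chi_self, Pi.zero_apply] at this
    simp only [Pi.add_apply, Pi.smul_apply, pairFn, if_pos, h1, h2, if_false] at this
    have hd := two_pow_ne_zero (q := q)
    have hτ : (if ρ = ρ + τ then parity 0 1 else 0) = ((if τ = 0 then 1 else 0 : ℕ) : ℂ) := by
      simp [parity]
    have hc : 1 - chi ρ' ρ = ((if sp ρ' ρ = 0 then 0 else 2 : ℕ) : ℂ) := by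
      rw [chi]; split_ifs <;> norm_num
    rw [hτ] at this
    -- Rewritten as a natural number, the value is visibly positive. The extra `1` for `τ = 0`
    -- arises because the two points of a pair coincide there.
    have h3 : (((1 + if τ = 0 then 1 else 0) * 2 ^ q +
        2 * (if sp ρ' ρ = 0 then 0 else 2) : ℕ) : ℂ) = 0 := by
      rw [Nat.cast_add, Nat.cast_mul 2, ← hc]
      push_cast at this ⊢
      simp at this
      field_simp at this
      linear_combination this
    rw [Nat.cast_eq_zero, Nat.add_eq_zero_iff, mul_eq_zero] at h3
    rcases h3.1 with h | h
    · omega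
    · exact absurd h (by positivity)

/-- Evaluated at `ν` outside both pairs, only the Fourier term of the projection survives; it is a
multiple of `chi ρ ν - chi ρ' ν`. -/
theorem spec_zero_neg_ne_bot {τ ρ ρ' ν : Lab q} (hρ : Orb τ 0 ρ) (hρ' : Orb τ 0 ρ')
    (hν : Orb τ 0 ν) (h : sp ρ ν ≠ sp ρ' ν) (h1 : ν ≠ ρ) (h2 : ν ≠ ρ + τ) (h3 : ν ≠ ρ')
    (h4 : ν ≠ ρ' + τ) : (Kind.spec 0 (-1)).space τ ≠ ⊥ := by
  set s := parity 0 1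
  have hss : s * s = 1 := parity_mul_self 0 1
  refine (Submodule.ne_bot_iff _).2 ⟨_, half_mem_space (h := pairFn s τ ρ + (-1 : ℂ) • pairFn s τ ρ')
    (Or.inr rfl) (fun σ hσ => ?_) (fun σ => ?_) ?_, fun h0 => ?_⟩
  · simp [pairFn_supp hρ σ hσ, pairFn_supp hρ' σ hσ]
  · simp [pairFn_add hss, mul_add]
    ring
  · simp [Finset.sum_add_distrib, sum_pairFn]
  · have := congrFun h0 ν
    simp only [fourier_add, fourier_smul, s, fourier_pairFn hν, Pi.zero_apply] at this
    have hd := two_pow_ne_zero (q := q)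
    simp [pairFn, h1, h2, h3, h4] at this
    exact h (chi_eq_chi.1 (by linear_combination this / 2))

/-! ### Kinds that vanish when there are few labels -/

theorem space_eq_bot_of_forall_not_supp {τ : Lab q} {κ : Kind}
    (h : ∀ σ, ¬ κ.Supp τ σ) : κ.space τ = ⊥ :=
  (Submodule.eq_bot_iff _).2 fun _ hk => funext fun σ => hk.1 σ (h σ)

/-- Sum `k` over the labels commuting with `ρ`. The hypothesis leaves only `ρ` and `ρ + τ`, giving a
nonnegative multiple of `k ρ`; the eigenvalue equation gives `-2^q/2` times `k ρ`. Hence `k ρ = 0`.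
-/
theorem spec_neg_eq_bot {τ : Lab q} {b : ZMod 2}
    (h : ∀ ρ σ, Orb τ b ρ → Orb τ b σ → sp σ ρ = 0 → σ = ρ ∨ σ = ρ + τ) :
    (Kind.spec b (-1)).space τ = ⊥ := by
  refine (Submodule.eq_bot_iff _).2 fun k hk => funext fun ρ => ?_
  by_cases hρ : Orb τ b ρ
  swap
  · exact hk.1 ρ hρ
  have h1 : ∀ σ, (k σ + chi σ ρ * k σ) / 2 =
      ((if Orb τ b σ ∧ sp σ ρ = 0 then 1 else 0 : ℕ) : ℂ) * k ρ := by
    intro σ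
    by_cases hσ : Orb τ b σ
    · rcases ZMod2.cases (sp σ ρ) with h' | h'
      · rw [chi_eq_one h', if_pos ⟨hσ, h'⟩]
        rcases h ρ σ hρ hσ h' with rfl | rfl
        · simp
        · have hb : b = 0 := by rw [← hρ.1, ← h', sp_add_left, sp_self, zero_add, sp_comm]
          rw [hk.2.1, hb]
          simp [parity]
      · simp [chi_eq_neg_one h', h']
    · rw [hk.1 σ hσ]
      simp [hσ]
  have h2 : (∑ σ, (k σ + chi σ ρ * k σ)) / 2 = -1 * 2 ^ q * k ρ / 2 := by
    rw [Finset.sum_add_distrib, hk.2.2.1, zero_add]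
    congr 1
    exact (hk.2.2.2 ρ hρ).trans (by simp)
  rw [Finset.sum_div, Finset.sum_congr rfl fun σ _ => h1 σ, ← Finset.sum_mul,
    ← Nat.cast_sum] at h2
  set n := ∑ σ, if Orb τ b σ ∧ sp σ ρ = 0 then 1 else 0
  have h3 : ((2 * n + 2 ^ q : ℕ) : ℂ) * k ρ = 0 := by
    push_cast
    linear_combination 2 * h2
  refine (mul_eq_zero.1 h3).resolve_left ?_
  rw [Nat.cast_eq_zero]
  have : 0 < 2 ^ q := by positivity
  omega

/-- For `b = 1` this kind is even under translation by `τ`, hence constant on an orbit `{ρ, ρ + τ}`,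
and its sum is zero. -/
theorem alt_eq_bot {τ : Lab q} {b : ZMod 2} (hb : b = 1)
    (h : ∀ ρ σ, Orb τ b ρ → Orb τ b σ → σ = ρ ∨ σ = ρ + τ) :
    (Kind.spec b 0).space τ = ⊥ := by
  subst hb
  refine (Submodule.eq_bot_iff _).2 fun k hk => funext fun ρ => ?_
  by_cases hρ : Orb τ 1 ρ
  swap
  · exact hk.1 ρ hρ
  have h1 : ∀ σ, k σ = ((if Orb τ 1 σ then 1 else 0 : ℕ) : ℂ) * k ρ := by
    intro σ
    split_ifs with hσ
    · rcases h ρ σ hρ hσ with rfl | rfl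
      · simp
      · simp [hk.2.1, parity]
    · simp [hk.1 σ hσ]
  have h2 := hk.2.2.1
  rw [Finset.sum_congr rfl fun σ _ => h1 σ, ← Finset.sum_mul, ← Nat.cast_sum] at h2
  refine (mul_eq_zero.1 h2).resolve_left ?_
  rw [Nat.cast_eq_zero]
  intro h3
  have := Finset.sum_eq_zero_iff.1 h3 ρ (Finset.mem_univ ρ)
  simp [hρ] at this

/-- For at most two qubits, labels that commute with two commuting labels are generated by them. -/
theorem mem_of_perp {τ ρ σ : Lab q} (hq : 4 ^ q < if τ = 0 then 6 else 20) (hρ : Orb τ 0 ρ)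
    (hσ : Orb τ 0 σ) (h : sp σ ρ = 0) :
    σ = ρ ∨ σ = ρ + τ := by
  by_contra! hne
  have hcard := sum_perp_perp (τ := τ) hρ.2.1 hρ.2.2
  have h1 : ∑ P, (if sp P τ = 0 ∧ sp P ρ = 0 then (1 : ℂ) else 0) =
      ((Finset.univ.filter fun P => sp P τ = 0 ∧ sp P ρ = 0).card : ℕ) := by simp
  -- The common commutant has `4^q/4` elements, or `4^q/2` if `τ = 0`. The bounds `20` and `6` make
  -- this less than `5` and less than `3`, so a further label `σ` does not fit.
  have hsub : ({0, τ, ρ, ρ + τ, σ} : Finset (Lab q)) ⊆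
      Finset.univ.filter fun P => sp P τ = 0 ∧ sp P ρ = 0 := by
    intro P hP
    simp only [Finset.mem_insert, Finset.mem_singleton] at hP
    have := hρ.1
    have := hσ.1
    have h' := sp_comm τ ρ
    rcases hP with rfl | rfl | rfl | rfl | rfl <;> simp_all
  have hle := Finset.card_le_card hsub
  rw [h1] at hcard
  by_cases hτ : τ = 0
  · subst hτ
    have h3 : ({0, 0, ρ, ρ + 0, σ} : Finset (Lab q)).card = 3 := by
      rw [add_zero]
      simp
      rw [Finset.card_insert_of_notMem, Finset.card_pair]
      · exact hne.1.symm
      · simp [hρ.2.1.symm, hσ.2.1.symm]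
    rw [h3] at hle
    simp only [if_true] at hcard hq
    rw [eq_div_iff two_ne_zero] at hcard
    norm_cast at hcard
    omega
  · have h3 : ({0, τ, ρ, ρ + τ, σ} : Finset (Lab q)).card = 5 := by
      have h6 := hρ.add
      rw [Finset.card_insert_of_notMem, Finset.card_insert_of_notMem,
        Finset.card_insert_of_notMem, Finset.card_pair]
      · exact hne.2.symm
      · simp [hτ, hne.1.symm]
      · simp only [Finset.mem_insert, Finset.mem_singleton, hρ.2.2.symm, h6.2.2.symm, hσ.2.2.symm,
          or_self, not_false_eq_true]
      · simp [hρ.2.1.symm, h6.2.1.symm, hσ.2.1.symm, Ne.symm hτ]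
    rw [h3] at hle
    simp only [if_neg hτ] at hcard hq
    rw [eq_div_iff (by norm_num)] at hcard
    norm_cast at hcard
    omega

end kinds

/-! ### Irreducible subspaces -/

section generic
variable {G V V' : Type*} [Group G] [AddCommGroup V] [Module ℂ V] [AddCommGroup V'] [Module ℂ V']

/-- The subspace `W` carries an irreducible subrepresentation of `ρ`. -/
structure IsIrreducibleSubspace (ρ : Representation ℂ G V) (W : Submodule ℂ V) : Prop where
  stable : ∀ g, ∀ v ∈ W, ρ g v ∈ W
  ne_bot : W ≠ ⊥
  le : ∀ S : Submodule ℂ V, (∀ g, ∀ v ∈ S, ρ g v ∈ S) → S ≤ W → S ≠ ⊥ → W ≤ S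

/-- The subrepresentation carried by an irreducible subspace. -/
def IsIrreducibleSubspace.sub {ρ : Representation ℂ G V} {W : Submodule ℂ V}
    (h : IsIrreducibleSubspace ρ W) : Subrepresentation ρ := ⟨W, fun g _ hv => h.stable g _ hv⟩

theorem IsIrreducibleSubspace.isIrreducible {ρ : Representation ℂ G V} {W : Submodule ℂ V}
    (h : IsIrreducibleSubspace ρ W) : h.sub.toRepresentation.IsIrreducible := by
  have hnt : Nontrivial W := Submodule.nontrivial_iff_ne_bot.2 h.ne_bot
  refine { exists_pair_ne := ⟨⊥, ⊤, fun hbt => ?_⟩, eq_bot_or_eq_top := fun S => ?_ }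
  · have : (⊥ : Submodule ℂ W) = ⊤ := congrArg Subrepresentation.toSubmodule hbt
    exact bot_ne_top this
  · by_cases hS : S.toSubmodule.map W.subtype = ⊥
    · left
      apply Subrepresentation.toSubmodule_injective
      exact Submodule.map_injective_of_injective W.injective_subtype
        (hS.trans (Submodule.map_bot _).symm)
    · right
      apply Subrepresentation.toSubmodule_injective
      have := h.le (S.toSubmodule.map W.subtype) (fun g v hv => ?_) (Submodule.map_subtype_le _ _) hS
      · refine eq_top_iff.2 fun w _ => ?_
        obtain ⟨w', hw', h'⟩ := this w.2
        rwa [Subtype.ext h'] at hw'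
      · obtain ⟨w, hw, rfl⟩ := hv
        exact ⟨_, S.apply_mem_toSubmodule g hw, rfl⟩

/-- Schur's lemma for the restriction of an intertwiner to irreducible subspaces. -/
theorem IsIrreducibleSubspace.nonempty_equiv {ρ : Representation ℂ G V} {W W' : Submodule ℂ V}
    (h : IsIrreducibleSubspace ρ W) (h' : IsIrreducibleSubspace ρ W') (M : V →ₗ[ℂ] V)
    (hM : ∀ g v, M (ρ g v) = ρ g (M v)) (hW : ∀ v ∈ W, M v ∈ W') (h0 : ∃ v ∈ W, M v ≠ 0) :
    Nonempty (h.sub.toRepresentation.Equiv h'.sub.toRepresentation) := by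
  have := h.isIrreducible
  have := h'.isIrreducible
  let f : Representation.IntertwiningMap h.sub.toRepresentation h'.sub.toRepresentation :=
    ⟨M.restrict hW, fun g => LinearMap.ext fun v => Subtype.ext (hM g v)⟩
  obtain ⟨v, hv, hv0⟩ := h0
  have hf : Function.Bijective f :=
    (Representation.IsIrreducible.bijective_or_eq_zero f).resolve_right fun hf => hv0 (by
      have : f ⟨v, hv⟩ = 0 := by rw [hf]; rfl
      exact congrArg Subtype.val this)
  exact ⟨f.ofBijective hf⟩

theorem IsIrreducibleSubspace.map {ρ : Representation ℂ G V} {ρ' : Representation ℂ G V'}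
    {W : Submodule ℂ V} (h : IsIrreducibleSubspace ρ W) (Φ : V ≃ₗ[ℂ] V')
    (hΦ : ∀ g v, ρ' g (Φ v) = Φ (ρ g v)) :
    IsIrreducibleSubspace ρ' (W.map Φ.toLinearMap) where
  stable g v hv := by
    obtain ⟨w, hw, rfl⟩ := hv
    exact ⟨_, h.stable g w hw, (hΦ g w).symm⟩
  ne_bot := fun h' => h.ne_bot (Submodule.map_injective_of_injective Φ.injective
    (h'.trans (Submodule.map_bot _).symm))
  le S hS hle hne := by
    have hcomap : (S.comap Φ.toLinearMap).map Φ.toLinearMap = S :=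
      Submodule.map_comap_eq_of_surjective Φ.surjective S
    have := h.le (S.comap Φ.toLinearMap) (fun g v hv => by
      have := hS g _ hv
      rwa [LinearEquiv.coe_coe, hΦ] at this) (fun v hv => by
        obtain ⟨w, hw, hwv⟩ := hle hv
        rwa [← Φ.injective hwv]) (fun h' => hne (by rw [← hcomap, h', Submodule.map_bot]))
    rw [← hcomap]
    exact Submodule.map_mono this

/-- Equivariance of a linear map between subspaces. -/
def IsEquivariant (ρ : Representation ℂ G V) {W W' : Submodule ℂ V} (φ : W ≃ₗ[ℂ] W') : Prop :=
  ∀ g (v w : W), (w : V) = ρ g v → (φ w : V) = ρ g (φ v)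

/-- A criterion for a decomposition into irreducible subspaces, where the space is identified with
another one. -/
theorem isIrreducibleDecomposition_of_linearEquiv {ρ : Representation ℂ G V}
    {ρ' : Representation ℂ G V'} (Φ : V ≃ₗ[ℂ] V') (hΦ : ∀ g v, ρ' g (Φ v) = Φ (ρ g v)) {m : ℕ}
    {W : Fin m → Submodule ℂ V} {W' : Fin m → Submodule ℂ V'} {cls : Fin m → IrrepClass}
    (hW' : ∀ i, W' i = (W i).map Φ.toLinearMap) (hind : iSupIndep W) (htop : ⨆ i, W i = ⊤)
    (hirr : ∀ i, IsIrreducibleSubspace ρ (W i))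
    (heq : ∀ i j, cls i = cls j → ∃ B, IsIrreducibleSubspace ρ B ∧ ∀ l, l = i ∨ l = j →
      ∃ M : V →ₗ[ℂ] V, (∀ g v, M (ρ g v) = ρ g (M v)) ∧ (∀ v ∈ B, M v ∈ W l) ∧ ∃ v ∈ B, M v ≠ 0)
    (hneq : ∀ i j, ∀ φ : W i ≃ₗ[ℂ] W j, IsEquivariant ρ φ → cls i = cls j) :
    IsIrreducibleDecomposition ρ' W' cls := by
  obtain rfl : W' = fun i => (W i).map Φ.toLinearMap := funext hW'
  have hirr' : ∀ i, IsIrreducibleSubspace ρ' ((W i).map Φ.toLinearMap) := fun i => (hirr i).map Φ hΦ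
  refine ⟨?_, fun i => (hirr' i).sub, fun i => rfl, fun i => (hirr' i).isIrreducible, fun i j => ?_⟩
  · rw [DirectSum.isInternal_submodule_iff_iSupIndep_and_iSup_eq_top]
    constructor
    · exact iSupIndep.map_orderIso (Submodule.orderIsoMapComap Φ) hind
    · rw [← Submodule.map_iSup, htop, Submodule.map_top, LinearMap.range_eq_top]
      exact Φ.surjective
  constructor
  · rintro ⟨φ⟩
    let ψ : W i ≃ₗ[ℂ] W j :=
      (Φ.submoduleMap (W i)).trans (φ.toLinearEquiv.trans (Φ.submoduleMap (W j)).symm)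
    refine hneq i j ψ fun g v w hw => Φ.injective ?_
    have key : ∀ v : W i, Φ (ψ v) = ((φ (Φ.submoduleMap (W i) v) : (W j).map Φ.toLinearMap) : V') := by
      intro v
      exact congrArg Subtype.val (LinearEquiv.apply_symm_apply (Φ.submoduleMap (W j))
        (φ (Φ.submoduleMap (W i) v)))
    rw [key, ← hΦ, key]
    have h1 : Φ.submoduleMap (W i) w =
        (hirr' i).sub.toRepresentation g (Φ.submoduleMap (W i) v) := by
      apply Subtype.ext
      change Φ (w : V) = ρ' g (Φ v)
      rw [hw, hΦ]
    rw [h1]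
    exact congrArg Subtype.val (Representation.IntertwiningMap.isIntertwining _ _ φ.toIntertwiningMap g
      (Φ.submoduleMap (W i) v))
  · intro hij
    -- Both summands are compared with a common model `B`, so an intertwiner out of `B` into each of
    -- them suffices, without an inverse.
    obtain ⟨B, hB, hM⟩ := heq i j hij
    have hB' := hB.map Φ hΦ
    have key : ∀ l, l = i ∨ l = j →
        Nonempty (hB'.sub.toRepresentation.Equiv (hirr' l).sub.toRepresentation) := by
      intro l hl
      obtain ⟨M, h1, h2, v, hv, h3⟩ := hM l hl
      refine hB'.nonempty_equiv (hirr' l) (Φ.toLinearMap ∘ₗ M ∘ₗ Φ.symm.toLinearMap)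
        (fun g v => ?_) ?_ ⟨Φ v, ⟨v, hv, rfl⟩, by simpa using h3⟩
      · obtain ⟨v, rfl⟩ := Φ.surjective v
        simp [hΦ, h1]
      · rintro _ ⟨v, hv, rfl⟩
        exact ⟨M v, h2 v hv, by simp⟩
    obtain ⟨e⟩ := key i (Or.inl rfl)
    obtain ⟨e'⟩ := key j (Or.inr rfl)
    exact ⟨e.symm.trans e'⟩

end generic

/-! ### Monomial representations on functions of two labels -/

/-- Functions of two labels. -/
abbrev Coord (q : ℕ) : Type := Lab q → Lab q → ℂ

/-- A representation on functions of two labels in which the group acts by symplectic maps and by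
factors that depend on the first label, with all Pauli characters and all transvections. -/
structure IsMonomial {q : ℕ} {G : Type*} [Group G] (ρ : Representation ℂ G (Coord q)) : Prop where
  exists_map : ∀ g, ∃ (π : Lab q ≃+ Lab q) (t : Lab q → ℂ),
    (∀ x y, sp (π x) (π y) = sp x y) ∧ ∀ f τ σ, ρ g f (π τ) (π σ) = t τ * f τ σ
  exists_pauli : ∀ μ, ∃ g, ∀ f τ σ, ρ g f τ σ = chi μ τ * f τ σ
  exists_transv : ∀ P, ∃ g, ∃ t : Lab q → ℂ, (∀ τ, t τ ≠ 0) ∧ (∀ τ, sp P τ = 0 → t τ = 1) ∧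
    ∀ f τ σ, ρ g f (transv P τ) (transv P σ) = t τ * f τ σ

section monomial
variable {q : ℕ} {G : Type*} [Group G] {ρ : Representation ℂ G (Coord q)}

/-- Whether the label `τ` occurs in the trivial (`s = false`) or in the non-trivial sector. -/
def Adm (s : Bool) (τ : Lab q) : Prop := τ = 0 ↔ s = false

instance (s : Bool) : DecidablePred (Adm (q := q) s) :=
  fun _ => inferInstanceAs (Decidable (_ ↔ _))

theorem adm_false {τ : Lab q} : Adm false τ ↔ τ = 0 := by simp [Adm]

theorem adm_true {τ : Lab q} : Adm true τ ↔ τ ≠ 0 := by simp [Adm]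

theorem adm_map {s : Bool} {τ : Lab q} (π : Lab q ≃+ Lab q) : Adm s (π τ) ↔ Adm s τ := by
  simp [Adm]

/-- The functions `f` for which all `f τ` are of kind `κ`, supported in one of the two sectors. -/
def sector (s : Bool) (κ : Kind) : Submodule ℂ (Coord q) where
  carrier := {f | ∀ τ, (Adm s τ → f τ ∈ κ.space τ) ∧ (¬ Adm s τ → f τ = 0)}
  zero_mem' _ := ⟨fun _ => zero_mem _, fun _ => rfl⟩
  add_mem' h h' τ := ⟨fun a => add_mem ((h τ).1 a) ((h' τ).1 a), fun a => by
    rw [Pi.add_apply, (h τ).2 a, (h' τ).2 a, add_zero]⟩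
  smul_mem' c f h τ := ⟨fun a => Submodule.smul_mem _ c ((h τ).1 a), fun a => by
    rw [Pi.smul_apply, (h τ).2 a, smul_zero]⟩

theorem single_mem_sector {s : Bool} {κ : Kind} {τ : Lab q} (hτ : Adm s τ) {k : Lab q → ℂ}
    (hk : k ∈ κ.space τ) : (Pi.single τ k : Coord q) ∈ sector s κ := by
  intro τ'
  by_cases h : τ' = τ
  · subst h
    simp [hτ, hk]
  · simp [h]

theorem IsMonomial.sector_stable (hρ : IsMonomial ρ) {s : Bool} {κ : Kind} (g : G) {f : Coord q}
    (hf : f ∈ sector s κ) : ρ g f ∈ sector s κ := by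
  obtain ⟨π, t, hπ, h⟩ := hρ.exists_map g
  intro τ
  obtain ⟨τ, rfl⟩ := π.surjective τ
  have hfun : ρ g f (π τ) = t τ • fun σ => f τ (π.symm σ) := by
    funext σ
    obtain ⟨σ, rfl⟩ := π.surjective σ
    simp [h]
  rw [adm_map, hfun]
  refine ⟨fun a => Submodule.smul_mem _ _ ?_, fun a => ?_⟩
  · refine Kind.comp_mem_space π.symm (fun x y => ?_) ?_
    · rw [← hπ, π.apply_symm_apply, π.apply_symm_apply]
    · rw [π.symm_apply_apply]; exact (hf τ).1 a
  · rw [(hf τ).2 a]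
    exact smul_zero _

/-- Averaging the Pauli elements against the character of `τ` is the projection onto the fibre over
`τ`. -/
theorem IsMonomial.single_mem (hρ : IsMonomial ρ) {S : Submodule ℂ (Coord q)}
    (hS : ∀ g, ∀ v ∈ S, ρ g v ∈ S) {f : Coord q} (hf : f ∈ S) (τ : Lab q) :
    (Pi.single τ (f τ) : Coord q) ∈ S := by
  choose g hg using hρ.exists_pauli
  have : (Pi.single τ (f τ) : Coord q) = ((4 : ℂ) ^ q)⁻¹ • ∑ μ, chi μ τ • ρ (g μ) f := by
    funext τ' σ
    simp only [Pi.smul_apply, Finset.sum_apply, hg, smul_eq_mul]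
    have h : ∀ μ, chi μ τ * (chi μ τ' * f τ' σ) = chi μ (τ + τ') * f τ' σ := fun μ => by
      rw [chi_add_right]; ring
    simp only [h, ← Finset.sum_mul, sum_chi, Lab.add_eq_iff, zero_add]
    by_cases hτ : τ = τ'
    · subst hτ
      simp
    · rw [Pi.single_eq_of_ne (Ne.symm hτ), if_neg hτ]
      simp
  rw [this]
  exact S.smul_mem _ (S.sum_mem fun μ _ => S.smul_mem _ (hS _ _ hf))

theorem transv_single {g : G} {P : Lab q} {t : Lab q → ℂ}
    (hg : ∀ f τ σ, ρ g f (transv P τ) (transv P σ) = t τ * f τ σ) (τ : Lab q) (k : Lab q → ℂ) :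
    ρ g (Pi.single τ k) = Pi.single (transv P τ) (t τ • fun σ => k (transv P σ)) := by
  funext τ' σ
  obtain ⟨τ', rfl⟩ : ∃ x, τ' = transv P x := ⟨transv P τ', (transv_transv P τ').symm⟩
  obtain ⟨σ, rfl⟩ : ∃ x, σ = transv P x := ⟨transv P σ, (transv_transv P σ).symm⟩
  rw [hg]
  by_cases h : τ' = τ
  · subst h
    simp
  · rw [Pi.single_eq_of_ne h, Pi.single_eq_of_ne]
    · simp
    · exact fun h' => h ((transvEquiv P).injective h')

/-- A form of Mackey's criterion: an invariant `S` is the sum of its fibres `T τ`, a non-zero fibre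
is carried to all others of the sector by transvections, and each fibre is irreducible under the
transvections fixing `τ` by `Kind.space_le`. -/
theorem IsMonomial.isIrreducibleSubspace (hρ : IsMonomial ρ) {s : Bool} {κ : Kind}
    (hne : (sector s κ : Submodule ℂ (Coord q)) ≠ ⊥) : IsIrreducibleSubspace ρ (sector s κ) where
  stable g _ hv := hρ.sector_stable g hv
  ne_bot := hne
  le S hS hle hS0 := by
    let T : Lab q → Submodule ℂ (Lab q → ℂ) := fun τ =>
      S.comap (LinearMap.single ℂ (fun _ : Lab q => Lab q → ℂ) τ)
    have memT : ∀ τ k, k ∈ T τ ↔ (Pi.single τ k : Coord q) ∈ S := fun τ k => Iff.rfl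
    have hT : ∀ P τ, ∀ k ∈ T τ, (fun σ => k (transv P σ)) ∈ T (transv P τ) := by
      intro P τ k hk
      obtain ⟨g, t, ht0, -, hg⟩ := hρ.exists_transv P
      have h1 := hS g _ ((memT _ _).1 hk)
      rw [transv_single hg, ← memT] at h1
      exact (Submodule.smul_mem_iff _ (ht0 τ)).1 h1
    have hTle : ∀ τ, Adm s τ → T τ ≤ κ.space τ := by
      intro τ hτ k hk
      have := (hle ((memT _ _).1 hk) τ).1 hτ
      rwa [Pi.single_eq_same] at this
    obtain ⟨f, hf, hf0⟩ := S.ne_bot_iff.1 hS0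
    obtain ⟨τ, hτ⟩ := Function.ne_iff.1 hf0
    have hτs : Adm s τ := by
      by_contra h
      exact hτ ((hle hf τ).2 h)
    have hTτ : T τ ≠ ⊥ := (Submodule.ne_bot_iff _).2 ⟨f τ, hρ.single_mem hS hf τ, hτ⟩
    have hinv : ∀ P τ, T τ ≠ ⊥ → T (transv P τ) ≠ ⊥ := by
      intro P τ h
      obtain ⟨k, hk, hk0⟩ := (Submodule.ne_bot_iff _).1 h
      refine (Submodule.ne_bot_iff _).2 ⟨_, hT P τ k hk, fun h' => hk0 (funext fun σ => ?_)⟩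
      simpa using congrFun h' (transv P σ)
    have hall : ∀ τ', Adm s τ' → T τ' ≠ ⊥ := by
      intro τ' hτ'
      cases s with
      | false => rwa [adm_false.1 hτ', ← adm_false.1 hτs]
      | true =>
        have h1 := adm_true.1 hτs
        have h2 := adm_true.1 hτ'
        -- With both fixed labels zero every transvection is allowed, and the statement becomes
        -- transitivity on non-zero labels.
        have := eq_of_invariant (τ := (0 : Lab q)) (ρ := 0) (fun τ => T τ ≠ ⊥)
          (fun P _ _ ν => propext ⟨fun h => by simpa using hinv P _ h, hinv P ν⟩)
          (ν := τ) (ν' := τ') (by simp) (by simp) h1 h1 h1 (by simpa using h1) h2 h2 h2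
          (by simpa using h2)
        exact this ▸ hTτ
    intro f hf
    rw [← Finset.univ_sum_single f]
    refine S.sum_mem fun τ _ => ?_
    by_cases hτ : Adm s τ
    · refine Kind.space_le (fun P hP k hk => ?_) (hTle τ hτ) (hall τ hτ) ((hf τ).1 hτ)
      have := hT P τ k hk
      rwa [transv_of_eq_zero hP] at this
    · rw [(hf τ).2 hτ, Pi.single_zero]
      exact S.zero_mem

/-! ### Equivalences between sectors -/

/-- The map that replaces `f τ` by a multiple of the indicator function of the support of `κ`. -/
def evalMap (q : ℕ) (κ : Kind) [∀ τ : Lab q, DecidablePred (κ.Supp τ)] :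
    Coord q →ₗ[ℂ] Coord q where
  toFun f τ ν := if κ.Supp τ ν then f τ 0 else 0
  map_add' f f' := by funext τ ν; simp only [Pi.add_apply]; split_ifs <;> simp
  map_smul' c f := by funext τ ν; simp

/-- The value at `σ = 0` is carried to the value at `0` with a factor depending only on `τ`, and
supports move along with the symplectic map. -/
theorem IsMonomial.evalMap_apply (hρ : IsMonomial ρ) (κ : Kind)
    [∀ τ : Lab q, DecidablePred (κ.Supp τ)] (g : G) (f : Coord q) :
    evalMap q κ (ρ g f) = ρ g (evalMap q κ f) := by
  obtain ⟨π, t, hπ, h⟩ := hρ.exists_map g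
  funext τ ν
  obtain ⟨τ, rfl⟩ := π.surjective τ
  obtain ⟨ν, rfl⟩ := π.surjective ν
  have h0 := h f τ 0
  rw [map_zero] at h0
  simp only [evalMap, LinearMap.coe_mk, AddHom.coe_mk, h, h0, Kind.supp_map π hπ, mul_ite, mul_zero]

theorem evalMap_mem {s : Bool} {κ : Kind} [∀ τ : Lab q, DecidablePred (κ.Supp τ)]
    (hκ : ∀ b e, κ ≠ .spec b e) {f : Coord q} (hf : f ∈ sector s .point0) :
    evalMap q κ f ∈ sector s κ := by
  intro τ
  refine ⟨fun _ => ⟨fun σ hσ => if_neg hσ, ?_⟩, fun hτ => ?_⟩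
  · cases κ with
    | point0 => trivial
    | pointT => trivial
    | const b => exact fun σ σ' h h' => (if_pos h).trans (if_pos h').symm
    | spec b e => exact absurd rfl (hκ b e)
  · funext σ
    simp [evalMap, (hf τ).2 hτ]

theorem exists_evalMap_ne_zero {s : Bool} {κ : Kind} [∀ τ : Lab q, DecidablePred (κ.Supp τ)]
    (hne : (sector s κ : Submodule ℂ (Coord q)) ≠ ⊥) :
    ∃ f ∈ (sector s .point0 : Submodule ℂ (Coord q)), evalMap q κ f ≠ 0 := by
  obtain ⟨h, hh, hh0⟩ := (Submodule.ne_bot_iff _).1 hne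
  obtain ⟨τ, hτ⟩ := Function.ne_iff.1 hh0
  obtain ⟨ν, hν⟩ := Function.ne_iff.1 hτ
  have hτs : Adm s τ := by
    by_contra h
    exact hτ ((hh τ).2 h)
  have hsupp : κ.Supp τ ν := by
    by_contra h
    exact hν (((hh τ).1 hτs).1 ν h)
  refine ⟨Pi.single τ (Pi.single 0 1), single_mem_sector hτs
    ⟨fun σ hσ => Pi.single_eq_of_ne hσ _, trivial⟩, fun h0 => ?_⟩
  have := congrFun (congrFun h0 τ) ν
  simp [evalMap, hsupp] at this

/-- The Fourier transform in the second argument. -/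
def fourierMap (q : ℕ) : Coord q →ₗ[ℂ] Coord q where
  toFun f τ := fourier (f τ)
  map_add' f f' := by funext τ ν; exact fourier_add _ _ _
  map_smul' c f := by funext τ ν; exact fourier_smul _ _ _

theorem IsMonomial.fourierMap_apply (hρ : IsMonomial ρ) (g : G) (f : Coord q) :
    fourierMap q (ρ g f) = ρ g (fourierMap q f) := by
  obtain ⟨π, t, hπ, h⟩ := hρ.exists_map g
  funext τ ν
  obtain ⟨τ, rfl⟩ := π.surjective τ
  obtain ⟨ν, rfl⟩ := π.surjective ν
  rw [h]
  change fourier (ρ g f (π τ)) (π ν) = t τ * fourier (f τ) ν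
  have h1 : fourier (fun σ => ρ g f (π τ) (π σ)) ν = fourier (ρ g f (π τ)) (π ν) :=
    fourier_comp π.toEquiv hπ ν
  rw [← h1, ← fourier_smul]
  congr 1
  funext σ
  exact h f τ σ

/-- Support and parity trade places: functions odd under translation by `τ` have a transform
supported on labels anticommuting with `τ`, and functions supported on labels commuting with `τ`
have an even transform. -/
theorem fourierMap_mem {s : Bool} {f : Coord q} (hf : f ∈ sector s (.spec 0 0)) :
    fourierMap q f ∈ sector s (.spec 1 0) := by
  intro τ
  refine ⟨fun hτ => ?_, fun hτ => ?_⟩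
  · have hk := (hf τ).1 hτ
    refine alt_mem_space (fun ν hν => ?_) (fun ν => ?_) ?_
    · have h0 : sp ν τ = 0 := (ZMod2.cases _).resolve_right fun h => hν (orb_one.2 h)
      refine fourier_eq_zero hk.2.1 ?_
      rw [chi_comm, chi_eq_one h0]
      simp [parity]
    · change fourier _ _ = _ * fourier _ _
      rw [fourier_comp_add hk.1]
      simp [parity]
    · rw [← fourier_zero]
      change fourier (fourier _) 0 = 0
      rw [fourier_fourier, hk.1 0 fun h => h.2.1 rfl, mul_zero]
  · change fourier (f τ) = 0
    rw [(hf τ).2 hτ]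
    funext ν
    simp [fourier]

theorem fourierMap_ne_zero {f : Coord q} (hf : f ≠ 0) : fourierMap q f ≠ 0 := by
  intro h
  refine hf (funext fun τ => funext fun ν => ?_)
  have h1 : fourier (fourier (f τ)) ν = 0 := by
    rw [show fourier (f τ) = 0 from congrFun h τ]
    simp [fourier]
  rw [fourier_fourier] at h1
  exact (mul_eq_zero.1 h1).resolve_left (pow_ne_zero _ (by norm_num))

/-! ### Invariants of sectors -/

/-- An equivariant isomorphism preserves Pauli characters, so it sends a function concentrated over
`τ` to another such function. There it commutes with the transvections fixing `τ`, so any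
combination of them that acts by a scalar on one side acts by the same scalar on the other. -/
theorem IsMonomial.eq_of_isEquivariant (hρ : IsMonomial ρ) {s s' : Bool} {κ κ' : Kind}
    (hne : (sector s κ : Submodule ℂ (Coord q)) ≠ ⊥)
    (φ : (sector s κ : Submodule ℂ (Coord q)) ≃ₗ[ℂ] (sector s' κ' : Submodule ℂ (Coord q)))
    (hφ : IsEquivariant ρ φ) :
    s = s' ∧ κ.zval q (s = false) = κ'.zval q (s = false) ∧ κ.tval = κ'.tval := by
  obtain ⟨f, hf, hf0⟩ := (Submodule.ne_bot_iff _).1 hne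
  obtain ⟨τ, hτ⟩ := Function.ne_iff.1 hf0
  have hτs : Adm s τ := by
    by_contra h
    exact hτ ((hf τ).2 h)
  have hk := (hf τ).1 hτs
  set k := f τ
  let x : (sector s κ : Submodule ℂ (Coord q)) := ⟨Pi.single τ k, single_mem_sector hτs hk⟩
  have hx0 : x ≠ 0 := fun h => hτ (by
    have := congrFun (congrArg Subtype.val h) τ
    simpa [x] using this)
  have hy0 : ((φ x : Coord q)) ≠ 0 := fun h => hx0 (by
    have : φ x = 0 := Subtype.ext h
    simpa using this)
  set k' := (φ x : Coord q) τ
  have hy : (φ x : Coord q) = Pi.single τ k' := by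
    funext τ' σ
    by_cases h : τ' = τ
    · subst h
      simp [k']
    · rw [Pi.single_eq_of_ne h]
      -- Some Pauli element has opposite characters at `τ` and `τ'`, which excludes a component of
      -- the image over `τ'`.
      have hne' : τ + τ' ≠ 0 := fun h' => h (by rw [Lab.add_eq_iff, zero_add] at h'; exact h'.symm)
      obtain ⟨μ, hμ⟩ := exists_sp_eq_one hne'
      obtain ⟨g, hg⟩ := hρ.exists_pauli μ
      have h1 : ρ g (x : Coord q) = ((chi μ τ • x : sector s κ) : Coord q) := by
        funext τ'' σ
        rw [hg]
        by_cases h'' : τ'' = τ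
        · subst h''
          rfl
        · simp [x, h'']
      have h2 := hφ g x (chi μ τ • x) h1.symm
      rw [map_smul] at h2
      have h3 := congrFun (congrFun h2 τ') σ
      rw [hg] at h3
      have h4 : chi μ τ * chi μ τ' = -1 := by rw [← chi_add_right, chi_eq_neg_one hμ]
      have h5 : chi μ τ * (φ x : Coord q) τ' σ = chi μ τ' * (φ x : Coord q) τ' σ := h3
      change (φ x : Coord q) τ' σ = 0
      have h6 := chi_mul_self μ τ
      linear_combination (-(φ x : Coord q) τ' σ / 2) * h6 + (φ x : Coord q) τ' σ / 2 * h4 +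
        chi μ τ / 2 * h5
  have hk'0 : k' ≠ 0 := by
    intro h
    rw [hy, h, Pi.single_zero] at hy0
    exact hy0 rfl
  have hτs' : Adm s' τ := by
    by_contra h
    exact hk'0 (((φ x).2 τ).2 h)
  have hk' : k' ∈ κ'.space τ := ((φ x).2 τ).1 hτs'
  have hs : s = s' := by
    have h := hτs.symm.trans hτs'
    cases s <;> cases s' <;> simp at h ⊢
  choose g t ht0 ht1 hg using hρ.exists_transv
  have hact : ∀ P, sp P τ = 0 → ∀ k : Lab q → ℂ,
      ρ (g P) (Pi.single τ k) = Pi.single τ fun σ => k (transv P σ) := by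
    intro P hP k
    rw [transv_single (hg P), ht1 P τ hP, one_smul, transv_of_eq_zero hP]
  -- The image of `x` under the transvection along `P`, extended by zero to directions that do not
  -- fix `τ`, so that weighted sums may run over all `P`.
  let X : Lab q → (sector s κ : Submodule ℂ (Coord q)) := fun P =>
    if h : sp P τ = 0 then ⟨_, single_mem_sector hτs (Kind.transv_mem_space h hk)⟩ else 0
  have hX : ∀ P, (X P : Coord q) =
      Pi.single τ fun σ => if sp P τ = 0 then k (transv P σ) else 0 := by
    intro P
    by_cases h : sp P τ = 0
    · simp [X, h]
    · simp only [X, h, dif_neg, not_false_eq_true, if_false]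
      rw [show (fun _ : Lab q => (0 : ℂ)) = 0 from rfl, Pi.single_zero]
      rfl
  have hφX : ∀ P, (φ (X P) : Coord q) =
      Pi.single τ fun σ => if sp P τ = 0 then k' (transv P σ) else 0 := by
    intro P
    by_cases h : sp P τ = 0
    · rw [hφ (g P) x (X P), hy, hact P h]
      · simp [h]
      · rw [hX, hact P h]
        simp [h]
    · simp only [X, h, dif_neg, not_false_eq_true, if_false]
      rw [show (fun _ : Lab q => (0 : ℂ)) = 0 from rfl, Pi.single_zero, map_zero]
      rfl
  have key : ∀ (c : ℂ) (w : Lab q → ℂ), (∀ σ, ∑ P, w P * (if sp P τ = 0 then k (transv P σ) else 0)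
      = c * k σ) → ∀ σ, ∑ P, w P * (if sp P τ = 0 then k' (transv P σ) else 0) = c * k' σ := by
    intro c w h σ
    have h1 : ∑ P, w P • X P = c • x := by
      apply Subtype.ext
      rw [Submodule.coe_sum]
      funext τ' σ
      by_cases h' : τ' = τ
      · subst h'
        simpa [hX, x] using h σ
      · simp [hX, x, h']
    have h2 := congrFun (congrFun (congrArg Subtype.val (congrArg φ h1)) τ) σ
    rw [map_sum, Submodule.coe_sum, map_smul] at h2
    simpa [hφX, k'] using h2
  obtain ⟨ν, hν⟩ := Function.ne_iff.1 hk'0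
  have hz : (τ = 0) = (s = false) := propext hτs
  refine ⟨hs, ?_, ?_⟩
  · have h1 := key (κ.zval q (τ = 0)) (fun _ => 1) (fun σ => by
      simp only [one_mul]; exact Kind.sum_transv hk σ) ν
    simp only [one_mul] at h1
    rw [Kind.sum_transv hk'] at h1
    have h2 := mul_right_cancel₀ hν h1
    simp only [hz] at h2
    exact h2.symm
  · have h1 := key κ.tval (Pi.single τ 1) (fun σ => by
      rw [Finset.sum_eq_single τ (fun P _ hP => by simp [hP]) (by simp)]
      simp [Kind.transv_self hk]) ν
    rw [Finset.sum_eq_single τ (fun P _ hP => by simp [hP]) (by simp)] at h1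
    simp only [Pi.single_eq_same, sp_self, if_true, one_mul, Kind.transv_self hk'] at h1
    exact (mul_right_cancel₀ hν h1).symm

end monomial

/-! ### The fourteen sectors decompose the functions of two labels -/

section monomial
variable {q : ℕ}

/-- The sectors into which functions of two labels are decomposed. -/
def sectorIndex : Fin 14 → Bool × Kind :=
  -- The order is that of the summands for three or more qubits. Over `τ = 0` fewer kinds appear:
  -- `pointT` coincides with `point0`, the kinds with `b = 1` have empty support, and oddness under
  -- translation by `0` kills `spec 0 0`.
  ![(false, .point0), (true, .point0), (true, .pointT), (false, .const 0), (false, .spec 0 1),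
    (false, .spec 0 (-1)), (true, .const 0), (true, .spec 0 1), (true, .spec 0 (-1)),
    (true, .const 1), (true, .spec 1 1), (true, .spec 1 (-1)), (true, .spec 0 0), (true, .spec 1 0)]

/-- The `i`-th sector. -/
def sectorAt (q : ℕ) (i : Fin 14) : Submodule ℂ (Coord q) :=
  sector (sectorIndex i).1 (sectorIndex i).2

theorem sum_fourteen {M : Type*} [AddCommMonoid M] (x : Fin 14 → M) :
    ∑ i, x i = x 0 + (x 1 + (x 2 + (x 3 + (x 4 + (x 5 + (x 6 + (x 7 + (x 8 + (x 9 + (x 10 +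
      (x 11 + (x 12 + x 13)))))))))))) := by
  simp [Fin.sum_univ_succ]

theorem sector_apply_eq_zero {s : Bool} {κ : Kind} {f : Coord q} (hf : f ∈ sector s κ)
    {τ σ : Lab q} (h : ¬ κ.Supp τ σ) : f τ σ = 0 := by
  by_cases hτ : Adm s τ
  · exact ((hf τ).1 hτ).1 σ h
  · rw [(hf τ).2 hτ]; rfl

/-- Over each `τ`, evaluation at `0` and `τ` isolates the point kinds. The commuting and
anticommuting parts have disjoint supports, and `eq_zero_of_add_eq_zero` applies to each. -/
theorem eq_zero_of_sum_sectors {w : Fin 14 → Coord q} (hw : ∀ i, w i ∈ sectorAt q i)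
    (h : ∑ i, w i = 0) (i : Fin 14) : w i = 0 := by
  have hsum : ∀ τ σ, ∑ i, w i τ σ = 0 := fun τ σ => by
    have := congrFun (congrFun h τ) σ
    simpa using this
  simp only [sum_fourteen] at hsum
  have h0 : w 0 ∈ sector false .point0 := hw 0
  have h1 : w 1 ∈ sector true .point0 := hw 1
  have h2 : w 2 ∈ sector true .pointT := hw 2
  have h3 : w 3 ∈ sector false (.const 0) := hw 3
  have h4 : w 4 ∈ sector false (.spec 0 1) := hw 4
  have h5 : w 5 ∈ sector false (.spec 0 (-1)) := hw 5
  have h6 : w 6 ∈ sector true (.const 0) := hw 6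
  have h7 : w 7 ∈ sector true (.spec 0 1) := hw 7
  have h8 : w 8 ∈ sector true (.spec 0 (-1)) := hw 8
  have h9 : w 9 ∈ sector true (.const 1) := hw 9
  have h10 : w 10 ∈ sector true (.spec 1 1) := hw 10
  have h11 : w 11 ∈ sector true (.spec 1 (-1)) := hw 11
  have h12 : w 12 ∈ sector true (.spec 0 0) := hw 12
  have h13 : w 13 ∈ sector true (.spec 1 0) := hw 13
  have horb : ∀ τ b, ¬ Orb τ b (0 : Lab q) := fun τ b h => h.2.1 rfl
  have horb' : ∀ (τ : Lab q) b, ¬ Orb τ b τ := fun τ b h => h.2.2 rfl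
  suffices hall : ∀ τ : Lab q, ∀ i, w i τ = 0 from funext fun τ => hall τ i
  intro τ
  by_cases hτ : τ = 0
  · have hF : Adm false τ := adm_false.2 hτ
    have hT : ¬ Adm true τ := fun h => adm_true.1 h hτ
    have z1 := (h1 τ).2 hT
    have z2 := (h2 τ).2 hT
    have z6 := (h6 τ).2 hT
    have z7 := (h7 τ).2 hT
    have z8 := (h8 τ).2 hT
    have z9 := (h9 τ).2 hT
    have z10 := (h10 τ).2 hT
    have z11 := (h11 τ).2 hT
    have z12 := (h12 τ).2 hT
    have z13 := (h13 τ).2 hT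
    have hsum' := hsum τ
    simp only [z1, z2, z6, z7, z8, z9, z10, z11, z12, z13, Pi.zero_apply, add_zero, zero_add]
      at hsum'
    have z0 : w 0 τ = 0 := by
      funext σ
      by_cases hσ : σ = 0
      · subst hσ
        have := hsum' 0
        rw [sector_apply_eq_zero h3 (horb _ _), sector_apply_eq_zero h4 (horb _ _),
          sector_apply_eq_zero h5 (horb _ _)] at this
        simpa using this
      · exact sector_apply_eq_zero h0 hσ
    obtain ⟨z3, z4, z5, -⟩ := eq_zero_of_add_eq_zero ((h3 τ).1 hF) ((h4 τ).1 hF) ((h5 τ).1 hF)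
      (zero_mem _) (fun σ => by
        have := hsum' σ
        rw [z0] at this
        simp at this ⊢
        linear_combination this)
    intro i
    fin_cases i <;> assumption
  · have hF : ¬ Adm false τ := fun h => hτ (adm_false.1 h)
    have hT : Adm true τ := adm_true.2 hτ
    have z0 := (h0 τ).2 hF
    have z3 := (h3 τ).2 hF
    have z4 := (h4 τ).2 hF
    have z5 := (h5 τ).2 hF
    have hsum' := hsum τ
    simp only [z0, z3, z4, z5, Pi.zero_apply, zero_add] at hsum'
    have z1 : w 1 τ = 0 := by
      funext σ
      by_cases hσ : σ = 0
      · subst hσ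
        have := hsum' 0
        rw [sector_apply_eq_zero h2 (Ne.symm hτ), sector_apply_eq_zero h6 (horb _ _),
          sector_apply_eq_zero h7 (horb _ _), sector_apply_eq_zero h8 (horb _ _),
          sector_apply_eq_zero h9 (horb _ _), sector_apply_eq_zero h10 (horb _ _),
          sector_apply_eq_zero h11 (horb _ _), sector_apply_eq_zero h12 (horb _ _),
          sector_apply_eq_zero h13 (horb _ _)] at this
        simpa using this
      · exact sector_apply_eq_zero h1 hσ
    have z2 : w 2 τ = 0 := by
      funext σ
      by_cases hσ : σ = τ
      · subst hσ
        have := hsum' σ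
        rw [sector_apply_eq_zero h1 hτ, sector_apply_eq_zero h6 (horb' _ _),
          sector_apply_eq_zero h7 (horb' _ _), sector_apply_eq_zero h8 (horb' _ _),
          sector_apply_eq_zero h9 (horb' _ _), sector_apply_eq_zero h10 (horb' _ _),
          sector_apply_eq_zero h11 (horb' _ _), sector_apply_eq_zero h12 (horb' _ _),
          sector_apply_eq_zero h13 (horb' _ _)] at this
        simpa using this
      · exact sector_apply_eq_zero h2 hσ
    simp only [z1, z2, Pi.zero_apply, zero_add] at hsum'
    have hdisj : ∀ σ, ¬ Orb τ 0 σ ∨ ¬ Orb τ 1 σ := fun σ => by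
      by_contra! h
      exact zero_ne_one (h.1.1.symm.trans h.2.1)
    obtain ⟨z6, z7, z8, z12⟩ := eq_zero_of_add_eq_zero ((h6 τ).1 hT) ((h7 τ).1 hT) ((h8 τ).1 hT)
      ((h12 τ).1 hT) (fun σ => by
        rcases hdisj σ with hσ | hσ
        · rw [sector_apply_eq_zero h6 hσ, sector_apply_eq_zero h7 hσ, sector_apply_eq_zero h8 hσ,
            sector_apply_eq_zero h12 hσ]
          simp
        · have := hsum' σ
          rw [sector_apply_eq_zero h9 hσ, sector_apply_eq_zero h10 hσ, sector_apply_eq_zero h11 hσ,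
            sector_apply_eq_zero h13 hσ] at this
          linear_combination this)
    obtain ⟨z9, z10, z11, z13⟩ := eq_zero_of_add_eq_zero ((h9 τ).1 hT) ((h10 τ).1 hT)
      ((h11 τ).1 hT) ((h13 τ).1 hT) (fun σ => by
        have := hsum' σ
        rw [z6, z7, z8, z12] at this
        simp only [Pi.zero_apply, zero_add] at this
        linear_combination this)
    intro i
    fin_cases i <;> assumption

theorem iSupIndep_sectorAt (q : ℕ) : iSupIndep (sectorAt q) := by
  classical
  rw [iSupIndep_iff_finsetSum_eq_zero_imp_eq_zero]
  intro s v hv h i hi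
  have := eq_zero_of_sum_sectors (w := fun i => if i ∈ s then v i else 0) (fun i => by
    split_ifs with h'
    · exact hv i h'
    · exact zero_mem _) (by simpa [Finset.sum_ite_mem] using h) i
  simpa [hi] using this

/-- The restriction of a family of functions to a sector. -/
def restrictSector (s : Bool) (f : Coord q) : Coord q := fun τ => if Adm s τ then f τ else 0

theorem restrictSector_mem {s : Bool} {κ : Kind} {f : Coord q} (hf : ∀ τ, f τ ∈ κ.space τ) :
    restrictSector s f ∈ sector s κ := fun τ =>
  ⟨fun h => by rw [restrictSector, if_pos h]; exact hf τ, fun h => if_neg h⟩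

theorem iSup_sectorAt (q : ℕ) : ⨆ i, sectorAt q i = ⊤ := by
  refine eq_top_iff.2 fun f _ => ?_
  have := fun b τ => exists_decomposition_of_supp (τ := τ) (b := b)
    (k := fun σ => if Orb τ b σ then f τ σ else 0) (fun σ hσ => if_neg hσ)
  choose a ha p hp n hn t ht hsum using this
  let w : Fin 14 → Coord q :=
    ![restrictSector false fun τ => Pi.single 0 (f τ 0),
      restrictSector true fun τ => Pi.single 0 (f τ 0),
      restrictSector true fun τ => Pi.single τ (f τ τ),
      restrictSector false (a 0), restrictSector false (p 0), restrictSector false (n 0),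
      restrictSector true (a 0), restrictSector true (p 0), restrictSector true (n 0),
      restrictSector true (a 1), restrictSector true (p 1), restrictSector true (n 1),
      restrictSector true (t 0), restrictSector true (t 1)]
  have hw : ∀ i, w i ∈ sectorAt q i := by
    have h0 : ∀ s, (restrictSector s fun τ => Pi.single 0 (f τ 0)) ∈ sector s .point0 := fun s =>
      restrictSector_mem fun τ => ⟨fun σ hσ => Pi.single_eq_of_ne hσ _, trivial⟩
    have h1 : (restrictSector true fun τ => Pi.single τ (f τ τ)) ∈ sector true .pointT :=
      restrictSector_mem fun τ => ⟨fun σ hσ => Pi.single_eq_of_ne hσ _, trivial⟩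
    intro i
    fin_cases i
    exacts [h0 _, h0 _, h1, restrictSector_mem (ha 0), restrictSector_mem (hp 0),
      restrictSector_mem (hn 0), restrictSector_mem (ha 0), restrictSector_mem (hp 0),
      restrictSector_mem (hn 0), restrictSector_mem (ha 1), restrictSector_mem (hp 1),
      restrictSector_mem (hn 1), restrictSector_mem (ht 0), restrictSector_mem (ht 1)]
  have hf : f = ∑ i, w i := by
    funext τ σ
    have e0 := congrFun (hsum 0 τ) σ
    have e1 := congrFun (hsum 1 τ) σ
    simp only [Pi.add_apply] at e0 e1
    rw [sum_fourteen]
    simp only [Pi.add_apply]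
    change f τ σ = restrictSector false (fun τ => Pi.single 0 (f τ 0)) τ σ +
      (restrictSector true (fun τ => Pi.single 0 (f τ 0)) τ σ +
      (restrictSector true (fun τ => Pi.single τ (f τ τ)) τ σ +
      (restrictSector false (a 0) τ σ + (restrictSector false (p 0) τ σ +
      (restrictSector false (n 0) τ σ +
      (restrictSector true (a 0) τ σ + (restrictSector true (p 0) τ σ +
      (restrictSector true (n 0) τ σ +
      (restrictSector true (a 1) τ σ + (restrictSector true (p 1) τ σ +
      (restrictSector true (n 1) τ σ +
      (restrictSector true (t 0) τ σ + restrictSector true (t 1) τ σ))))))))))))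
    by_cases hτ : τ = 0
    · have hF : Adm false τ := adm_false.2 hτ
      have hT : ¬ Adm true τ := fun h => adm_true.1 h hτ
      simp only [restrictSector, if_pos hF, if_neg hT, Pi.zero_apply, add_zero, zero_add]
      -- For `τ = 0` the parity condition reads `k = -k`, so the fourth component of the
      -- decomposition disappears in the trivial sector.
      have ht0 : t 0 τ σ = 0 := by
        have := (ht 0 τ).2.1 σ
        rw [hτ, add_zero] at this
        simp [parity] at this
        rw [hτ]
        linear_combination this / 2
      rw [ht0] at e0
      by_cases hσ : σ = 0
      · subst hσ
        rw [if_neg fun h => h.2.1 rfl] at e0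
        rw [Pi.single_eq_same]
        linear_combination e0
      · rw [if_pos ⟨by rw [hτ]; simp, hσ, by rwa [hτ]⟩] at e0
        rw [Pi.single_eq_of_ne hσ]
        linear_combination e0
    · have hF : ¬ Adm false τ := fun h => hτ (adm_false.1 h)
      have hT : Adm true τ := adm_true.2 hτ
      simp only [restrictSector, if_neg hF, if_pos hT, Pi.zero_apply, zero_add]
      by_cases h0 : σ = 0
      · subst h0
        rw [if_neg fun h => h.2.1 rfl] at e0 e1
        rw [Pi.single_eq_same, Pi.single_eq_of_ne (Ne.symm hτ)]
        linear_combination e0 + e1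
      by_cases h1 : σ = τ
      · rw [if_neg fun h => h.2.2 h1] at e0 e1
        rw [h1] at e0 e1 ⊢
        rw [Pi.single_eq_same, Pi.single_eq_of_ne hτ]
        linear_combination e0 + e1
      rw [Pi.single_eq_of_ne h0, Pi.single_eq_of_ne h1]
      have : f τ σ = (if Orb τ 0 σ then f τ σ else 0) + if Orb τ 1 σ then f τ σ else 0 := by
        rcases ZMod2.cases (sp σ τ) with h | h
        · have h2 : Orb τ 0 σ := ⟨h, h0, h1⟩
          have h3 : ¬ Orb τ 1 σ := fun h' => zero_ne_one (h.symm.trans h'.1)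
          simp [h2, h3]
        · have h2 : Orb τ 1 σ := ⟨h, h0, h1⟩
          have h3 : ¬ Orb τ 0 σ := fun h' => zero_ne_one (h'.1.symm.trans h)
          simp [h2, h3]
      linear_combination this + e0 + e1
  rw [hf]
  exact Submodule.sum_mem _ fun i _ => Submodule.mem_iSup_of_mem i (hw i)

/-- The representative of the equivalence class of the `i`-th sector. -/
def baseIndex : Fin 14 → Fin 14 := ![0, 1, 1, 0, 4, 5, 1, 7, 8, 1, 10, 11, 12, 12]

/-- The point and constant sectors are reached from `point0` by `evalMap`, sector `13` from sector
`12` by the Fourier transform, and every other sector is its own representative. -/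
theorem exists_intertwiner {G : Type*} [Group G] {ρ : Representation ℂ G (Coord q)}
    (hρ : IsMonomial ρ) {i : Fin 14} (hi : sectorAt q i ≠ ⊥)
    (hb : sectorAt q (baseIndex i) ≠ ⊥) :
    ∃ M : Coord q →ₗ[ℂ] Coord q, (∀ g v, M (ρ g v) = ρ g (M v)) ∧
      (∀ v ∈ sectorAt q (baseIndex i), M v ∈ sectorAt q i) ∧
      ∃ v ∈ sectorAt q (baseIndex i), M v ≠ 0 := by
  classical
  have hid : baseIndex i = i → ∃ M : Coord q →ₗ[ℂ] Coord q, (∀ g v, M (ρ g v) = ρ g (M v)) ∧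
      (∀ v ∈ sectorAt q (baseIndex i), M v ∈ sectorAt q i) ∧
      ∃ v ∈ sectorAt q (baseIndex i), M v ≠ 0 := fun h => by
    obtain ⟨v, hv, hv0⟩ := (Submodule.ne_bot_iff _).1 hb
    exact ⟨LinearMap.id, fun g v => rfl, fun v hv => h ▸ hv, v, hv, hv0⟩
  have heval : ∀ s κ, (∀ b e, κ ≠ Kind.spec b e) → (sector s κ : Submodule ℂ (Coord q)) ≠ ⊥ →
      ∃ M : Coord q →ₗ[ℂ] Coord q, (∀ g v, M (ρ g v) = ρ g (M v)) ∧
      (∀ v ∈ (sector s .point0 : Submodule ℂ (Coord q)), M v ∈ sector s κ) ∧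
      ∃ v ∈ (sector s .point0 : Submodule ℂ (Coord q)), M v ≠ 0 := fun s κ hκ hne =>
    ⟨evalMap q κ, hρ.evalMap_apply κ, fun v hv => evalMap_mem hκ hv, exists_evalMap_ne_zero hne⟩
  fin_cases i
  · exact hid rfl
  · exact hid rfl
  · exact heval true .pointT (by simp) hi
  · exact heval false (.const 0) (by simp) hi
  · exact hid rfl
  · exact hid rfl
  · exact heval true (.const 0) (by simp) hi
  · exact hid rfl
  · exact hid rfl
  · exact heval true (.const 1) (by simp) hi
  · exact hid rfl
  · exact hid rfl
  · exact hid rfl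
  · obtain ⟨v, hv, hv0⟩ := (Submodule.ne_bot_iff _).1 hb
    exact ⟨fourierMap q, hρ.fourierMap_apply, fun v hv => fourierMap_mem hv, v, hv,
      fourierMap_ne_zero hv0⟩

/-- The invariants that distinguish inequivalent sectors. -/
def invariants (q : ℕ) (i : Fin 14) : Bool × ℂ × ℂ :=
  ((sectorIndex i).1, (sectorIndex i).2.zval q ((sectorIndex i).1 = false), (sectorIndex i).2.tval)

/-- The decomposition of a monomial representation into the non-zero sectors. -/
theorem IsMonomial.isIrreducibleDecomposition {G V' : Type*} [Group G] [AddCommGroup V']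
    [Module ℂ V'] {ρ : Representation ℂ G (Coord q)} (hρ : IsMonomial ρ)
    {ρ' : Representation ℂ G V'} (Φ : Coord q ≃ₗ[ℂ] V') (hΦ : ∀ g v, ρ' g (Φ v) = Φ (ρ g v))
    {m : ℕ} (e : Fin m → Fin 14) (he : Function.Injective e)
    {W' : Fin m → Submodule ℂ V'} {cls : Fin m → IrrepClass}
    (hW' : ∀ i, W' i = (sectorAt q (e i)).map Φ.toLinearMap)
    (hne : ∀ i, sectorAt q (e i) ≠ ⊥) (hbot : ∀ j, (∀ i, e i ≠ j) → sectorAt q j = ⊥)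
    (hcls : ∀ i j, cls i = cls j ↔ baseIndex (e i) = baseIndex (e j))
    (hbase : ∀ i, ∃ l, e l = baseIndex (e i))
    (hinv : ∀ i j, invariants q (e i) = invariants q (e j) → baseIndex (e i) = baseIndex (e j)) :
    IsIrreducibleDecomposition ρ' W' cls := by
  have hirr : ∀ i, IsIrreducibleSubspace ρ (sectorAt q (e i)) := fun i =>
    hρ.isIrreducibleSubspace (hne i)
  refine isIrreducibleDecomposition_of_linearEquiv Φ hΦ hW' ((iSupIndep_sectorAt q).comp he) ?_
    hirr (fun i j hij => ?_) (fun i j φ hφ => ?_)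
  · refine eq_top_iff.2 ?_
    rw [← iSup_sectorAt q]
    refine iSup_le fun j => ?_
    by_cases h : ∃ i, e i = j
    · obtain ⟨i, rfl⟩ := h
      exact le_iSup (fun i => sectorAt q (e i)) i
    · rw [hbot j fun i hi => h ⟨i, hi⟩]
      exact bot_le
  · obtain ⟨l, hl⟩ := hbase i
    refine ⟨sectorAt q (e l), hirr l, fun r hr => ?_⟩
    have hr' : e l = baseIndex (e r) := by
      rcases hr with rfl | rfl
      · exact hl
      · rw [hl, (hcls _ _).1 hij]
    have := exists_intertwiner hρ (hne r) (hr' ▸ hne l)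
    rwa [← hr'] at this
  · rw [hcls]
    apply hinv
    obtain ⟨h1, h2, h3⟩ := hρ.eq_of_isEquivariant (hne i) φ hφ
    simp only [invariants, Prod.mk.injEq]
    refine ⟨h1, ?_, h3⟩
    rw [h2]
    congr 1
    rw [h1]

end monomial

/-! ### Which sectors vanish, and how their invariants separate the classes -/

section sectors
variable {q : ℕ}

theorem sp_single (i j : Fin q) (a b : ZMod 2 × ZMod 2) :
    sp (Pi.single i a) (Pi.single j b : Lab q) =
      if i = j then a.1 * b.2 + a.2 * b.1 else 0 := by
  rw [sp, Finset.sum_eq_single i (fun l _ hl => by simp [hl]) (by simp)]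
  split_ifs with h
  · subst h; simp
  · simp [h]

/-- The label of `X` on the `i`-th qubit. -/
def labX (i : Fin q) : Lab q := Pi.single i (1, 0)

/-- The label of `Z` on the `i`-th qubit. -/
def labZ (i : Fin q) : Lab q := Pi.single i (0, 1)

@[simp] theorem sp_labX_labX (i j : Fin q) : sp (labX i) (labX j) = 0 := by
  simp [labX, sp_single]

@[simp] theorem sp_labZ_labZ (i j : Fin q) : sp (labZ i) (labZ j) = 0 := by
  simp [labZ, sp_single]

@[simp] theorem sp_labX_labZ (i j : Fin q) : sp (labX i) (labZ j) = if i = j then 1 else 0 := by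
  simp [labX, labZ, sp_single]

@[simp] theorem sp_labZ_labX (i j : Fin q) : sp (labZ i) (labX j) = if i = j then 1 else 0 := by
  simp [labX, labZ, sp_single]

theorem ne_of_sp (η : Lab q) {ν ν' : Lab q} (h : sp η ν ≠ sp η ν') : ν ≠ ν' :=
  fun h' => h (by rw [h'])

theorem labX_ne_zero (i : Fin q) : labX i ≠ 0 := ne_of_sp (labZ i) (by simp)

theorem labZ_ne_zero (i : Fin q) : labZ i ≠ 0 := ne_of_sp (labX i) (by simp)

theorem sector_ne_bot {s : Bool} {κ : Kind} {τ : Lab q} (hτ : Adm s τ) (h : κ.space τ ≠ ⊥) :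
    (sector s κ : Submodule ℂ (Coord q)) ≠ ⊥ := by
  obtain ⟨k, hk, hk0⟩ := (Submodule.ne_bot_iff _).1 h
  refine (Submodule.ne_bot_iff _).2 ⟨_, single_mem_sector hτ hk, fun h' => hk0 ?_⟩
  simpa using congrFun h' τ

theorem sector_eq_bot {s : Bool} {κ : Kind} (h : ∀ τ : Lab q, Adm s τ → κ.space τ = ⊥) :
    (sector s κ : Submodule ℂ (Coord q)) = ⊥ := by
  refine (Submodule.eq_bot_iff _).2 fun f hf => funext fun τ => ?_
  by_cases hτ : Adm s τ
  · have := (hf τ).1 hτ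
    rw [h τ hτ] at this
    exact this
  · exact (hf τ).2 hτ

theorem orb_zero_zero {σ : Lab q} (h : σ ≠ 0) : Orb 0 0 σ := ⟨sp_zero_right σ, h, h⟩

/-- One qubit already provides an anticommuting pair of labels, `labX i` and `labZ i`, which serves
every witness here. -/
theorem sectorAt_ne_bot_of_one_le (i : Fin q) :
    sectorAt q 0 ≠ ⊥ ∧ sectorAt q 1 ≠ ⊥ ∧ sectorAt q 2 ≠ ⊥ ∧ sectorAt q 3 ≠ ⊥ ∧
      sectorAt q 4 ≠ ⊥ ∧ sectorAt q 9 ≠ ⊥ ∧ sectorAt q 10 ≠ ⊥ := by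
  have hF : Adm false (0 : Lab q) := adm_false.2 rfl
  have hT : Adm true (labX i) := adm_true.2 (labX_ne_zero i)
  have hX := orb_zero_zero (labX_ne_zero i)
  have hZ := orb_zero_zero (labZ_ne_zero i)
  have h1 : Orb (labX i) 1 (labZ i) := orb_one.2 (by simp)
  exact ⟨sector_ne_bot hF (point0_ne_bot _), sector_ne_bot hT (point0_ne_bot _),
    sector_ne_bot hT (pointT_ne_bot _), sector_ne_bot hF (const_ne_bot hX),
    sector_ne_bot hF (spec_zero_pos_ne_bot hX hZ (ne_of_sp (labX i) (by simp))
      (ne_of_sp (labX i) (by simp))), sector_ne_bot hT (const_ne_bot h1),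
    sector_ne_bot hT (spec_one_ne_bot (Or.inl rfl) h1)⟩

theorem sectorAt_ne_bot_of_two_le (hq : 2 ≤ q) {i j : Fin q} (hij : i ≠ j) :
    sectorAt q 5 ≠ ⊥ ∧ sectorAt q 6 ≠ ⊥ ∧ sectorAt q 7 ≠ ⊥ ∧ sectorAt q 11 ≠ ⊥ ∧
      sectorAt q 12 ≠ ⊥ ∧ sectorAt q 13 ≠ ⊥ := by
  have hF : Adm false (0 : Lab q) := adm_false.2 rfl
  have hT : Adm true (labX i) := adm_true.2 (labX_ne_zero i)
  have hji := hij.symm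
  have hXj : Orb (labX i) 0 (labX j) :=
    ⟨by simp, labX_ne_zero j, ne_of_sp (labZ j) (by simp [hji])⟩
  have hZj : Orb (labX i) 0 (labZ j) := ⟨by simp [hji], labZ_ne_zero j, ne_of_sp (labX j) (by simp)⟩
  have hXZ : labX j ≠ labZ j := ne_of_sp (labX j) (by simp)
  have hXZ' : labX j ≠ labZ j + labX i := ne_of_sp (labX j) (by simp)
  have hZi : Orb (labX i) 1 (labZ i) := orb_one.2 (by simp)
  have hZi' : Orb (labX i) 1 (labZ i + labX j) := orb_one.2 (by simp)
  refine ⟨sector_ne_bot hF (spec_zero_neg_ne_bot (orb_zero_zero (labX_ne_zero i))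
      (orb_zero_zero (labZ_ne_zero j)) (orb_zero_zero (labX_ne_zero j)) (by simp)
      (ne_of_sp (labZ j) (by simp [hji])) (ne_of_sp (labZ j) (by simp [hji]))
      hXZ (by simpa using hXZ)), sector_ne_bot hT (const_ne_bot hXj),
    sector_ne_bot hT (spec_zero_pos_ne_bot hXj hZj hXZ hXZ'),
    sector_ne_bot hT (spec_one_ne_bot (Or.inr ⟨rfl, hq⟩) hZi),
    sector_ne_bot hT (alt_ne_bot (labX_ne_zero i) hXj hZj hXZ hXZ'),
    sector_ne_bot hT (alt_ne_bot (labX_ne_zero i) hZi hZi' (ne_of_sp (labZ j) (by simp))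
      (ne_of_sp (labZ j) (by simp [hji])))⟩

/-- With `τ` on one qubit, the witness needs a label commuting with `τ` outside two pairs `{ρ, ρ +
τ}` that distinguishes them; the two remaining qubits supply it. -/
theorem sectorAt_ne_bot_of_three_le {i j k : Fin q} (hij : i ≠ j) (hik : i ≠ k) (hjk : j ≠ k) :
    sectorAt q 8 ≠ ⊥ := by
  have hT : Adm true (labX i) := adm_true.2 (labX_ne_zero i)
  have hji := hij.symm
  have hki := hik.symm
  have hkj := hjk.symm
  have hXj : Orb (labX i) 0 (labX j) :=
    ⟨by simp, labX_ne_zero j, ne_of_sp (labZ j) (by simp [hji])⟩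
  have hXk : Orb (labX i) 0 (labX k) :=
    ⟨by simp, labX_ne_zero k, ne_of_sp (labZ k) (by simp [hki])⟩
  have hZk : Orb (labX i) 0 (labZ k) := ⟨by simp [hki], labZ_ne_zero k, ne_of_sp (labX k) (by simp)⟩
  exact sector_ne_bot hT (spec_zero_neg_ne_bot hXj hZk hXk (by simp)
    (ne_of_sp (labZ k) (by simp [hkj])) (ne_of_sp (labZ k) (by simp [hkj, hki]))
    (ne_of_sp (labX k) (by simp)) (ne_of_sp (labX k) (by simp)))

theorem eq_of_perp_one {ρ σ : Lab 1} (hρ : ρ ≠ 0) (hσ : σ ≠ 0) (h : sp σ ρ = 0) : σ = ρ := by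
  rcases mem_of_perp (τ := 0) (by norm_num) (orb_zero_zero hρ) (orb_zero_zero hσ) h with h | h
  · exact h
  · rwa [add_zero] at h

/-- For one qubit the only non-zero label commuting with `τ ≠ 0` is `τ` itself. Commuting orbits
over `τ ≠ 0` are empty and anticommuting ones have the form `{ρ, ρ + τ}`. -/
theorem sectorAt_one_eq_bot : sectorAt 1 5 = ⊥ ∧ sectorAt 1 6 = ⊥ ∧ sectorAt 1 7 = ⊥ ∧
    sectorAt 1 8 = ⊥ ∧ sectorAt 1 11 = ⊥ ∧ sectorAt 1 12 = ⊥ ∧ sectorAt 1 13 = ⊥ := by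
  have horb : ∀ τ : Lab 1, Adm true τ → ∀ σ, ¬ Orb τ 0 σ := fun τ hτ σ hσ =>
    hσ.2.2 (eq_of_perp_one (adm_true.1 hτ) hσ.2.1 hσ.1)
  refine ⟨sector_eq_bot fun τ hτ => spec_neg_eq_bot fun ρ σ hρ hσ h =>
      Or.inl (eq_of_perp_one hρ.2.1 hσ.2.1 h),
    sector_eq_bot fun τ hτ => space_eq_bot_of_forall_not_supp (horb τ hτ),
    sector_eq_bot fun τ hτ => space_eq_bot_of_forall_not_supp (horb τ hτ),
    sector_eq_bot fun τ hτ => space_eq_bot_of_forall_not_supp (horb τ hτ),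
    sector_eq_bot fun τ hτ => spec_neg_eq_bot fun ρ σ hρ hσ h =>
      Or.inl (eq_of_perp_one hρ.2.1 hσ.2.1 h),
    sector_eq_bot fun τ hτ => space_eq_bot_of_forall_not_supp (horb τ hτ),
    sector_eq_bot fun τ hτ => alt_eq_bot rfl fun ρ σ hρ hσ => ?_⟩
  rcases ZMod2.cases (sp σ ρ) with h | h
  · exact Or.inl (eq_of_perp_one hρ.2.1 hσ.2.1 h)
  · right
    rw [← eq_of_perp_one (ρ := ρ) (σ := σ + τ) hρ.2.1 hσ.add.2.1, Lab.add_add_self]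
    rw [sp_add_left, h, sp_comm, hρ.1, ZMod2.add_self]

theorem sectorAt_two_eq_bot : sectorAt 2 8 = ⊥ :=
  sector_eq_bot fun _ hτ => spec_neg_eq_bot fun _ _ hρ hσ h =>
    mem_of_perp (by norm_num [adm_true.1 hτ]) hρ hσ h

open Classical in
/-- The representative of the equivalence class of a sector in terms of its invariants. -/
def invariantCode (q : ℕ) (v : Bool × ℂ × ℂ) : Fin 14 :=
  if v.1 = false then
    if v.2.1 = 4 ^ q then 0 else if v.2.1 = 4 ^ q / 2 - 2 ^ q / 2 then 4 else 5
  else if v.2.1 = 4 ^ q / 2 then 1 else if v.2.1 = 4 ^ q / 4 then 12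
  else if v.2.1 = 4 ^ q / 4 - 2 ^ q / 2 then if v.2.2 = 1 then 7 else 10
  else if v.2.2 = 1 then 8 else 11

/-- The class is recovered from the numerical invariants. This rests on the scalars `4^q/2 ∓ 2^q/2`
and `4^q` being distinct over `τ = 0`, and on `4^q/2`, `4^q/4` and `4^q/4 ∓ 2^q/2` being distinct
over `τ ≠ 0`; the transvection along `τ` then tells `b = 0` from `b = 1`. -/
theorem invariantCode_invariants (hq : 1 ≤ q) (i : Fin 14) (hi : q = 1 → i ≠ 8 ∧ i ≠ 11) :
    invariantCode q (invariants q i) = baseIndex i := by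
  have hx := two_pow_ne_zero (q := q)
  have h4 : (4 : ℂ) ^ q = 2 ^ q * 2 ^ q := four_pow_eq
  have hpos : 0 < 2 ^ q := by positivity
  have h1 : (2 : ℂ) ^ q + 1 ≠ 0 := by
    have : ((2 ^ q + 1 : ℕ) : ℂ) ≠ 0 := Nat.cast_ne_zero.2 (by omega)
    simpa using this
  have h2 : (2 : ℂ) ^ q + 2 ≠ 0 := by
    have : ((2 ^ q + 2 : ℕ) : ℂ) ≠ 0 := Nat.cast_ne_zero.2 (by omega)
    simpa using this
  have h3 : (2 : ℂ) ^ q - 1 ≠ 0 := by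
    rw [sub_ne_zero]
    have h2q : 2 ^ 1 ≤ 2 ^ q := Nat.pow_le_pow_right (by norm_num) hq
    have : ((2 ^ q : ℕ) : ℂ) ≠ (1 : ℕ) := Nat.cast_injective.ne (by omega)
    simpa using this
  have n1 : (4 : ℂ) ^ q / 2 - 2 ^ q / 2 ≠ 4 ^ q := fun h =>
    mul_ne_zero hx h1 (by rw [h4] at h; linear_combination (-2) * h)
  have n2 : (4 : ℂ) ^ q / 2 + 2 ^ q / 2 ≠ 4 ^ q := fun h =>
    mul_ne_zero hx h3 (by rw [h4] at h; linear_combination (-2) * h)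
  have n3 : (4 : ℂ) ^ q / 2 + 2 ^ q / 2 ≠ 4 ^ q / 2 - 2 ^ q / 2 := fun h =>
    hx (by linear_combination h)
  have m1 : (4 : ℂ) ^ q / 4 ≠ 4 ^ q / 2 := fun h =>
    mul_ne_zero hx hx (by rw [h4] at h; linear_combination (-4) * h)
  have m2 : (4 : ℂ) ^ q / 4 - 2 ^ q / 2 ≠ 4 ^ q / 2 := fun h =>
    mul_ne_zero hx h2 (by rw [h4] at h; linear_combination (-4) * h)
  -- For one qubit these two scalars coincide. The sectors concerned, `8` and `11`, are then zero
  -- and are excluded by hypothesis.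
  have m3 : q ≠ 1 → (4 : ℂ) ^ q / 4 + 2 ^ q / 2 ≠ 4 ^ q / 2 := fun hq1 h => by
    have h2q : 2 ^ 2 ≤ 2 ^ q := Nat.pow_le_pow_right (by norm_num) (by omega)
    have h5 : ((2 ^ q : ℕ) : ℂ) ≠ (2 : ℕ) := Nat.cast_injective.ne (by omega)
    have h6 : (2 : ℂ) ^ q - 2 ≠ 0 := by
      rw [sub_ne_zero]
      simpa using h5
    exact mul_ne_zero hx h6 (by rw [h4] at h; linear_combination (-4) * h)
  have m4 : (4 : ℂ) ^ q / 4 - 2 ^ q / 2 ≠ 4 ^ q / 4 := fun h => hx (by linear_combination (-2) * h)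
  have m5 : (4 : ℂ) ^ q / 4 + 2 ^ q / 2 ≠ 4 ^ q / 4 := fun h => hx (by linear_combination 2 * h)
  have m6 : (4 : ℂ) ^ q / 4 + 2 ^ q / 2 ≠ 4 ^ q / 4 - 2 ^ q / 2 := fun h =>
    hx (by linear_combination h)
  have e1 : ∀ a : ℂ, a - ((1 : ℤ) : ℂ) * 2 ^ q / 2 = a - 2 ^ q / 2 := fun a => by simp
  have e2 : ∀ a : ℂ, a - ((-1 : ℤ) : ℂ) * 2 ^ q / 2 = a + 2 ^ q / 2 := fun a => by
    push_cast; ring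
  have e3 : ∀ a : ℂ, a - ((0 : ℤ) : ℂ) * 2 ^ q / 2 = a := fun a => by simp
  have t1 : (Kind.spec 0 1).tval = 1 := rfl
  have t2 : (Kind.spec 0 (-1)).tval = 1 := rfl
  have t3 : (Kind.spec 1 1).tval ≠ 1 := by norm_num [Kind.tval, parity]
  have t4 : (Kind.spec 1 (-1)).tval ≠ 1 := by norm_num [Kind.tval, parity]
  have z0 : ∀ b e, (Kind.spec b e).zval q (false = false) = 4 ^ q / 2 - e * 2 ^ q / 2 :=
    fun b e => by simp [Kind.zval]
  have z1 : ∀ b e, (Kind.spec b e).zval q (true = false) = 4 ^ q / 4 - e * 2 ^ q / 2 :=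
    fun b e => by simp [Kind.zval]
  have y0 : ∀ κ, (∀ b e, κ ≠ Kind.spec b e) → invariantCode q (false, κ.zval q (false = false),
      κ.tval) = 0 := fun κ hκ => by
    cases κ <;> simp [invariantCode, Kind.zval] at hκ ⊢
  have y1 : ∀ κ, (∀ b e, κ ≠ Kind.spec b e) → invariantCode q (true, κ.zval q (true = false),
      κ.tval) = 1 := fun κ hκ => by
    cases κ <;> simp [invariantCode, Kind.zval] at hκ ⊢
  fin_cases i
  · exact y0 .point0 (by simp)
  · exact y1 .point0 (by simp)
  · exact y1 .pointT (by simp)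
  · exact y0 (.const 0) (by simp)
  · change invariantCode q (false, (Kind.spec 0 1).zval q (false = false), _) = 4
    rw [z0, e1]
    simp only [invariantCode, if_true, if_neg n1]
  · change invariantCode q (false, (Kind.spec 0 (-1)).zval q (false = false), _) = 5
    rw [z0, e2]
    simp only [invariantCode, if_true, if_neg n2, if_neg n3]
  · exact y1 (.const 0) (by simp)
  · change invariantCode q (true, (Kind.spec 0 1).zval q (true = false), (Kind.spec 0 1).tval) = 7
    rw [z1, e1]
    simp [invariantCode, m2, m4, t1]
  · change invariantCode q (true, (Kind.spec 0 (-1)).zval q (true = false),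
      (Kind.spec 0 (-1)).tval) = 8
    rw [z1, e2]
    simp [invariantCode, m3 fun h => (hi h).1 rfl, m5, m6, t2]
  · exact y1 (.const 1) (by simp)
  · change invariantCode q (true, (Kind.spec 1 1).zval q (true = false), (Kind.spec 1 1).tval) = 10
    rw [z1, e1]
    simp [invariantCode, m2, m4, t3]
  · change invariantCode q (true, (Kind.spec 1 (-1)).zval q (true = false),
      (Kind.spec 1 (-1)).tval) = 11
    rw [z1, e2]
    simp [invariantCode, m3 fun h => (hi h).2 rfl, m5, m6, t4]
  · change invariantCode q (true, (Kind.spec 0 0).zval q (true = false), (Kind.spec 0 0).tval) = 12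
    rw [z1, e3]
    simp [invariantCode, m1]
  · change invariantCode q (true, (Kind.spec 1 0).zval q (true = false), (Kind.spec 1 0).tval) = 12
    rw [z1, e3]
    simp [invariantCode, m1]

end sectors

/-! ### Pauli operators -/

/-- The labels of the single-qubit Pauli matrices. -/
def singleLabel : ZMod 2 × ZMod 2 ≃ Fin 4 where
  toFun a := if a.1 = 0 then (if a.2 = 0 then 0 else 3) else (if a.2 = 0 then 1 else 2)
  invFun := ![(0, 0), (1, 0), (1, 1), (0, 1)]
  left_inv := by decide
  right_inv := by decide

/-- The single-qubit Pauli matrices. -/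
def pauliOne (a : ZMod 2 × ZMod 2) : Matrix (Fin 2) (Fin 2) ℂ :=
  ![1, pauliX, pauliY, pauliZ] (singleLabel a)

theorem pauliOne_zero_zero : pauliOne (0, 0) = 1 := rfl

theorem pauliOne_one_zero : pauliOne (1, 0) = !![0, 1; 1, 0] := rfl

theorem pauliOne_zero_one : pauliOne (0, 1) = !![1, 0; 0, -1] := rfl

theorem pauliY_eq : pauliY = !![0, Complex.I; -Complex.I, 0] := by
  simp [pauliY, pauliX, pauliZ]

theorem pauliOne_one_one : pauliOne (1, 1) = !![0, Complex.I; -Complex.I, 0] := pauliY_eq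

theorem pauliOne_mul_self (a : ZMod 2 × ZMod 2) : pauliOne a * pauliOne a = 1 := by
  obtain ⟨x, z⟩ := a
  rcases ZMod2.cases x with rfl | rfl <;> rcases ZMod2.cases z with rfl | rfl <;>
    simp only [pauliOne_zero_zero, pauliOne_one_zero, pauliOne_zero_one, pauliOne_one_one,
      Matrix.mul_fin_two, Matrix.one_fin_two] <;> simp

theorem star_pauliOne (a : ZMod 2 × ZMod 2) : star (pauliOne a) = pauliOne a := by
  obtain ⟨x, z⟩ := a
  rcases ZMod2.cases x with rfl | rfl <;> rcases ZMod2.cases z with rfl | rfl <;>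
    simp only [pauliOne_zero_zero, pauliOne_one_zero, pauliOne_zero_one, pauliOne_one_one] <;>
    ext i j <;> fin_cases i <;> fin_cases j <;> simp [Matrix.star_apply]

/-- The sign `(-1) ^ u`. -/
def signOf (u : ZMod 2) : ℂ := if u = 0 then 1 else -1

theorem exists_pauliOne_mul (a b : ZMod 2 × ZMod 2) : ∃ c : ℂ,
    c * c = signOf (a.1 * b.2 + a.2 * b.1) ∧ pauliOne a * pauliOne b = c • pauliOne (a + b) := by
  have h2 : (1 : ZMod 2) + 1 = 0 := rfl
  obtain ⟨x, z⟩ := a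
  obtain ⟨x', z'⟩ := b
  -- Restricting the phase to these three values makes each of the sixteen products a finite check.
  have key : ∃ c ∈ ({1, Complex.I, -Complex.I} : Set ℂ),
      c * c = signOf (x * z' + z * x') ∧
        pauliOne (x, z) * pauliOne (x', z') = c • pauliOne (x + x', z + z') := by
    simp only [Set.mem_insert_iff, Set.mem_singleton_iff, exists_eq_or_imp, exists_eq_left]
    rcases ZMod2.cases x with rfl | rfl <;> rcases ZMod2.cases z with rfl | rfl <;>
      rcases ZMod2.cases x' with rfl | rfl <;> rcases ZMod2.cases z' with rfl | rfl <;>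
      simp only [add_zero, zero_add, h2, mul_zero, mul_one, signOf, pauliOne_zero_zero,
        pauliOne_one_zero, pauliOne_zero_one, pauliOne_one_one, Matrix.mul_fin_two,
        Matrix.one_fin_two, Matrix.smul_of, Matrix.smul_cons, Matrix.smul_empty] <;>
      norm_num
  obtain ⟨c, -, h⟩ := key
  exact ⟨c, h⟩

theorem trace_pauliOne (a : ZMod 2 × ZMod 2) :
    (pauliOne a).trace = if a = 0 then 2 else 0 := by
  obtain ⟨x, z⟩ := a
  rcases ZMod2.cases x with rfl | rfl <;> rcases ZMod2.cases z with rfl | rfl <;>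
    simp [pauliOne_zero_zero, pauliOne_one_zero, pauliOne_zero_one, pauliOne_one_one,
      Matrix.trace_fin_two]

theorem tensorOp_smul {q : ℕ} (c : Fin q → ℂ) (A : Fin q → Matrix (Fin 2) (Fin 2) ℂ) :
    tensorOp (fun j => c j • A j) = (∏ j, c j) • tensorOp A := by
  ext a b
  simp [tensorOp, Finset.prod_mul_distrib]

theorem trace_tensorOp {q : ℕ} (A : Fin q → Matrix (Fin 2) (Fin 2) ℂ) :
    (tensorOp A).trace = ∏ j, (A j).trace := by
  simp only [Matrix.trace, Matrix.diag, tensorOp, Matrix.of_apply]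
  rw [Finset.prod_univ_sum, Fintype.piFinset_univ]

theorem signOf_sum {ι : Type*} (s : Finset ι) (u : ι → ZMod 2) :
    signOf (∑ i ∈ s, u i) = ∏ i ∈ s, signOf (u i) := by
  classical
  induction s using Finset.induction_on with
  | empty => rfl
  | insert a s ha ih =>
    rw [Finset.sum_insert ha, Finset.prod_insert ha, ← ih]
    rcases ZMod2.cases (u a) with h | h <;> rcases ZMod2.cases (∑ i ∈ s, u i) with h' | h' <;>
      simp [signOf, h, h', ZMod2.add_self]

section pauli
variable {q : ℕ}

/-- The Pauli operator with a given label. -/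
def pauli (σ : Lab q) : Op q := tensorOp fun j => pauliOne (σ j)

/-- The factor in the product of two Pauli operators. -/
def phase (σ τ : Lab q) : ℂ := ∏ j, (exists_pauliOne_mul (σ j) (τ j)).choose

theorem phase_mul_self (σ τ : Lab q) : phase σ τ * phase σ τ = chi σ τ := by
  rw [phase, ← Finset.prod_mul_distrib]
  simp only [(exists_pauliOne_mul _ _).choose_spec.1]
  rw [← signOf_sum]
  rfl

theorem phase_ne_zero (σ τ : Lab q) : phase σ τ ≠ 0 := fun h => by
  have := phase_mul_self σ τ
  rw [h, chi] at this
  split_ifs at this <;> simp at this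

theorem pauli_mul (σ τ : Lab q) : pauli σ * pauli τ = phase σ τ • pauli (σ + τ) := by
  rw [pauli, pauli, ← tensorOp_mul, phase, pauli, ← tensorOp_smul]
  congr 1
  funext j
  exact (exists_pauliOne_mul (σ j) (τ j)).choose_spec.2

theorem pauli_zero : pauli (0 : Lab q) = 1 := tensorOp_one

theorem pauli_mul_self (σ : Lab q) : pauli σ * pauli σ = 1 := by
  rw [pauli, ← tensorOp_mul]
  simp only [pauliOne_mul_self]
  exact tensorOp_one

theorem star_pauli (σ : Lab q) : star (pauli σ) = pauli σ := by
  rw [pauli, tensorOp_star]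
  simp only [star_pauliOne]

theorem pauli_ne_zero (σ : Lab q) : pauli σ ≠ 0 := fun h => by
  have := pauli_mul_self σ
  rw [h, mul_zero] at this
  exact zero_ne_one this

/-- The square of `P_σ P_τ` is `chi σ τ`, while its inverse is `P_τ P_σ`; comparing the two gives
the commutation sign. -/
theorem pauli_comm (σ τ : Lab q) : pauli σ * pauli τ = chi σ τ • (pauli τ * pauli σ) := by
  have h1 : pauli σ * pauli τ * (pauli σ * pauli τ) = chi σ τ • 1 := by
    rw [pauli_mul, smul_mul_smul_comm, phase_mul_self, pauli_mul_self]
  have h2 : pauli σ * pauli τ * (pauli τ * pauli σ) = 1 := by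
    rw [mul_assoc, ← mul_assoc (pauli τ), pauli_mul_self, one_mul, pauli_mul_self]
  calc pauli σ * pauli τ = pauli σ * pauli τ * (pauli σ * pauli τ * (pauli τ * pauli σ)) := by
        rw [h2, mul_one]
    _ = _ := by rw [← mul_assoc, h1, smul_mul_assoc, one_mul]

theorem trace_pauli (σ : Lab q) : (pauli σ).trace = if σ = 0 then 2 ^ q else 0 := by
  rw [pauli, trace_tensorOp]
  simp only [trace_pauliOne]
  split_ifs with h
  · subst h
    simp
  · obtain ⟨j, hj⟩ := Function.ne_iff.1 h
    exact Finset.prod_eq_zero (Finset.mem_univ j) (if_neg hj)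

theorem trace_pauli_mul (σ τ : Lab q) :
    (pauli σ * pauli τ).trace = if σ = τ then 2 ^ q else 0 := by
  by_cases h : σ = τ
  · subst h
    rw [pauli_mul_self, ← pauli_zero, trace_pauli]
    simp
  · rw [pauli_mul, Matrix.trace_smul, trace_pauli, if_neg, if_neg h, smul_zero]
    rwa [Lab.add_eq_iff, zero_add]

theorem eq_of_smul_pauli_eq {c c' : ℂ} {σ σ' : Lab q} (hc : c ≠ 0)
    (h : c • pauli σ = c' • pauli σ') : σ = σ' := by
  by_contra hne
  have := congrArg (fun A => (pauli σ * A).trace) h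
  simp only [mul_smul_comm, Matrix.trace_smul, trace_pauli_mul, if_neg hne, if_true, smul_zero] at this
  exact smul_ne_zero hc two_pow_ne_zero this

/-! ### The Pauli group -/

theorem pauliOne_mem_unitaryGroup (a : ZMod 2 × ZMod 2) :
    pauliOne a ∈ Matrix.unitaryGroup (Fin 2) ℂ := by
  rw [Matrix.mem_unitaryGroup_iff, star_pauliOne, pauliOne_mul_self]

theorem pauliOne_mem_pauliGroupOne (a : ZMod 2 × ZMod 2) :
    (⟨pauliOne a, pauliOne_mem_unitaryGroup a⟩ : Matrix.unitaryGroup (Fin 2) ℂ) ∈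
      pauliGroupOne := by
  have hX : (⟨pauliX, pauliX_mem⟩ : Matrix.unitaryGroup (Fin 2) ℂ) ∈ pauliGroupOne :=
    Subgroup.subset_closure (by simp)
  have hZ : (⟨pauliZ, pauliZ_mem⟩ : Matrix.unitaryGroup (Fin 2) ℂ) ∈ pauliGroupOne :=
    Subgroup.subset_closure (by simp)
  have hI : (⟨Complex.I • 1, iOne_mem⟩ : Matrix.unitaryGroup (Fin 2) ℂ) ∈ pauliGroupOne :=
    Subgroup.subset_closure (by simp)
  obtain ⟨x, z⟩ := a
  rcases ZMod2.cases x with rfl | rfl <;> rcases ZMod2.cases z with rfl | rfl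
  · exact one_mem _
  · exact hZ
  · exact hX
  · convert mul_mem hI (mul_mem hZ hX) using 1
    apply Subtype.ext
    change pauliY = Complex.I • 1 * (pauliZ * pauliX)
    rw [smul_mul_assoc, one_mul, pauliY]

theorem exists_of_mem_pauliGroupOne {A : Matrix.unitaryGroup (Fin 2) ℂ} (hA : A ∈ pauliGroupOne) :
    ∃ (c : ℂ) (a : ZMod 2 × ZMod 2), (A : Matrix (Fin 2) (Fin 2) ℂ) = c • pauliOne a := by
  induction hA using Subgroup.closure_induction with
  | mem A hA =>
    rcases hA with rfl | rfl | rfl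
    · exact ⟨1, (1, 0), by rw [one_smul]; rfl⟩
    · exact ⟨1, (0, 1), by rw [one_smul]; rfl⟩
    · exact ⟨Complex.I, (0, 0), rfl⟩
  | one => exact ⟨1, (0, 0), by rw [one_smul]; rfl⟩
  | mul A B _ _ hA hB =>
    obtain ⟨c, a, hA⟩ := hA
    obtain ⟨c', b, hB⟩ := hB
    obtain ⟨e, -, he⟩ := exists_pauliOne_mul a b
    refine ⟨c * c' * e, a + b, ?_⟩
    rw [Submonoid.coe_mul, hA, hB, smul_mul_smul_comm, he, smul_smul]
  | inv A _ hA =>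
    obtain ⟨c, a, hA⟩ := hA
    refine ⟨star c, a, ?_⟩
    have : ((A⁻¹ : Matrix.unitaryGroup (Fin 2) ℂ) : Matrix (Fin 2) (Fin 2) ℂ) =
      star (A : Matrix (Fin 2) (Fin 2) ℂ) := rfl
    rw [this, hA, star_smul, star_pauliOne]

/-- The Pauli operators as unitaries. -/
def pauliU (σ : Lab q) : U q :=
  tensorU q fun j => ⟨pauliOne (σ j), pauliOne_mem_unitaryGroup (σ j)⟩

theorem coe_pauliU (σ : Lab q) : (pauliU σ : Op q) = pauli σ := rfl

theorem pauliU_mem (σ : Lab q) : pauliU σ ∈ pauliGroup q :=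
  ⟨_, fun j _ => pauliOne_mem_pauliGroupOne (σ j), rfl⟩

theorem exists_of_mem_pauliGroup {A : U q} (hA : A ∈ pauliGroup q) :
    ∃ (c : ℂ) (σ : Lab q), (A : Op q) = c • pauli σ := by
  obtain ⟨B, hB, rfl⟩ := hA
  choose c σ h using fun j => exists_of_mem_pauliGroupOne (hB j (Set.mem_univ j))
  refine ⟨∏ j, c j, σ, ?_⟩
  rw [pauli, ← tensorOp_smul]
  change tensorOp (fun j => (B j : Matrix (Fin 2) (Fin 2) ℂ)) = _
  simp only [h]

/-- The factor `i` is put on a single qubit, which is why at least one qubit is needed. -/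
theorem exists_I_mem_pauliGroup (hq : 1 ≤ q) : ∃ J ∈ pauliGroup q, (J : Op q) = Complex.I • 1 := by
  have hI : (⟨Complex.I • 1, iOne_mem⟩ : Matrix.unitaryGroup (Fin 2) ℂ) ∈ pauliGroupOne :=
    Subgroup.subset_closure (by simp)
  let j₀ : Fin q := ⟨0, hq⟩
  refine ⟨_, ⟨Pi.mulSingle j₀ ⟨Complex.I • 1, iOne_mem⟩, fun j _ => ?_, rfl⟩, ?_⟩
  · by_cases h : j = j₀
    · subst h
      rw [Pi.mulSingle_eq_same]
      exact hI
    · rw [Pi.mulSingle_eq_of_ne h]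
      exact pauliGroupOne.one_mem
  · change tensorOp (fun j => (((Pi.mulSingle j₀ ⟨Complex.I • 1, iOne_mem⟩ :
      Fin q → Matrix.unitaryGroup (Fin 2) ℂ) j : Matrix.unitaryGroup (Fin 2) ℂ) :
        Matrix (Fin 2) (Fin 2) ℂ)) = _
    have : ∀ j, (((Pi.mulSingle j₀ ⟨Complex.I • 1, iOne_mem⟩ :
        Fin q → Matrix.unitaryGroup (Fin 2) ℂ) j : Matrix.unitaryGroup (Fin 2) ℂ) :
        Matrix (Fin 2) (Fin 2) ℂ) = (if j = j₀ then Complex.I else 1) • 1 := by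
      intro j
      by_cases h : j = j₀
      · subst h
        simp
      · simp [h]
    simp only [this]
    rw [tensorOp_smul, tensorOp_one]
    simp

/-! ### Conjugation by Clifford unitaries -/

/-- Conjugation by the unitary `V`, up to signs, permutes the Pauli operators by `π`. -/
structure ActsBy (V : U q) (π : Lab q → Lab q) (t : Lab q → ℂ) : Prop where
  conj : ∀ σ, (V : Op q) * pauli σ * star (V : Op q) = t σ • pauli (π σ)
  sq : ∀ σ, t σ * t σ = 1
  sp_map : ∀ σ τ, sp (π σ) (π τ) = sp σ τ

theorem conj_mul (V : U q) (A B : Op q) :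
    (V : Op q) * (A * B) * star (V : Op q) =
      ((V : Op q) * A * star (V : Op q)) * ((V : Op q) * B * star (V : Op q)) := by
  have h : star (V : Op q) * (V : Op q) = 1 := Matrix.mem_unitaryGroup_iff'.1 V.2
  calc (V : Op q) * (A * B) * star (V : Op q)
      = (V : Op q) * A * 1 * (B * star (V : Op q)) := by simp only [mul_assoc, one_mul]
    _ = _ := by rw [← h]; simp only [mul_assoc]

/-- Conjugation preserves `P_σ² = 1`, products up to a scalar, and commutation signs. These give in
turn that the factors are signs, that the permutation is additive, and that it is symplectic;
injectivity follows from nondegeneracy. -/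
theorem exists_actsBy {V : U q} (hV : V ∈ cliffordUnitaries q) :
    ∃ (π : Lab q ≃+ Lab q) (t : Lab q → ℂ), ActsBy V π t := by
  have hex : ∀ σ, ∃ (c : ℂ) (σ' : Lab q),
      (V : Op q) * pauli σ * star (V : Op q) = c • pauli σ' := fun σ =>
    exists_of_mem_pauliGroup ((Subgroup.mem_normalizer_iff.1 hV (pauliU σ)).1 (pauliU_mem σ))
  choose t π h using hex
  have hVV : (V : Op q) * star (V : Op q) = 1 := Matrix.mem_unitaryGroup_iff.1 V.2
  have hsq : ∀ σ, t σ * t σ = 1 := by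
    intro σ
    have h1 := conj_mul V (pauli σ) (pauli σ)
    rw [pauli_mul_self, mul_one, hVV, h, smul_mul_smul_comm, pauli_mul_self] at h1
    have := congrFun (congrFun h1 0) 0
    simpa using this.symm
  have ht : ∀ σ, t σ ≠ 0 := fun σ h0 => by simpa [h0] using hsq σ
  have hadd : ∀ σ τ, π (σ + τ) = π σ + π τ := by
    intro σ τ
    have h1 := conj_mul V (pauli σ) (pauli τ)
    rw [pauli_mul, mul_smul_comm, smul_mul_assoc, h, h, h, smul_mul_smul_comm, pauli_mul, smul_smul,
      smul_smul] at h1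
    exact eq_of_smul_pauli_eq (mul_ne_zero (phase_ne_zero σ τ) (ht _)) h1
  have hsp : ∀ σ τ, sp (π σ) (π τ) = sp σ τ := by
    intro σ τ
    rw [← chi_eq_chi]
    have h1 := conj_mul V (pauli σ) (pauli τ)
    have h2 := conj_mul V (pauli τ) (pauli σ)
    rw [h, h, smul_mul_smul_comm] at h1 h2
    rw [pauli_comm, mul_smul_comm, smul_mul_assoc, h2, pauli_comm (π σ), pauli_mul, smul_smul,
      smul_smul, smul_smul, smul_smul] at h1
    have h3 := smul_left_injective ℂ (pauli_ne_zero _) h1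
    have h4 : t τ * t σ * phase (π τ) (π σ) ≠ 0 :=
      mul_ne_zero (mul_ne_zero (ht τ) (ht σ)) (phase_ne_zero _ _)
    refine mul_right_cancel₀ h4 ?_
    linear_combination -h3
  have hinj : Function.Injective π := fun σ σ' hσ => eq_of_sp fun η => by
    rw [← hsp, hσ, hsp]
  exact ⟨AddEquiv.ofBijective (AddMonoidHom.mk' π hadd) (Finite.injective_iff_bijective.1 hinj),
    t, h, hsq, hsp⟩

theorem actsBy_pauliU (μ : Lab q) :
    pauliU μ ∈ cliffordUnitaries q ∧ ActsBy (pauliU μ) id (chi μ) := by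
  refine ⟨Subgroup.le_normalizer (pauliU_mem μ), fun σ => ?_, chi_mul_self μ, fun _ _ => rfl⟩
  rw [coe_pauliU, star_pauli, pauli_comm, smul_mul_assoc, mul_assoc, pauli_mul_self, mul_one]
  rfl

/-- The unitary `(1 + i P) / √2`. -/
def quarterTurn (P : Lab q) : Op q :=
  ((Real.sqrt 2 : ℝ) : ℂ)⁻¹ • (1 + Complex.I • pauli P)

theorem sqrt_two_inv_mul_self :
    ((Real.sqrt 2 : ℝ) : ℂ)⁻¹ * ((Real.sqrt 2 : ℝ) : ℂ)⁻¹ = 2⁻¹ := by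
  rw [← mul_inv, ← Complex.ofReal_mul, Real.mul_self_sqrt (by norm_num)]
  norm_num

theorem star_quarterTurn (P : Lab q) : star (quarterTurn P) =
    ((Real.sqrt 2 : ℝ) : ℂ)⁻¹ • (1 - Complex.I • pauli P) := by
  rw [quarterTurn, star_smul, star_add, star_smul, star_pauli, star_one]
  simp [sub_eq_add_neg]

theorem one_add_mul_one_sub (P : Lab q) :
    (1 + Complex.I • pauli P) * (1 - Complex.I • pauli P) = (2 : ℂ) • 1 := by
  rw [mul_sub, add_mul, add_mul, smul_mul_smul_comm, pauli_mul_self, Complex.I_mul_I]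
  simp only [mul_one, one_mul]
  module

theorem quarterTurn_mem (P : Lab q) : quarterTurn P ∈ Matrix.unitaryGroup (Ind q) ℂ := by
  rw [Matrix.mem_unitaryGroup_iff, star_quarterTurn, quarterTurn, smul_mul_smul_comm,
    one_add_mul_one_sub, sqrt_two_inv_mul_self, smul_smul, inv_mul_cancel₀ two_ne_zero, one_smul]

/-- `(1 + i P) / √2` as an element of the unitary group. -/
def quarterTurnU (P : Lab q) : U q := ⟨quarterTurn P, quarterTurn_mem P⟩

theorem quarterTurn_conj_of_commute {P : Lab q} {A : Op q} (h : pauli P * A = A * pauli P) :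
    quarterTurn P * A * star (quarterTurn P) = A := by
  have h1 : quarterTurn P * A = A * quarterTurn P := by
    rw [quarterTurn, smul_mul_assoc, mul_smul_comm, add_mul, mul_add, smul_mul_assoc,
      mul_smul_comm, h, one_mul, mul_one]
  rw [h1, mul_assoc, Matrix.mem_unitaryGroup_iff.1 (quarterTurn_mem P), mul_one]

theorem quarterTurn_conj_of_anticommute {P : Lab q} {A : Op q} (h : pauli P * A = -(A * pauli P)) :
    quarterTurn P * A * star (quarterTurn P) = Complex.I • (pauli P * A) := by
  have h1 : A * (1 - Complex.I • pauli P) = (1 + Complex.I • pauli P) * A := by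
    rw [mul_sub, add_mul, mul_smul_comm, smul_mul_assoc, h, mul_one, one_mul, smul_neg,
      sub_eq_add_neg]
  have h2 : (1 + Complex.I • pauli P) * (1 + Complex.I • pauli P) =
      (2 * Complex.I) • pauli P := by
    rw [mul_add, add_mul, add_mul, smul_mul_smul_comm, pauli_mul_self, Complex.I_mul_I]
    simp only [mul_one, one_mul]
    module
  rw [star_quarterTurn, quarterTurn, smul_mul_assoc, smul_mul_smul_comm, mul_assoc, h1, ← mul_assoc,
    h2, sqrt_two_inv_mul_self, smul_mul_assoc, smul_smul, inv_mul_cancel_left₀ two_ne_zero]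

/-- Conjugation by the quarter turn fixes what commutes with `P` and sends an anticommuting `A` to
`iPA`, again in the Pauli group since `i` is. -/
theorem quarterTurnU_conj_mem (hq : 1 ≤ q) (P : Lab q) {A : U q} (hA : A ∈ pauliGroup q) :
    quarterTurnU P * A * (quarterTurnU P)⁻¹ ∈ pauliGroup q := by
  obtain ⟨c, σ, h⟩ := exists_of_mem_pauliGroup hA
  obtain ⟨J, hJ, hJI⟩ := exists_I_mem_pauliGroup hq
  have hcomm : pauli P * (A : Op q) = chi P σ • ((A : Op q) * pauli P) := by
    rw [h, mul_smul_comm, smul_mul_assoc, pauli_comm, smul_comm]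
  rcases ZMod2.cases (sp P σ) with h' | h'
  · convert hA using 1
    apply Subtype.ext
    exact quarterTurn_conj_of_commute (by rw [hcomm, chi_eq_one h', one_smul])
  · convert mul_mem (mul_mem hJ (pauliU_mem P)) hA using 1
    apply Subtype.ext
    refine (quarterTurn_conj_of_anticommute
      (by rw [hcomm, chi_eq_neg_one h', neg_one_smul])).trans ?_
    change _ = (J : Op q) * pauli P * (A : Op q)
    rw [hJI, smul_mul_assoc, one_mul, smul_mul_assoc]

theorem quarterTurnU_sq (P : Lab q) :
    ((quarterTurnU P * quarterTurnU P : U q) : Op q) = Complex.I • pauli P := by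
  change quarterTurn P * quarterTurn P = _
  rw [quarterTurn, smul_mul_smul_comm, sqrt_two_inv_mul_self, mul_add, add_mul, add_mul,
    smul_mul_smul_comm, pauli_mul_self, Complex.I_mul_I]
  simp only [mul_one, one_mul]
  module

/-- The square of the quarter turn is `iP`, a Pauli element. Conjugating twice and undoing the
square inside the Pauli group gives the reverse inclusion that the normalizer requires. -/
theorem quarterTurnU_mem (hq : 1 ≤ q) (P : Lab q) : quarterTurnU P ∈ cliffordUnitaries q := by
  refine Subgroup.mem_normalizer_iff.2 fun A => ⟨quarterTurnU_conj_mem hq P, fun hA => ?_⟩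
  obtain ⟨J, hJ, hJI⟩ := exists_I_mem_pauliGroup hq
  have hT : quarterTurnU P * quarterTurnU P ∈ pauliGroup q := by
    convert mul_mem hJ (pauliU_mem P) using 1
    apply Subtype.ext
    rw [quarterTurnU_sq]
    change _ = (J : Op q) * pauli P
    rw [hJI, smul_mul_assoc, one_mul]
  have h1 := quarterTurnU_conj_mem hq P hA
  have h2 := mul_mem (mul_mem (inv_mem hT) h1) hT
  convert h2 using 1
  group

theorem actsBy_quarterTurnU (P : Lab q) : ActsBy (quarterTurnU P) (transv P)
    (fun σ => if sp P σ = 0 then 1 else Complex.I * phase P σ) where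
  conj σ := by
    change quarterTurn P * pauli σ * star (quarterTurn P) = _
    rcases ZMod2.cases (sp P σ) with h | h
    · rw [quarterTurn_conj_of_commute (by rw [pauli_comm, chi_eq_one h, one_smul]), if_pos h,
        transv_of_eq_zero h, one_smul]
    · rw [quarterTurn_conj_of_anticommute (by rw [pauli_comm, chi_eq_neg_one h, neg_one_smul]),
        if_neg (by rw [h]; exact one_ne_zero), transv_of_eq_one h, pauli_mul, smul_smul, add_comm]
  sq σ := by
    rcases ZMod2.cases (sp P σ) with h | h
    · simp [h]
    · rw [if_neg (by rw [h]; exact one_ne_zero)]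
      have := phase_mul_self P σ
      rw [chi_eq_neg_one h] at this
      linear_combination Complex.I * Complex.I * this - Complex.I_mul_I
  sp_map := sp_transv_transv P

end pauli

section basis
variable {q : ℕ}

/-! ### The monomial basis of the two-copy space -/

/-- The identification of the two kinds of labels. -/
def pauliString : Lab q ≃ PauliString q := Equiv.piCongrRight fun _ => singleLabel

theorem pauliString_zero : pauliString (0 : Lab q) = 0 := rfl

theorem nP_pauliString (σ : Lab q) : nP (pauliString σ) = (sqrtDim q)⁻¹ • pauli σ := rfl

theorem sqrtDim_mul_self : sqrtDim q * sqrtDim q = 2 ^ q := by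
  rw [sqrtDim, ← Complex.ofReal_mul, Real.mul_self_sqrt (by positivity)]
  norm_num

theorem sqrtDim_ne_zero : sqrtDim q ≠ 0 := fun h => by
  have := sqrtDim_mul_self (q := q)
  rw [h, mul_zero] at this
  exact two_pow_ne_zero this.symm

theorem nMul_pauliString (σ τ : Lab q) :
    nMul (pauliString σ) (pauliString τ) = ((sqrtDim q)⁻¹ * phase σ τ) • pauli (σ + τ) := by
  rw [nMul, nP_pauliString, nP_pauliString, smul_mul_smul_comm, pauli_mul, smul_smul, smul_smul]
  congr 1
  field_simp [sqrtDim_ne_zero (q := q)]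

/-- The factor that makes the product of two Pauli operators self-adjoint. -/
def twist (σ τ : Lab q) : ℂ := if sp σ τ = 0 then 1 else Complex.I

theorem twist_mul_self (σ τ : Lab q) : twist σ τ * twist σ τ = chi σ τ := by
  rw [twist, chi]
  split_ifs <;> simp

/-- The sign in the self-adjoint product of two Pauli operators. -/
def hermSign (σ τ : Lab q) : ℂ := twist σ τ * phase σ τ

theorem hermSign_mul_self (σ τ : Lab q) : hermSign σ τ * hermSign σ τ = 1 := by
  rw [hermSign, mul_mul_mul_comm, twist_mul_self, phase_mul_self, chi_mul_self]

theorem star_hermSign (σ τ : Lab q) : star (hermSign σ τ) = hermSign σ τ := by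
  rcases mul_self_eq_one_iff.1 (hermSign_mul_self σ τ) with h | h <;> simp [h]

theorem phase_mul_phase_add (σ τ : Lab q) : phase σ τ * phase (σ + τ) τ = 1 := by
  have h : pauli σ = (phase σ τ * phase (σ + τ) τ) • pauli σ := by
    conv_lhs => rw [← mul_one (pauli σ), ← pauli_mul_self τ, ← mul_assoc, pauli_mul,
      smul_mul_assoc, pauli_mul, smul_smul, Lab.add_add_self]
  have h' : (phase σ τ * phase (σ + τ) τ - 1) • pauli σ = 0 := by
    rw [sub_smul, one_smul, ← h, sub_self]
  exact sub_eq_zero.1 ((smul_eq_zero.1 h').resolve_right (pauli_ne_zero σ))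

/-- From `P_σ P_τ P_τ = P_σ` the two phases are inverse to each other, and the two equal twists
contribute `chi σ τ`. -/
theorem hermSign_add (σ τ : Lab q) : hermSign (σ + τ) τ = chi σ τ * hermSign σ τ := by
  have h1 : twist (σ + τ) τ = twist σ τ := by simp [twist]
  have h2 : hermSign σ τ * hermSign (σ + τ) τ = chi σ τ := by
    rw [hermSign, hermSign, h1, mul_mul_mul_comm, twist_mul_self, phase_mul_phase_add, mul_one]
  rw [← h2, mul_right_comm, hermSign_mul_self, one_mul]

/-- The basis vector `σ ⊗ (σ · τ)`, up to a factor `i` if `σ` and `τ` anti-commute. -/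
def twin (τ σ : Lab q) : Op2 q :=
  nP (pauliString σ) ⊗ₜ[ℂ] (twist σ τ • nMul (pauliString σ) (pauliString τ))

theorem twin_eq (τ σ : Lab q) :
    twin τ σ = (((2 : ℂ) ^ q)⁻¹ * hermSign σ τ) • (pauli σ ⊗ₜ[ℂ] pauli (σ + τ)) := by
  rw [twin, nMul_pauliString, nP_pauliString, smul_smul, TensorProduct.smul_tmul_smul,
    ← sqrtDim_mul_self, hermSign]
  congr 1
  rw [mul_inv]
  ring

theorem hsInner_twin (τ σ τ' σ' : Lab q) :
    hsInner (twin τ σ) (twin τ' σ') = if τ = τ' ∧ σ = σ' then 1 else 0 := by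
  have h : ∀ ρ : Lab q, (pauli ρ).conjTranspose = pauli ρ := star_pauli
  rw [twin_eq, twin_eq, TensorProduct.smul_tmul', TensorProduct.smul_tmul', hsInner_tmul,
    Matrix.conjTranspose_smul, h, h, smul_mul_smul_comm, Matrix.trace_smul, trace_pauli_mul,
    trace_pauli_mul]
  by_cases hσ : σ = σ'
  · subst hσ
    by_cases hτ : τ = τ'
    · subst hτ
      simp only [star_mul', star_hermSign, star_inv₀, star_pow, and_self, if_true, smul_eq_mul]
      have : star (2 : ℂ) = 2 := by simp
      rw [this]
      have := hermSign_mul_self σ τ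
      have h2 := two_pow_ne_zero (q := q)
      field_simp
      linear_combination this
    · simp [hτ]
  · simp [hσ]

theorem hsInner_add_right (u v w : Op2 q) : hsInner u (v + w) = hsInner u v + hsInner u w := by
  simp only [hsInner]
  rw [map_add, mul_add, Matrix.trace_add]

theorem hsInner_smul_right (u v : Op2 q) (c : ℂ) : hsInner u (c • v) = c * hsInner u v := by
  simp only [hsInner]
  rw [map_smul, Matrix.mul_smul, Matrix.trace_smul, smul_eq_mul]

theorem hsInner_add_left (u v w : Op2 q) : hsInner (u + v) w = hsInner u w + hsInner v w := by
  simp only [hsInner]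
  rw [map_add, Matrix.conjTranspose_add, add_mul, Matrix.trace_add]

theorem hsInner_smul_left (u v : Op2 q) (c : ℂ) :
    hsInner (c • u) v = star c * hsInner u v := by
  simp only [hsInner]
  rw [map_smul, Matrix.conjTranspose_smul, Matrix.smul_mul, Matrix.trace_smul, smul_eq_mul]

/-- The inner product with a fixed left argument. -/
def hsInnerRight (u : Op2 q) : Op2 q →ₗ[ℂ] ℂ where
  toFun v := hsInner u v
  map_add' := hsInner_add_right u
  map_smul' c v := hsInner_smul_right u v c

/-- The vector with given coefficients in the basis `twin`. -/
def ofCoordMap (q : ℕ) : Coord q →ₗ[ℂ] Op2 q where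
  toFun f := ∑ τ, ∑ σ, f τ σ • twin τ σ
  map_add' f f' := by simp [add_smul, Finset.sum_add_distrib]
  map_smul' c f := by simp [Finset.smul_sum, smul_smul]

theorem ofCoordMap_apply (f : Coord q) : ofCoordMap q f = ∑ τ, ∑ σ, f τ σ • twin τ σ := rfl

theorem hsInner_twin_ofCoordMap (f : Coord q) (τ σ : Lab q) :
    hsInner (twin τ σ) (ofCoordMap q f) = f τ σ := by
  change hsInnerRight (twin τ σ) _ = _
  rw [ofCoordMap_apply]
  simp only [map_sum, map_smul]
  change ∑ τ', ∑ σ', f τ' σ' * hsInner _ _ = _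
  simp only [hsInner_twin, mul_ite, mul_one, mul_zero, ite_and]
  simp

theorem ofCoordMap_injective : Function.Injective (ofCoordMap q) := fun f f' h => by
  funext τ σ
  rw [← hsInner_twin_ofCoordMap f, h, hsInner_twin_ofCoordMap]

theorem finrank_coord_eq : Module.finrank ℂ (Coord q) = Module.finrank ℂ (Op2 q) := by
  rw [Module.finrank_tensorProduct, Module.finrank_matrix, Module.finrank_pi_fintype]
  simp only [Module.finrank_pi, Finset.sum_const, Finset.card_univ, smul_eq_mul]
  simp [← mul_pow]

/-- The coordinates in the basis `twin`. -/
def ofCoord (q : ℕ) : Coord q ≃ₗ[ℂ] Op2 q :=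
  LinearMap.linearEquivOfInjective (ofCoordMap q) ofCoordMap_injective finrank_coord_eq

theorem ofCoord_apply (f : Coord q) : ofCoord q f = ∑ τ, ∑ σ, f τ σ • twin τ σ := rfl

theorem hsInner_twin_ofCoord (f : Coord q) (τ σ : Lab q) :
    hsInner (twin τ σ) (ofCoord q f) = f τ σ := hsInner_twin_ofCoordMap f τ σ

/-! ### The two-copy representation in coordinates -/

/-- Conjugate the product rule of `P_σ` and `P_τ` by `V` and compare coefficients. The sign of the
tensor product `P_σ ⊗ P_{σ+τ}` reduces to that of `P_τ`, up to the normalisation already built into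
`twin`; this is the reason for using that basis. -/
theorem ActsBy.hermSign_map {V : U q} {π : Lab q ≃+ Lab q} {t : Lab q → ℂ} (h : ActsBy V π t)
    (σ τ : Lab q) : hermSign σ τ * (t σ * t (σ + τ)) = t τ * hermSign (π σ) (π τ) := by
  have h1 := conj_mul V (pauli σ) (pauli τ)
  rw [h.conj, h.conj, pauli_mul, smul_mul_smul_comm, pauli_mul, mul_smul_comm, smul_mul_assoc,
    h.conj, smul_smul, smul_smul, ← map_add] at h1
  have h2 : (phase σ τ * t (σ + τ) - t σ * t τ * phase (π σ) (π τ)) • pauli (π (σ + τ)) = 0 := by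
    rw [sub_smul, h1, sub_self]
  have h3 := sub_eq_zero.1 ((smul_eq_zero.1 h2).resolve_right (pauli_ne_zero _))
  rw [hermSign, hermSign, show twist (π σ) (π τ) = twist σ τ by simp [twist, h.sp_map]]
  linear_combination twist σ τ * t σ * h3 + twist σ τ * t τ * phase (π σ) (π τ) * h.sq σ

theorem twoCopy_twin {V : U q} (hV : V ∈ cliffordUnitaries q) {π : Lab q ≃+ Lab q}
    {t : Lab q → ℂ} (h : ActsBy V π t) (τ σ : Lab q) :
    twoCopy q (QuotientGroup.mk ⟨V, hV⟩) (twin τ σ) = t τ • twin (π τ) (π σ) := by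
  have h1 : ∀ A B : Op q, twoCopy q (QuotientGroup.mk ⟨V, hV⟩) (A ⊗ₜ[ℂ] B) =
      ((V : Op q) * A * star (V : Op q)) ⊗ₜ[ℂ] ((V : Op q) * B * star (V : Op q)) :=
    fun A B => rfl
  rw [twin_eq, map_smul, h1, h.conj, h.conj, twin_eq, TensorProduct.smul_tmul_smul, smul_smul,
    smul_smul, map_add]
  congr 1
  linear_combination ((2 : ℂ) ^ q)⁻¹ * h.hermSign_map σ τ

/-- The two-copy representation in the coordinates given by the basis `twin`. -/
def coordRep (q : ℕ) : Representation ℂ (CliffordGroup q) (Coord q) where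
  toFun g := (ofCoord q).symm.toLinearMap ∘ₗ twoCopy q g ∘ₗ (ofCoord q).toLinearMap
  map_one' := LinearMap.ext fun f => by simp
  map_mul' g g' := LinearMap.ext fun f => by simp

theorem ofCoord_coordRep (g : CliffordGroup q) (f : Coord q) :
    twoCopy q g (ofCoord q f) = ofCoord q (coordRep q g f) := by
  simp [coordRep]

theorem coordRep_apply {V : U q} (hV : V ∈ cliffordUnitaries q) {π : Lab q ≃+ Lab q}
    {t : Lab q → ℂ} (h : ActsBy V π t) (f : Coord q) (τ σ : Lab q) :
    coordRep q (QuotientGroup.mk ⟨V, hV⟩) f (π τ) (π σ) = t τ * f τ σ := by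
  have key : coordRep q (QuotientGroup.mk ⟨V, hV⟩) f =
      fun x y => t (π.symm x) * f (π.symm x) (π.symm y) := by
    apply (ofCoord q).injective
    rw [← ofCoord_coordRep, ofCoord_apply, ofCoord_apply, map_sum]
    symm
    rw [← Equiv.sum_comp π.toEquiv]
    refine Finset.sum_congr rfl fun τ _ => ?_
    rw [map_sum, ← Equiv.sum_comp π.toEquiv]
    refine Finset.sum_congr rfl fun σ _ => ?_
    rw [map_smul, twoCopy_twin hV h, smul_smul]
    simp [mul_comm]
  simp [key]

theorem isMonomial_coordRep (hq : 1 ≤ q) : IsMonomial (coordRep q) where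
  exists_map g := by
    induction g using QuotientGroup.induction_on with
    | H V =>
      obtain ⟨π, t, h⟩ := exists_actsBy V.2
      exact ⟨π, t, h.sp_map, coordRep_apply V.2 h⟩
  exists_pauli μ :=
    ⟨QuotientGroup.mk ⟨_, (actsBy_pauliU μ).1⟩, fun f τ σ =>
      coordRep_apply (π := AddEquiv.refl (Lab q)) (actsBy_pauliU μ).1 (actsBy_pauliU μ).2 f τ σ⟩
  exists_transv P := by
    refine ⟨QuotientGroup.mk ⟨_, quarterTurnU_mem hq P⟩, _, fun τ => ?_, fun τ h => if_pos h,
      fun f τ σ => coordRep_apply (π := transvEquiv P) (quarterTurnU_mem hq P)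
        (actsBy_quarterTurnU P) f τ σ⟩
    have := (actsBy_quarterTurnU P).sq τ
    exact fun h => by simp [h] at this

end basis

section slices
variable {q : ℕ}

/-! ### Sets of labels and sums over them -/

theorem mem_nonId {σ : Lab q} : pauliString σ ∈ nonId q ↔ σ ≠ 0 := by
  rw [nonId, Finset.mem_filter, ← pauliString_zero, Ne, pauliString.injective.eq_iff]
  simp

theorem commutator_eq_zero {σ τ : Lab q} :
    nP (pauliString σ) * nP (pauliString τ) - nP (pauliString τ) * nP (pauliString σ) = 0 ↔
      sp σ τ = 0 := by
  have hd : (sqrtDim q)⁻¹ * (sqrtDim q)⁻¹ ≠ 0 :=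
    mul_ne_zero (inv_ne_zero sqrtDim_ne_zero) (inv_ne_zero sqrtDim_ne_zero)
  rw [nP_pauliString, nP_pauliString, smul_mul_smul_comm, smul_mul_smul_comm, ← smul_sub,
    smul_eq_zero_iff_right hd, pauli_comm σ τ, pauli_mul]
  rcases ZMod2.cases (sp σ τ) with h | h
  · simp [chi_eq_one h, h]
  · rw [chi_eq_neg_one h, neg_one_smul, ← neg_add', ← two_smul ℂ, neg_eq_zero, smul_smul, h]
    simp [phase_ne_zero, pauli_ne_zero]

theorem anticommutator_eq_zero {σ τ : Lab q} :
    nP (pauliString σ) * nP (pauliString τ) + nP (pauliString τ) * nP (pauliString σ) = 0 ↔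
      sp σ τ = 1 := by
  have hd : (sqrtDim q)⁻¹ * (sqrtDim q)⁻¹ ≠ 0 :=
    mul_ne_zero (inv_ne_zero sqrtDim_ne_zero) (inv_ne_zero sqrtDim_ne_zero)
  rw [nP_pauliString, nP_pauliString, smul_mul_smul_comm, smul_mul_smul_comm, ← smul_add,
    smul_eq_zero_iff_right hd, pauli_comm σ τ, pauli_mul]
  rcases ZMod2.cases (sp σ τ) with h | h
  · rw [chi_eq_one h, one_smul, ← two_smul ℂ, smul_smul, h]
    simp [phase_ne_zero, pauli_ne_zero]
  · simp [chi_eq_neg_one h, h]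

theorem mem_antiComm {σ τ : Lab q} : pauliString σ ∈ antiComm (pauliString τ) ↔ Orb τ 1 σ := by
  rw [antiComm, Finset.mem_filter, mem_nonId, anticommutator_eq_zero, orb_one]
  refine ⟨fun h => h.2, fun h => ⟨?_, h⟩⟩
  rintro rfl
  simp at h

theorem mem_commOther {σ τ : Lab q} : pauliString σ ∈ commOther (pauliString τ) ↔ Orb τ 0 σ := by
  rw [commOther, Finset.mem_filter, mem_nonId, commutator_eq_zero,
    pauliString.injective.ne_iff, Orb]
  tauto

theorem mem_commAll {σ τ : Lab q} : pauliString σ ∈ commAll (pauliString τ) ↔ sp σ τ = 0 := by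
  rw [commAll, Finset.mem_filter, commutator_eq_zero]
  simp

theorem sum_pauliString {M : Type*} [AddCommMonoid M] {s : Finset (PauliString q)}
    {p : Lab q → Prop} [DecidablePred p] (h : ∀ σ, pauliString σ ∈ s ↔ p σ) (F : PauliString q → M) :
    ∑ σ ∈ s, F σ = ∑ σ, if p σ then F (pauliString σ) else 0 := by
  classical
  rw [← Finset.sum_filter]
  symm
  refine Finset.sum_bij (fun σ _ => pauliString σ) (fun σ hσ => ?_)
    (fun _ _ _ _ e => pauliString.injective e) (fun σ hσ => ?_) fun _ _ => rfl
  · exact (h σ).2 (Finset.mem_filter.1 hσ).2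
  · obtain ⟨σ, rfl⟩ := pauliString.surjective σ
    exact ⟨σ, Finset.mem_filter.2 ⟨Finset.mem_univ _, (h σ).1 hσ⟩, rfl⟩

/-! ### Vectors with coordinates at one label -/

/-- The vector with coordinates `k` at the label `τ`. -/
def slice (τ : Lab q) (k : Lab q → ℂ) : Op2 q := ∑ σ, k σ • twin τ σ

theorem ofCoord_single (τ : Lab q) (k : Lab q → ℂ) :
    ofCoord q (Pi.single τ k) = slice τ k := by
  rw [ofCoord_apply, Finset.sum_eq_single τ]
  · rw [Pi.single_eq_same]; rfl
  · intro τ' _ h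
    rw [Pi.single_eq_of_ne h]
    simp
  · simp

theorem slice_smul (τ : Lab q) (c : ℂ) (k : Lab q → ℂ) : slice τ (c • k) = c • slice τ k := by
  simp [slice, Finset.smul_sum, smul_smul]

theorem slice_zero (τ : Lab q) : slice τ (0 : Lab q → ℂ) = 0 := by simp [slice]

theorem slice_single (τ σ : Lab q) : slice τ (Pi.single σ 1) = twin τ σ := by
  rw [slice, Finset.sum_eq_single σ]
  · simp
  · intro σ' _ h
    simp [Pi.single_eq_of_ne h]
  · simp

theorem hsInner_slice (τ : Lab q) (k : Lab q → ℂ) (f : Coord q) :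
    hsInner (slice τ k) (ofCoord q f) = ∑ σ, star (k σ) * f τ σ := by
  have h : ∀ s : Finset (Lab q), hsInner (∑ σ ∈ s, k σ • twin τ σ) (ofCoord q f) =
      ∑ σ ∈ s, star (k σ) * f τ σ := by
    classical
    intro s
    induction s using Finset.induction_on with
    | empty => simp [hsInner]
    | insert a s ha ih =>
      rw [Finset.sum_insert ha, Finset.sum_insert ha, hsInner_add_left, ih, hsInner_smul_left,
        hsInner_twin_ofCoord]
  exact h _

/-- The functions `f` with `f τ ∈ K τ`, supported in one of the two sectors. -/
def fibered (s : Bool) (K : Lab q → Submodule ℂ (Lab q → ℂ)) : Submodule ℂ (Coord q) :=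
  Submodule.pi Set.univ fun τ => if Adm s τ then K τ else ⊥

theorem mem_fibered {s : Bool} {K : Lab q → Submodule ℂ (Lab q → ℂ)} {f : Coord q} :
    f ∈ fibered s K ↔ ∀ τ, (Adm s τ → f τ ∈ K τ) ∧ (¬ Adm s τ → f τ = 0) := by
  simp only [fibered, Submodule.mem_pi, Set.mem_univ, true_imp_iff]
  refine forall_congr' fun τ => ?_
  by_cases h : Adm s τ <;> simp [h]

theorem sector_eq_fibered (s : Bool) (κ : Kind) :
    (sector s κ : Submodule ℂ (Coord q)) = fibered s fun τ => κ.space τ := by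
  ext f
  rw [mem_fibered]
  rfl

theorem fibered_congr {s : Bool} {K K' : Lab q → Submodule ℂ (Lab q → ℂ)}
    (h : ∀ τ, Adm s τ → K τ = K' τ) : fibered s K = fibered s K' := by
  ext f
  rw [mem_fibered, mem_fibered]
  exact forall_congr' fun τ => and_congr_left' (forall_congr' fun a => by rw [h τ a])

/-- The vectors whose coordinates at `τ` lie in `K τ`, supported in one of the two sectors. -/
def fiberedOp (s : Bool) (K : Lab q → Submodule ℂ (Lab q → ℂ)) : Submodule ℂ (Op2 q) :=
  (fibered s K).map (ofCoord q).toLinearMap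

theorem slice_mem_fiberedOp {s : Bool} {K : Lab q → Submodule ℂ (Lab q → ℂ)} {τ : Lab q}
    (hτ : Adm s τ) {k : Lab q → ℂ} (hk : k ∈ K τ) : slice τ k ∈ fiberedOp s K := by
  refine ⟨Pi.single τ k, mem_fibered.2 fun τ' => ?_, ofCoord_single τ k⟩
  by_cases h : τ' = τ
  · subst h
    simp [hτ, hk]
  · simp [h]

theorem fiberedOp_le {s : Bool} {K : Lab q → Submodule ℂ (Lab q → ℂ)} {W : Submodule ℂ (Op2 q)}
    (h : ∀ τ, Adm s τ → ∀ k ∈ K τ, slice τ k ∈ W) : fiberedOp s K ≤ W := by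
  rintro _ ⟨f, hf, rfl⟩
  have hf := mem_fibered.1 hf
  rw [LinearEquiv.coe_coe, ← Finset.univ_sum_single f, map_sum]
  refine W.sum_mem fun τ _ => ?_
  rw [ofCoord_single]
  by_cases hτ : Adm s τ
  · exact h τ hτ _ ((hf τ).1 hτ)
  · rw [(hf τ).2 hτ, slice_zero]
    exact W.zero_mem

/-! ### Symmetric and antisymmetric combinations -/

/-- The symmetric (`s = 1`) or antisymmetric (`s = -1`) combination of two tensor factors. -/
def parT (s : ℂ) (A B : Op q) : Op2 q :=
  ((Real.sqrt 2 : ℝ) : ℂ)⁻¹ • (A ⊗ₜ[ℂ] B + s • (B ⊗ₜ[ℂ] A))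

theorem symT_eq (A B : Op q) : symT A B = parT 1 A B := by rw [symT, parT, one_smul]

theorem altT_eq (A B : Op q) : altT A B = parT (-1) A B := by
  have h : (-1 : ℂ) • (B ⊗ₜ[ℂ] A) = -(B ⊗ₜ[ℂ] A) := by module
  rw [altT, parT, h, sub_eq_add_neg]

theorem parT_smul (s c : ℂ) (A B : Op q) : parT s A (c • B) = c • parT s A B := by
  simp only [parT, TensorProduct.tmul_smul, ← TensorProduct.smul_tmul', smul_add]
  rw [smul_comm c, smul_comm c, smul_comm c s]

/-- The symmetric or antisymmetric combination of the factors of a basis vector. -/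
def parTwin (s : ℂ) (τ σ : Lab q) : Op2 q :=
  parT s (nP (pauliString σ)) (twist σ τ • nMul (pauliString σ) (pauliString τ))

/-- The flip of tensor factors preserves `τ` and translates `σ` by `τ`, with the sign from
`hermSign_add`. Symmetry of a tensor thereby becomes parity of its coordinates. -/
theorem twin_swap (τ σ : Lab q) :
    (twist σ τ • nMul (pauliString σ) (pauliString τ)) ⊗ₜ[ℂ] nP (pauliString σ) =
      chi σ τ • twin τ (σ + τ) := by
  rw [twin_eq, hermSign_add, Lab.add_add_self, nMul_pauliString, nP_pauliString, smul_smul,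
    TensorProduct.smul_tmul_smul, smul_smul, ← sqrtDim_mul_self, hermSign]
  congr 1
  rw [mul_inv]
  linear_combination (-(sqrtDim q)⁻¹ * (sqrtDim q)⁻¹ * twist σ τ * phase σ τ) * chi_mul_self σ τ

theorem parTwin_eq (s : ℂ) (τ σ : Lab q) : parTwin s τ σ =
    ((Real.sqrt 2 : ℝ) : ℂ)⁻¹ • (twin τ σ + (s * chi σ τ) • twin τ (σ + τ)) := by
  rw [parTwin, parT, twin_swap, ← twin, smul_smul]

/-- Up to sign, `τ` is the Hermitian product of `σ` with `σ + τ`; so the pair `(σ, τ)` belongs to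
the fibre over `σ + τ`. -/
theorem nP_eq (σ τ : Lab q) : nP (pauliString τ) = hermSign σ (σ + τ) •
    (twist σ (σ + τ) • nMul (pauliString σ) (pauliString (σ + τ))) := by
  have h : σ + (σ + τ) = τ := by rw [← add_assoc, Lab.add_self, zero_add]
  rw [nMul_pauliString, nP_pauliString, smul_smul, smul_smul, h]
  congr 1
  have := hermSign_mul_self σ (σ + τ)
  rw [hermSign] at this ⊢
  linear_combination (-(sqrtDim q)⁻¹) * this

theorem parT_nP (s : ℂ) (σ τ : Lab q) : parT s (nP (pauliString σ)) (nP (pauliString τ)) =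
    hermSign σ (σ + τ) • parTwin s (σ + τ) σ := by
  rw [nP_eq σ τ, parT_smul]
  rfl

theorem sqrt_two_ne_zero : ((Real.sqrt 2 : ℝ) : ℂ) ≠ 0 := by simp

theorem sum_parTwin (s : ℂ) (τ : Lab q) (a : Lab q → ℂ) : ∑ σ, a σ • parTwin s τ σ =
    slice τ (((Real.sqrt 2 : ℝ) : ℂ)⁻¹ • fun σ => a σ + s * (chi σ τ * a (σ + τ))) := by
  have h : ∑ σ, (a σ * (s * chi σ τ)) • twin τ (σ + τ) =
      ∑ σ, (s * (chi σ τ * a (σ + τ))) • twin τ σ := by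
    rw [← Equiv.sum_comp (Equiv.addRight τ)]
    refine Finset.sum_congr rfl fun σ _ => ?_
    simp only [Equiv.coe_addRight, Lab.add_add_self, chi_add_left]
    congr 1
    have : chi τ τ = 1 := chi_eq_one (sp_self τ)
    rw [this]
    ring
  rw [slice_smul]
  simp only [parTwin_eq, slice, smul_comm _ (((Real.sqrt 2 : ℝ) : ℂ)⁻¹), ← Finset.smul_sum]
  congr 1
  simp only [smul_add, smul_smul, add_smul, Finset.sum_add_distrib, h]

/-- The functions with `k (σ + τ) = ± k σ`, with support in one orbit. -/
def parSpace (s : ℂ) (b : ZMod 2) (τ : Lab q) : Submodule ℂ (Lab q → ℂ) where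
  carrier := {k | (∀ σ, ¬ Orb τ b σ → k σ = 0) ∧ ∀ σ, chi σ τ * k (σ + τ) = s * k σ}
  zero_mem' := by simp
  add_mem' := by
    rintro k k' ⟨h, h1⟩ ⟨h', h1'⟩
    exact ⟨fun σ hσ => by simp [h σ hσ, h' σ hσ], fun σ => by
      rw [Pi.add_apply, Pi.add_apply, mul_add, mul_add, h1, h1']⟩
  smul_mem' := by
    rintro c k ⟨h, h1⟩
    exact ⟨fun σ hσ => by simp [h σ hσ], fun σ => by
      rw [Pi.smul_apply, Pi.smul_apply, smul_eq_mul, smul_eq_mul, mul_left_comm, h1,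
        mul_left_comm]⟩

/-- When `k` has the matching parity, each basis vector is reached from both `σ` and `σ + τ`; the
resulting factor `2` meets the normalisation `1/√2`. -/
theorem sum_parTwin_of_mem {s : ℂ} (hs : s * s = 1) {b : ZMod 2} {τ : Lab q} {k : Lab q → ℂ}
    (hk : k ∈ parSpace s b τ) :
    ∑ σ, k σ • parTwin s τ σ = ((Real.sqrt 2 : ℝ) : ℂ) • slice τ k := by
  rw [sum_parTwin, ← slice_smul]
  congr 1
  funext σ
  have h2 := sqrt_two_inv_mul_self
  have h3 := mul_inv_cancel₀ sqrt_two_ne_zero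
  simp only [Pi.smul_apply, smul_eq_mul]
  linear_combination ((Real.sqrt 2 : ℝ) : ℂ)⁻¹ * s * hk.2 σ +
    ((Real.sqrt 2 : ℝ) : ℂ)⁻¹ * k σ * hs + (2 * ((Real.sqrt 2 : ℝ) : ℂ) * k σ) * h2 -
    2 * k σ * ((Real.sqrt 2 : ℝ) : ℂ)⁻¹ * h3

theorem parTwin_eq_slice (s : ℂ) (τ σ : Lab q) : parTwin s τ σ =
    slice τ (((Real.sqrt 2 : ℝ) : ℂ)⁻¹ • fun ν => (Pi.single σ 1 : Lab q → ℂ) ν +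
      s * (chi ν τ * (Pi.single σ 1 : Lab q → ℂ) (ν + τ))) := by
  rw [← sum_parTwin, Finset.sum_eq_single σ]
  · simp
  · intro σ' _ h
    simp [Pi.single_eq_of_ne h]
  · simp

theorem single_add_mem_parSpace {s : ℂ} (hs : s * s = 1) {b : ZMod 2} {τ σ : Lab q}
    (hσ : Orb τ b σ) : (fun ν => (Pi.single σ 1 : Lab q → ℂ) ν +
      s * (chi ν τ * (Pi.single σ 1 : Lab q → ℂ) (ν + τ))) ∈ parSpace s b τ := by
  refine ⟨fun ν hν => ?_, fun ν => ?_⟩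
  · have h1 : ν ≠ σ := fun h => hν (h ▸ hσ)
    have h2 : ν + τ ≠ σ := fun h => hν (orb_add_iff.1 (h ▸ hσ))
    simp [Pi.single_eq_of_ne h1, Pi.single_eq_of_ne h2]
  · simp only [Lab.add_add_self, chi_add_left, chi_eq_one (sp_self τ), mul_one]
    set x : Lab q → ℂ := Pi.single σ 1
    linear_combination (s * x ν) * chi_mul_self ν τ - (chi ν τ * x (ν + τ)) * hs

/-- The generators attached to a pair of labels are those attached to its sum as fibre label, by
`parT_nP`. Conversely a function of the right parity is a combination of them by
`sum_parTwin_of_mem`. -/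
theorem span_parT {s : ℂ} (hs : s * s = 1) {b : ZMod 2} {N : PauliString q → Finset (PauliString q)}
    (hN : ∀ σ τ, pauliString σ ∈ N (pauliString τ) ↔ Orb τ b σ) :
    Submodule.span ℂ {v | ∃ τ ∈ nonId q, ∃ σ ∈ N τ, v = parT s (nP σ) (nP τ)} =
      fiberedOp true (parSpace s b) := by
  apply le_antisymm
  · rw [Submodule.span_le]
    rintro _ ⟨τ, hτ, σ, hσ, rfl⟩
    obtain ⟨τ, rfl⟩ := pauliString.surjective τ
    obtain ⟨σ, rfl⟩ := pauliString.surjective σ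
    rw [hN] at hσ
    rw [mem_nonId] at hτ
    have h : Orb (σ + τ) b σ := by
      refine ⟨by simp [hσ.1], hσ.2.1, fun h => hτ ?_⟩
      simpa using h
    rw [parT_nP, parTwin_eq_slice, ← slice_smul]
    refine slice_mem_fiberedOp (adm_true.2 fun h' => hσ.2.2 ?_)
      (Submodule.smul_mem _ _ (Submodule.smul_mem _ _ (single_add_mem_parSpace hs h)))
    rw [Lab.add_eq_iff, zero_add] at h'
    exact h'
  · refine fiberedOp_le fun τ hτ k hk => ?_
    rw [← Submodule.smul_mem_iff _ sqrt_two_ne_zero, ← sum_parTwin_of_mem hs hk]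
    refine Submodule.sum_mem _ fun σ _ => ?_
    by_cases hσ : Orb τ b σ
    swap
    · rw [hk.1 σ hσ, zero_smul]
      exact Submodule.zero_mem _
    refine Submodule.smul_mem _ _ ?_
    have h : parTwin s τ σ =
        hermSign σ τ • parT s (nP (pauliString σ)) (nP (pauliString (σ + τ))) := by
      have h' : σ + (σ + τ) = τ := by rw [← add_assoc, Lab.add_self, zero_add]
      rw [parT_nP, h', smul_smul, hermSign_mul_self, one_smul]
    rw [h]
    refine Submodule.smul_mem _ _ (Submodule.subset_span ⟨_, mem_nonId.2 fun h' => hσ.2.2 ?_, _,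
      (hN _ _).2 ?_, rfl⟩)
    · rw [Lab.add_eq_iff, zero_add] at h'
      exact h'
    · refine ⟨by simp [hσ.1], hσ.2.1, fun h' => adm_true.1 hτ ?_⟩
      simpa using h'

theorem vsymComm_eq_fiberedOp : VsymComm q = fiberedOp true (parSpace 1 0) := by
  simp only [VsymComm, symT_eq]
  exact span_parT (mul_one 1) fun σ τ => mem_commOther

theorem vsymAnti_eq_fiberedOp : VsymAnti q = fiberedOp true (parSpace 1 1) := by
  simp only [VsymAnti, symT_eq]
  exact span_parT (mul_one 1) fun σ τ => mem_antiComm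

theorem valtComm_eq_fiberedOp : ValtComm q = fiberedOp true (parSpace (-1) 0) := by
  simp only [ValtComm, altT_eq]
  exact span_parT (by norm_num) fun σ τ => mem_commOther

theorem valtAnti_eq_fiberedOp : ValtAnti q = fiberedOp true (parSpace (-1) 1) := by
  simp only [ValtAnti, altT_eq]
  exact span_parT (by norm_num) fun σ τ => mem_antiComm

end slices

section spaces
variable {q : ℕ}

/-! ### Identification of the subspaces -/

theorem map_sectorAt (i : Fin 14) : (sectorAt q i).map (ofCoord q).toLinearMap =
    fiberedOp (sectorIndex i).1 fun τ => (sectorIndex i).2.space τ := by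
  rw [sectorAt, sector_eq_fibered, fiberedOp]

theorem eq_one_of_smul_pauli {c : ℂ} {σ : Lab q} (h : pauli σ = c • pauli σ) : c = 1 := by
  have h2 : (c - 1) • pauli σ = 0 := by rw [sub_smul, one_smul, ← h, sub_self]
  exact sub_eq_zero.1 ((smul_eq_zero.1 h2).resolve_right (pauli_ne_zero σ))

theorem hermSign_zero_right (σ : Lab q) : hermSign σ 0 = 1 := by
  have h := pauli_mul σ 0
  rw [pauli_zero, mul_one, add_zero] at h
  rw [hermSign, twist, sp_zero_right, if_pos rfl, one_mul, eq_one_of_smul_pauli h]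

theorem hermSign_zero_left (σ : Lab q) : hermSign 0 σ = 1 := by
  have h := pauli_mul 0 σ
  rw [pauli_zero, one_mul, zero_add] at h
  rw [hermSign, twist, sp_zero_left, if_pos rfl, one_mul, eq_one_of_smul_pauli h]

theorem hermSign_self (σ : Lab q) : hermSign σ σ = 1 := by
  have h := hermSign_add 0 σ
  rwa [zero_add, hermSign_zero_left, chi_zero_left, mul_one] at h

theorem nP_tmul_nP (σ τ : Lab q) : nP (pauliString σ) ⊗ₜ[ℂ] nP (pauliString τ) =
    hermSign σ (σ + τ) • twin (σ + τ) σ := by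
  rw [nP_eq σ τ, TensorProduct.tmul_smul, twin]

theorem nP_tmul_nP_self (σ : Lab q) :
    nP (pauliString σ) ⊗ₜ[ℂ] nP (pauliString σ) = twin 0 σ := by
  rw [nP_tmul_nP, Lab.add_self, hermSign_zero_right, one_smul]

theorem nP_zero_tmul_nP (τ : Lab q) : nP 0 ⊗ₜ[ℂ] nP (pauliString τ) = twin τ 0 := by
  rw [← pauliString_zero, nP_tmul_nP, zero_add, hermSign_zero_left, one_smul]

theorem nP_tmul_nP_zero (τ : Lab q) : nP (pauliString τ) ⊗ₜ[ℂ] nP 0 = twin τ τ := by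
  rw [← pauliString_zero, nP_tmul_nP, add_zero, hermSign_self, one_smul]

theorem single_mem_space {κ : Kind} {τ σ : Lab q} (hκ : κ = .point0 ∨ κ = .pointT)
    (h : κ.Supp τ σ) : (Pi.single σ 1 : Lab q → ℂ) ∈ κ.space τ := by
  rcases hκ with rfl | rfl <;>
    exact ⟨fun ν hν => Pi.single_eq_of_ne (fun e => hν (by rw [e]; exact h)) _, trivial⟩

theorem slice_of_supp {τ ρ : Lab q} {k : Lab q → ℂ} (h : ∀ σ, σ ≠ ρ → k σ = 0) :
    slice τ k = k ρ • twin τ ρ := by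
  rw [slice, Finset.sum_eq_single ρ]
  · intro σ _ hσ
    rw [h σ hσ, zero_smul]
  · simp

theorem vid_eq : Vid q = (sectorAt q 0).map (ofCoord q).toLinearMap := by
  rw [map_sectorAt]
  change _ = fiberedOp false fun τ => Kind.point0.space τ
  have h : nP 0 ⊗ₜ[ℂ] nP 0 = twin (0 : Lab q) 0 := nP_tmul_nP_self 0
  rw [Vid, h]
  apply le_antisymm
  · rw [Submodule.span_le, Set.singleton_subset_iff, ← slice_single]
    exact slice_mem_fiberedOp (adm_false.2 rfl) (single_mem_space (Or.inl rfl) rfl)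
  · refine fiberedOp_le fun τ hτ k hk => ?_
    rw [adm_false.1 hτ, slice_of_supp hk.1]
    exact Submodule.smul_mem _ _ (Submodule.mem_span_singleton_self _)

theorem vr_eq : Vr q = (sectorAt q 1).map (ofCoord q).toLinearMap := by
  rw [map_sectorAt]
  change _ = fiberedOp true fun τ => Kind.point0.space τ
  apply le_antisymm
  · rw [Vr, Submodule.span_le]
    rintro _ ⟨τ, hτ, rfl⟩
    obtain ⟨τ, rfl⟩ := pauliString.surjective τ
    rw [nP_zero_tmul_nP, ← slice_single]
    exact slice_mem_fiberedOp (adm_true.2 (mem_nonId.1 hτ)) (single_mem_space (Or.inl rfl) rfl)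
  · refine fiberedOp_le fun τ hτ k hk => ?_
    rw [slice_of_supp hk.1, ← nP_zero_tmul_nP]
    exact Submodule.smul_mem _ _ (Submodule.subset_span ⟨_, mem_nonId.2 (adm_true.1 hτ), rfl⟩)

theorem vl_eq : Vl q = (sectorAt q 2).map (ofCoord q).toLinearMap := by
  rw [map_sectorAt]
  change _ = fiberedOp true fun τ => Kind.pointT.space τ
  apply le_antisymm
  · rw [Vl, Submodule.span_le]
    rintro _ ⟨τ, hτ, rfl⟩
    obtain ⟨τ, rfl⟩ := pauliString.surjective τ
    rw [nP_tmul_nP_zero, ← slice_single]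
    exact slice_mem_fiberedOp (adm_true.2 (mem_nonId.1 hτ)) (single_mem_space (Or.inr rfl) rfl)
  · refine fiberedOp_le fun τ hτ k hk => ?_
    rw [slice_of_supp hk.1, ← nP_tmul_nP_zero]
    exact Submodule.smul_mem _ _ (Submodule.subset_span ⟨_, mem_nonId.2 (adm_true.1 hτ), rfl⟩)

/-! ### The diagonal sector -/

theorem orb_zero_left_iff {σ : Lab q} : Orb 0 0 σ ↔ σ ≠ 0 :=
  ⟨fun h => h.2.1, fun h => ⟨sp_zero_right σ, h, h⟩⟩

theorem slice_zero_mem_vdiag {k : Lab q → ℂ} (h : ∀ σ, ¬ Orb 0 0 σ → k σ = 0) :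
    slice 0 k ∈ Vdiag q := by
  refine Submodule.sum_mem _ fun σ _ => ?_
  by_cases hσ : Orb 0 0 σ
  · rw [← nP_tmul_nP_self]
    exact Submodule.smul_mem _ _
      (Submodule.subset_span ⟨_, mem_nonId.2 (orb_zero_left_iff.1 hσ), rfl⟩)
  · rw [h σ hσ, zero_smul]
    exact Submodule.zero_mem _

/-- The restriction of a function of Pauli strings to an orbit. -/
def restrict (τ : Lab q) (b : ZMod 2) (c : PauliString q → ℂ) : Lab q → ℂ := fun σ =>
  if Orb τ b σ then c (pauliString σ) else 0

theorem restrict_of_not_orb {τ σ : Lab q} {b : ZMod 2} (c : PauliString q → ℂ)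
    (h : ¬ Orb τ b σ) : restrict τ b c σ = 0 := if_neg h

theorem restrict_of_supp {τ : Lab q} {b : ZMod 2} {k : Lab q → ℂ}
    (h : ∀ σ, ¬ Orb τ b σ → k σ = 0) : restrict τ b (fun σ => k (pauliString.symm σ)) = k := by
  funext σ
  rw [restrict]
  split_ifs with hσ
  · simp
  · exact (h σ hσ).symm

theorem sum_nonId_smul (c : PauliString q → ℂ) :
    ∑ σ ∈ nonId q, c σ • (nP σ ⊗ₜ[ℂ] nP σ) = slice 0 (restrict 0 0 c) := by
  rw [sum_pauliString fun σ => mem_nonId.trans orb_zero_left_iff.symm, slice]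
  refine Finset.sum_congr rfl fun σ _ => ?_
  rw [restrict]
  split_ifs
  · rw [nP_tmul_nP_self]
  · rw [zero_smul]

theorem sum_ite_sp_eq_one (a : Lab q → ℂ) (ν : Lab q) :
    ∑ σ, (if sp σ ν = 1 then a σ else 0) = (∑ σ, a σ - fourier a ν) / 2 := by
  rw [fourier, ← Finset.sum_sub_distrib, Finset.sum_div]
  refine Finset.sum_congr rfl fun σ _ => ?_
  rcases ZMod2.cases (sp σ ν) with h | h
  · rw [if_neg (by rw [h]; exact zero_ne_one), chi_eq_one h]
    ring
  · rw [if_pos h, chi_eq_neg_one h]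
    ring

theorem exists_of_mem_const {k : Lab q → ℂ} {τ : Lab q} {b : ZMod 2}
    (hk : k ∈ (Kind.const b).space τ) : k = 0 ∨
      (∃ σ, Orb τ b σ) ∧ ∃ c : ℂ, k = c • restrict τ b 1 := by
  by_cases h : ∃ σ, Orb τ b σ
  · obtain ⟨σ, hσ⟩ := h
    refine Or.inr ⟨⟨σ, hσ⟩, k σ, funext fun ν => ?_⟩
    by_cases hν : Orb τ b ν
    · simp [restrict, hν, hk.2 ν σ hν hσ]
    · rw [hk.1 ν hν, Pi.smul_apply, restrict_of_not_orb _ hν, smul_zero]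
  · exact Or.inl (funext fun σ => hk.1 σ fun hσ => h ⟨σ, hσ⟩)

theorem restrict_one_mem (τ : Lab q) (b : ZMod 2) : restrict τ b 1 ∈ (Kind.const b).space τ :=
  ⟨fun _ hσ => if_neg hσ, fun _ _ hσ hσ' => (if_pos hσ).trans (if_pos hσ').symm⟩

theorem v0_eq (hq : 1 ≤ q) : V0 q = (sectorAt q 3).map (ofCoord q).toLinearMap := by
  rw [map_sectorAt]
  change _ = fiberedOp false fun τ => (Kind.const 0).space τ
  have h1 : ∑ σ ∈ nonId q, nP σ ⊗ₜ[ℂ] nP σ = slice 0 (restrict 0 0 1) := by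
    rw [← sum_nonId_smul]
    simp
  -- The normalising factor must be non-zero for the span to be unchanged, which uses `q ≥ 1`.
  have h2 : ((Real.sqrt ((2 ^ q) ^ 2 - 1) : ℝ) : ℂ)⁻¹ ≠ 0 := by
    have : (1 : ℝ) < 2 ^ q := one_lt_pow₀ (by norm_num) (by omega)
    refine inv_ne_zero (Complex.ofReal_ne_zero.2 (Real.sqrt_pos.2 ?_).ne')
    nlinarith
  rw [V0, h1]
  apply le_antisymm
  · rw [Submodule.span_le]
    rintro _ ⟨-, rfl⟩
    exact Submodule.smul_mem _ _ (slice_mem_fiberedOp (adm_false.2 rfl) (restrict_one_mem 0 0))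
  · refine fiberedOp_le fun τ hτ k hk => ?_
    obtain rfl := adm_false.1 hτ
    rcases exists_of_mem_const hk with rfl | ⟨-, c, rfl⟩
    · rw [slice_zero]
      exact Submodule.zero_mem _
    · rw [slice_smul, ← Submodule.smul_mem_iff _ h2, smul_comm]
      refine Submodule.smul_mem _ _ (Submodule.subset_span ⟨?_, rfl⟩)
      exact Submodule.smul_mem _ _ (slice_zero_mem_vdiag fun σ => restrict_of_not_orb _)

theorem sum_antiComm_eq (c : PauliString q → ℂ) (ν : Lab q) :
    ∑ σ ∈ antiComm (pauliString ν), c σ =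
      (∑ σ, restrict 0 0 c σ - fourier (restrict 0 0 c) ν) / 2 := by
  rw [sum_pauliString fun σ => mem_antiComm.trans orb_one, ← sum_ite_sp_eq_one]
  refine Finset.sum_congr rfl fun σ _ => ?_
  by_cases h : sp σ ν = 1
  · rw [if_pos h, if_pos h, restrict, if_pos (orb_zero_left_iff.2 _)]
    rintro rfl
    simp at h
  · rw [if_neg h, if_neg h]

/-- With zero total sum, the sum over labels anticommuting with `ν` is minus half the transform at
`ν`, so the stated condition is the eigenvalue equation for `e · 2^q`. -/
theorem span_diag_spec {e : ℤ} (he : e = 1 ∨ e = -1) {z : ℂ} (hz : z = -(e * (dim q / 2))) :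
    Submodule.span ℂ {v | v ∈ Vdiag q ∧ ∃ c : PauliString q → ℂ,
      v = ∑ σ ∈ nonId q, c σ • (nP σ ⊗ₜ[ℂ] nP σ) ∧ ∑ σ ∈ nonId q, c σ = 0 ∧
      ∀ τ ∈ nonId q, ∑ σ ∈ antiComm τ, c σ = z * c τ} =
    fiberedOp false fun τ => (Kind.spec 0 e).space τ := by
  have h0 : ∀ c : PauliString q → ℂ, ∑ σ ∈ nonId q, c σ = ∑ σ, restrict 0 0 c σ := fun c =>
    sum_pauliString (fun σ => mem_nonId.trans orb_zero_left_iff.symm) c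
  apply le_antisymm
  · rw [Submodule.span_le]
    rintro _ ⟨-, c, rfl, hc0, hc⟩
    rw [h0] at hc0
    rw [sum_nonId_smul]
    refine slice_mem_fiberedOp (adm_false.2 rfl) (spec_mem_space he
      (fun σ => restrict_of_not_orb c) (fun ν hν => ?_) fun _ => hc0)
    have h := hc _ (mem_nonId.2 (orb_zero_left_iff.1 hν))
    rw [sum_antiComm_eq, hc0, hz, dim] at h
    rw [show restrict 0 0 c ν = c (pauliString ν) from if_pos hν]
    linear_combination -2 * h
  · refine fiberedOp_le fun τ hτ k hk => ?_
    obtain rfl := adm_false.1 hτ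
    refine Submodule.subset_span ⟨slice_zero_mem_vdiag hk.1, fun σ => k (pauliString.symm σ), ?_, ?_,
      fun ν hν => ?_⟩
    · rw [sum_nonId_smul, restrict_of_supp hk.1]
    · rw [h0, restrict_of_supp hk.1, hk.2.2.1]
    · obtain ⟨ν, rfl⟩ := pauliString.surjective ν
      rw [sum_antiComm_eq, restrict_of_supp hk.1, hk.2.2.1,
        hk.2.2.2 ν (orb_zero_left_iff.2 (mem_nonId.1 hν)), hz, dim]
      simp only [Equiv.symm_apply_apply]
      ring

theorem v1_eq : V1 q = (sectorAt q 4).map (ofCoord q).toLinearMap := by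
  rw [map_sectorAt]
  exact span_diag_spec (Or.inl rfl) (by simp)

theorem v2_eq : V2 q = (sectorAt q 5).map (ofCoord q).toLinearMap := by
  rw [map_sectorAt]
  exact span_diag_spec (Or.inr rfl) (by simp)

/-! ### The off-diagonal sectors -/

theorem Orb.chi_eq_parity {τ σ : Lab q} {b : ZMod 2} (h : Orb τ b σ) : chi σ τ = parity b 1 := by
  rw [chi_comm, h.chi_eq]

theorem mem_parSpace_of_parity {s : ℂ} {k : Lab q → ℂ} {τ : Lab q} {b : ZMod 2}
    (hs : ∀ σ, ¬ Orb τ b σ → k σ = 0) (hk : ∀ σ, k (σ + τ) = s * parity b 1 * k σ) :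
    k ∈ parSpace s b τ := by
  refine ⟨hs, fun σ => ?_⟩
  by_cases hσ : Orb τ b σ
  · rw [hσ.chi_eq_parity, hk]
    linear_combination s * k σ * parity_mul_self b 1
  · rw [hk, hs σ hσ, mul_zero, mul_zero, mul_zero]

theorem parity_of_mem_parSpace {s : ℂ} {k : Lab q → ℂ} {τ : Lab q} {b : ZMod 2}
    (hk : k ∈ parSpace s b τ) (σ : Lab q) : k (σ + τ) = s * parity b 1 * k σ := by
  by_cases hσ : Orb τ b σ
  · have h := hk.2 σ
    rw [hσ.chi_eq_parity] at h
    linear_combination parity b 1 * h - k (σ + τ) * parity_mul_self b 1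
  · rw [hk.1 σ hσ, hk.1 _ fun h => hσ (orb_add_iff.1 h), mul_zero]

theorem spec_le_parSpace {b : ZMod 2} {e : ℤ} (he : e ≠ 0) (τ : Lab q) :
    (Kind.spec b e).space τ ≤ parSpace 1 b τ := fun k hk =>
  mem_parSpace_of_parity hk.1 fun σ => by rw [hk.2.1, parity_eq he, one_mul]

theorem spec_zero_le_parSpace {b : ZMod 2} (τ : Lab q) :
    (Kind.spec b 0).space τ ≤ parSpace (-1) b τ := fun k hk =>
  mem_parSpace_of_parity hk.1 fun σ => by rw [hk.2.1, parity_zero]; ring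

/-- A constant is even under translation, which means symmetric when `b = 0` and antisymmetric when
`b = 1`. This is why an adjoint summand sits in the symmetric commuting and in the antisymmetric
anticommuting sector. -/
theorem const_le_parSpace (b : ZMod 2) (τ : Lab q) :
    (Kind.const b).space τ ≤ parSpace (parity b 1) b τ := fun k hk =>
  mem_parSpace_of_parity hk.1 fun σ => by
    rw [parity_mul_self, one_mul]
    by_cases hσ : Orb τ b σ
    · exact hk.2 _ _ hσ.add hσ
    · rw [hk.1 σ hσ, hk.1 _ fun h => hσ (orb_add_iff.1 h)]

theorem sum_smul_eq {s : ℂ} {b : ZMod 2} {τ : Lab q} {N : Finset (PauliString q)}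
    (hN : ∀ σ, pauliString σ ∈ N ↔ Orb τ b σ) {F : PauliString q → Op2 q}
    (hF : ∀ σ, Orb τ b σ → F (pauliString σ) = parTwin s τ σ) (c : PauliString q → ℂ) :
    ∑ σ ∈ N, c σ • F σ = ∑ σ, restrict τ b c σ • parTwin s τ σ := by
  rw [sum_pauliString hN]
  refine Finset.sum_congr rfl fun σ _ => ?_
  rw [restrict]
  split_ifs with h
  · rw [hF σ h]
  · rw [zero_smul]

theorem symT_nMul {τ σ : Lab q} (h : Orb τ 0 σ) :
    symT (nP (pauliString σ)) (nMul (pauliString σ) (pauliString τ)) = parTwin 1 τ σ := by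
  rw [symT_eq, parTwin, twist, if_pos h.1, one_smul]

theorem twist_of_orb_one {τ σ : Lab q} (h : Orb τ 1 σ) : twist σ τ = Complex.I :=
  if_neg (by rw [h.1]; exact one_ne_zero)

theorem symT_I_smul_nMul {τ σ : Lab q} (h : Orb τ 1 σ) :
    symT (nP (pauliString σ)) (Complex.I • nMul (pauliString σ) (pauliString τ)) =
      parTwin 1 τ σ := by
  rw [symT_eq, parTwin, twist_of_orb_one h]

theorem altT_I_smul_nMul {τ σ : Lab q} (h : Orb τ 1 σ) :
    altT (nP (pauliString σ)) (Complex.I • nMul (pauliString σ) (pauliString τ)) =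
      parTwin (-1) τ σ := by
  rw [altT_eq, parTwin, twist_of_orb_one h]

theorem sum_symT_nMul (τ : Lab q) (c : PauliString q → ℂ) :
    ∑ σ ∈ commOther (pauliString τ), c σ • symT (nP σ) (nMul σ (pauliString τ)) =
      ∑ σ, restrict τ 0 c σ • parTwin 1 τ σ :=
  sum_smul_eq (F := fun σ => symT (nP σ) (nMul σ (pauliString τ))) (fun _ => mem_commOther)
    (fun _ h => symT_nMul h) c

theorem sum_symT_I_smul_nMul (τ : Lab q) (c : PauliString q → ℂ) :
    ∑ σ ∈ antiComm (pauliString τ), c σ • symT (nP σ) (Complex.I • nMul σ (pauliString τ)) =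
      ∑ σ, restrict τ 1 c σ • parTwin 1 τ σ :=
  sum_smul_eq (F := fun σ => symT (nP σ) (Complex.I • nMul σ (pauliString τ)))
    (fun _ => mem_antiComm) (fun _ h => symT_I_smul_nMul h) c

theorem span_adj {b : ZMod 2} {N : PauliString q → Finset (PauliString q)}
    (hN : ∀ σ τ, pauliString σ ∈ N (pauliString τ) ↔ Orb τ b σ)
    {F : PauliString q → PauliString q → Op2 q}
    (hF : ∀ σ τ, Orb τ b σ → F (pauliString σ) (pauliString τ) = parTwin (parity b 1) τ σ) :
    Submodule.span ℂ {v | v ∈ fiberedOp true (parSpace (parity b 1) b) ∧ ∃ τ ∈ nonId q,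
      v = ((Real.sqrt (2 * (N τ).card) : ℝ) : ℂ)⁻¹ • ∑ σ ∈ N τ, F σ τ} =
    fiberedOp true fun τ => (Kind.const b).space τ := by
  have hsum : ∀ τ, ∑ σ ∈ N (pauliString τ), F σ (pauliString τ) =
      ((Real.sqrt 2 : ℝ) : ℂ) • slice τ (restrict τ b 1) := fun τ => by
    rw [← sum_parTwin_of_mem (parity_mul_self b 1) (const_le_parSpace b τ (restrict_one_mem τ b)),
      ← sum_smul_eq (F := fun σ => F σ (pauliString τ)) (fun σ => hN σ τ) (fun σ => hF σ τ) 1]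
    simp
  apply le_antisymm
  · rw [Submodule.span_le]
    rintro _ ⟨-, τ, hτ, rfl⟩
    obtain ⟨τ, rfl⟩ := pauliString.surjective τ
    rw [hsum]
    exact Submodule.smul_mem _ _ (Submodule.smul_mem _ _
      (slice_mem_fiberedOp (adm_true.2 (mem_nonId.1 hτ)) (restrict_one_mem τ b)))
  · refine fiberedOp_le fun τ hτ k hk => ?_
    rcases exists_of_mem_const hk with rfl | ⟨⟨σ, hσ⟩, c, rfl⟩
    · rw [slice_zero]
      exact Submodule.zero_mem _
    · have hpos : 0 < (N (pauliString τ)).card := Finset.card_pos.2 ⟨_, (hN σ τ).2 hσ⟩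
      have h2 : ((Real.sqrt (2 * (N (pauliString τ)).card) : ℝ) : ℂ)⁻¹ ≠ 0 := by
        refine inv_ne_zero (Complex.ofReal_ne_zero.2 (Real.sqrt_pos.2 ?_).ne')
        positivity
      rw [slice_smul]
      refine Submodule.smul_mem _ _ ?_
      rw [← Submodule.smul_mem_iff _ sqrt_two_ne_zero, ← Submodule.smul_mem_iff _ h2, ← hsum]
      refine Submodule.subset_span ⟨?_, _, mem_nonId.2 (adm_true.1 hτ), rfl⟩
      rw [hsum]
      exact Submodule.smul_mem _ _ (Submodule.smul_mem _ _
        (slice_mem_fiberedOp hτ (const_le_parSpace b τ (restrict_one_mem τ b))))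

theorem vadjComm_eq : VadjComm q = (sectorAt q 6).map (ofCoord q).toLinearMap := by
  have hp : parity 0 1 = 1 := by simp [parity]
  rw [map_sectorAt]
  simp only [VadjComm, vsymComm_eq_fiberedOp, ← hp]
  refine span_adj (fun σ τ => mem_commOther) (F := fun σ τ => symT (nP σ) (nMul σ τ))
    fun σ τ h => ?_
  rw [symT_nMul h, hp]

theorem vadjAnti_eq : VadjAnti q = (sectorAt q 9).map (ofCoord q).toLinearMap := by
  have hp : parity 1 1 = -1 := by simp [parity]
  rw [map_sectorAt]
  simp only [VadjAnti, valtAnti_eq_fiberedOp, ← hp]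
  refine span_adj (fun σ τ => mem_antiComm)
    (F := fun σ τ => altT (nP σ) (Complex.I • nMul σ τ)) fun σ τ h => ?_
  rw [altT_I_smul_nMul h, hp]

theorem iSup_span_eq {b : ZMod 2} {e : ℤ} (he : e ≠ 0)
    {P : Lab q → (PauliString q → ℂ) → Prop} {W : PauliString q → Submodule ℂ (Op2 q)}
    (hW : ∀ τ, W (pauliString τ) = Submodule.span ℂ {v | v ∈ fiberedOp true (parSpace 1 b) ∧
      ∃ c, v = ∑ σ, restrict τ b c σ • parTwin 1 τ σ ∧ P τ c})
    (hP : ∀ τ, τ ≠ 0 → ∀ c, P τ c ↔ restrict τ b c ∈ (Kind.spec b e).space τ) :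
    ⨆ τ ∈ nonId q, W τ = fiberedOp true fun τ => (Kind.spec b e).space τ := by
  have hsum : ∀ (τ : Lab q) {k}, k ∈ (Kind.spec b e).space τ →
      ∑ σ, k σ • parTwin 1 τ σ = ((Real.sqrt 2 : ℝ) : ℂ) • slice τ k := fun τ k hk =>
    sum_parTwin_of_mem (mul_one 1) (spec_le_parSpace he τ hk)
  apply le_antisymm
  · refine iSup₂_le fun τ hτ => ?_
    obtain ⟨τ, rfl⟩ := pauliString.surjective τ
    rw [hW, Submodule.span_le]
    rintro _ ⟨-, c, rfl, hc⟩
    rw [hP τ (mem_nonId.1 hτ)] at hc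
    rw [hsum τ hc]
    exact Submodule.smul_mem _ _ (slice_mem_fiberedOp (adm_true.2 (mem_nonId.1 hτ)) hc)
  · refine fiberedOp_le fun τ hτ k hk => ?_
    have hτ' := mem_nonId.2 (adm_true.1 hτ)
    refine Submodule.mem_iSup_of_mem (pauliString τ) (Submodule.mem_iSup_of_mem hτ' ?_)
    rw [hW, ← Submodule.smul_mem_iff _ sqrt_two_ne_zero, ← hsum τ hk]
    refine Submodule.subset_span ⟨?_, fun σ => k (pauliString.symm σ), ?_, ?_⟩
    · rw [hsum τ hk]
      exact Submodule.smul_mem _ _ (slice_mem_fiberedOp hτ (spec_le_parSpace he τ hk))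
    · rw [restrict_of_supp hk.1]
    · rw [hP τ (adm_true.1 hτ), restrict_of_supp hk.1]
      exact hk

/-- The conditions defining the symmetric commuting subspaces do not demand zero sum; it follows by
summing the equation over all labels commuting with `τ`. -/
theorem sum_eq_zero_of_fourier_eq {τ : Lab q} (hτ : τ ≠ 0) {a : Lab q → ℂ}
    (ha : ∀ σ, ¬ Orb τ 0 σ → a σ = 0) {z : ℂ} (hz : (4 : ℂ) ^ q / 2 + z ≠ 0)
    (h : ∀ ν, Orb τ 0 ν → fourier a ν = ∑ σ, a σ + z * a ν) : ∑ σ, a σ = 0 := by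
  have hτa : fourier a τ = ∑ σ, a σ := by
    refine Finset.sum_congr rfl fun σ _ => ?_
    by_cases hσ : Orb τ 0 σ
    · rw [chi_eq_one hσ.1, one_mul]
    · rw [ha σ hσ, mul_zero]
  -- The equation extends to `ν = 0` and `ν = τ`, where `a` vanishes and the transform equals the
  -- total sum. The weight `(1 + chi ν τ)/2` is the indicator of the labels commuting with `τ`.
  have hpoint : ∀ ν, (1 + chi ν τ) / 2 * fourier a ν =
      (1 + chi ν τ) / 2 * (∑ σ, a σ) + z * a ν := fun ν => by
    rcases ZMod2.cases (sp ν τ) with h1 | h1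
    · rw [chi_eq_one h1]
      by_cases h2 : Orb τ 0 ν
      · rw [h ν h2]
        ring
      · rw [ha ν h2]
        have : ν = 0 ∨ ν = τ := by
          by_contra! h3
          exact h2 ⟨h1, h3.1, h3.2⟩
        rcases this with rfl | rfl
        · rw [fourier_zero]
          ring
        · rw [hτa]
          ring
    · rw [chi_eq_neg_one h1, ha ν fun h2 => by rw [h2.1] at h1; exact zero_ne_one h1]
      ring
  -- The sum of the transform over the commutant of `τ` is given by Fourier inversion at `0` and
  -- `τ`, where `a` is zero.
  have hs1 : ∑ ν, (1 + chi ν τ) / 2 * fourier a ν = 0 := by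
    have : ∑ ν, (1 + chi ν τ) / 2 * fourier a ν =
        (fourier (fourier a) 0 + fourier (fourier a) τ) / 2 := by
      rw [fourier_zero, fourier.eq_1 (fourier a), ← Finset.sum_add_distrib, Finset.sum_div]
      exact Finset.sum_congr rfl fun ν _ => by ring
    rw [this, fourier_fourier, fourier_fourier, ha 0 fun h => h.2.1 rfl, ha τ fun h => h.2.2 rfl]
    ring
  have hs2 : ∑ ν : Lab q, (1 + chi ν τ) / 2 = 4 ^ q / 2 := by
    rw [← Finset.sum_div, Finset.sum_add_distrib, sum_chi, if_neg hτ, sum_one, add_zero]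
  simp only [hpoint, Finset.sum_add_distrib, ← Finset.sum_mul, ← Finset.mul_sum, hs2,
    ← add_mul] at hs1
  exact (mul_eq_zero.1 hs1).resolve_left hz

/-- Without knowing the sum, the condition says that the transform equals the total sum plus `e ·
2^q` times the function; the preceding lemma removes the sum. -/
theorem symComm_condition_iff (hq : 2 ≤ q) {e : ℤ} (he : e = 1 ∨ e = -1) {z : ℂ}
    (hz : z = -(e * (dim q / 2))) {τ : Lab q} (hτ : τ ≠ 0) (c : PauliString q → ℂ) :
    (∀ ν ∈ commOther (pauliString τ),
      ∑ σ ∈ commOther (pauliString τ) ∩ antiComm ν, c σ = z * c ν) ↔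
      restrict τ 0 c ∈ (Kind.spec 0 e).space τ := by
  have hsum : ∀ ν, ∑ σ ∈ commOther (pauliString τ) ∩ antiComm (pauliString ν), c σ =
      (∑ σ, restrict τ 0 c σ - fourier (restrict τ 0 c) ν) / 2 := fun ν => by
    rw [sum_pauliString (p := fun σ => Orb τ 0 σ ∧ sp σ ν = 1) fun σ => by
      rw [Finset.mem_inter, mem_commOther, mem_antiComm, orb_one], ← sum_ite_sp_eq_one]
    refine Finset.sum_congr rfl fun σ _ => ?_
    by_cases h : Orb τ 0 σ <;> by_cases h' : sp σ ν = 1 <;> simp [restrict, h, h']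
  have hc : ∀ ν, Orb τ 0 ν → restrict τ 0 c ν = c (pauliString ν) := fun ν h => if_pos h
  constructor
  · intro h
    have h1 : ∀ ν, Orb τ 0 ν → fourier (restrict τ 0 c) ν =
        ∑ σ, restrict τ 0 c σ + e * 2 ^ q * restrict τ 0 c ν := fun ν hν => by
      have := h _ (mem_commOther.2 hν)
      rw [hsum, hz, dim, ← hc ν hν] at this
      linear_combination -2 * this
    have h0 : ∑ σ, restrict τ 0 c σ = 0 := by
      refine sum_eq_zero_of_fourier_eq hτ (fun σ => restrict_of_not_orb c) ?_ h1
      rw [four_pow_eq]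
      obtain ⟨m, rfl⟩ := Nat.exists_eq_add_of_le hq
      have h2 : (0 : ℝ) < 2 ^ (2 + m) := by positivity
      have h3 : (1 : ℝ) ≤ 2 ^ m := one_le_pow₀ (by norm_num)
      -- The factor `4^q/2 + e · 2^q` vanishes for `e = -1` and one qubit, hence the assumption of
      -- at least two.
      have h4 : (0 : ℝ) < 2 ^ (2 + m) * 2 ^ (2 + m) / 2 + e * 2 ^ (2 + m) := by
        have : (-1 : ℝ) ≤ e := by rcases he with rfl | rfl <;> norm_num
        have : (2 : ℝ) ^ (2 + m) = 4 * 2 ^ m := by rw [pow_add]; norm_num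
        nlinarith
      have h5 : ((2 ^ (2 + m) * 2 ^ (2 + m) / 2 + e * 2 ^ (2 + m) : ℝ) : ℂ) ≠ 0 :=
        Complex.ofReal_ne_zero.2 h4.ne'
      simpa using h5
    refine spec_mem_space he (fun σ => restrict_of_not_orb c) (fun ν hν => ?_) fun _ => h0
    rw [h1 ν hν, h0, zero_add]
  · intro h ν hν
    obtain ⟨ν, rfl⟩ := pauliString.surjective ν
    rw [mem_commOther] at hν
    rw [hsum, h.2.2.1, h.2.2.2 ν hν, hc ν hν, hz, dim]
    ring

theorem vsymComm1_eq (hq : 2 ≤ q) :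
    VsymComm1 q = (sectorAt q 7).map (ofCoord q).toLinearMap := by
  rw [map_sectorAt]
  refine iSup_span_eq (by decide) (fun τ => ?_)
    fun τ hτ => symComm_condition_iff hq (Or.inl rfl) (z := -(dim q / 2)) (by simp) hτ
  simp only [VsymComm1At, vsymComm_eq_fiberedOp, sum_symT_nMul]

theorem vsymComm2_eq (hq : 2 ≤ q) :
    VsymComm2 q = (sectorAt q 8).map (ofCoord q).toLinearMap := by
  rw [map_sectorAt]
  refine iSup_span_eq (by decide) (fun τ => ?_)
    fun τ hτ => symComm_condition_iff hq (Or.inr rfl) (z := dim q / 2) (by simp) hτ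
  simp only [VsymComm2At, vsymComm_eq_fiberedOp, sum_symT_nMul]

/-- The difference of the sums over commuting and anticommuting labels is the Fourier transform
itself. No condition on the total sum is needed because the parity is odd for `b = 1`. -/
theorem symAnti_condition_iff {e : ℤ} (he : e = 1 ∨ e = -1) {z : ℂ} (hz : z = e * dim q)
    (τ : Lab q) (c : PauliString q → ℂ) :
    (∀ ν ∈ antiComm (pauliString τ),
      ∑ σ ∈ antiComm (pauliString τ) ∩ commAll ν, c σ -
        ∑ σ ∈ antiComm (pauliString τ) ∩ antiComm ν, c σ = z * c ν) ↔
      restrict τ 1 c ∈ (Kind.spec 1 e).space τ := by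
  have hsum : ∀ ν, ∑ σ ∈ antiComm (pauliString τ) ∩ commAll (pauliString ν), c σ -
      ∑ σ ∈ antiComm (pauliString τ) ∩ antiComm (pauliString ν), c σ =
        fourier (restrict τ 1 c) ν := fun ν => by
    rw [sum_pauliString (p := fun σ => Orb τ 1 σ ∧ sp σ ν = 0) fun σ => by
        rw [Finset.mem_inter, mem_antiComm, mem_commAll],
      sum_pauliString (p := fun σ => Orb τ 1 σ ∧ sp σ ν = 1) fun σ => by
        rw [Finset.mem_inter, mem_antiComm, mem_antiComm, orb_one (τ := ν)],
      ← Finset.sum_sub_distrib, fourier]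
    refine Finset.sum_congr rfl fun σ _ => ?_
    by_cases h : Orb τ 1 σ <;> rcases ZMod2.cases (sp σ ν) with h' | h' <;>
      simp [restrict, h, h', chi]
  have hc : ∀ ν, Orb τ 1 ν → restrict τ 1 c ν = c (pauliString ν) := fun ν h => if_pos h
  constructor
  · intro h
    refine spec_mem_space he (fun σ => restrict_of_not_orb c) (fun ν hν => ?_)
      fun h => absurd h one_ne_zero
    rw [← hsum, h _ (mem_antiComm.2 hν), hz, hc ν hν, dim]
  · intro h ν hν
    obtain ⟨ν, rfl⟩ := pauliString.surjective ν
    rw [mem_antiComm] at hν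
    rw [hsum, h.2.2.2 ν hν, hc ν hν, hz, dim]

theorem vsymAnti1_eq : VsymAnti1 q = (sectorAt q 10).map (ofCoord q).toLinearMap := by
  rw [map_sectorAt]
  refine iSup_span_eq (by decide) (fun τ => ?_)
    fun τ _ => symAnti_condition_iff (Or.inl rfl) (z := dim q) (by simp) τ
  simp only [VsymAnti1At, vsymAnti_eq_fiberedOp, sum_symT_I_smul_nMul]

theorem vsymAnti2_eq : VsymAnti2 q = (sectorAt q 11).map (ofCoord q).toLinearMap := by
  rw [map_sectorAt]
  refine iSup_span_eq (by decide) (fun τ => ?_)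
    fun τ _ => symAnti_condition_iff (Or.inr rfl) (z := -dim q) (by simp) τ
  simp only [VsymAnti2At, vsymAnti_eq_fiberedOp, sum_symT_I_smul_nMul]

/-- For commuting labels antisymmetry is oddness under translation by `τ`, so the sum vanishes by
itself and no constants have to be split off. -/
theorem parSpace_neg_one_zero (τ : Lab q) : parSpace (-1) 0 τ = (Kind.spec 0 0).space τ := by
  refine le_antisymm (fun k hk => ?_) (spec_zero_le_parSpace τ)
  have h : ∀ σ, k (σ + τ) = -k σ := fun σ => by
    rw [parity_of_mem_parSpace hk]
    simp [parity]
  refine alt_mem_space hk.1 (fun σ => by rw [h]; simp [parity]) ?_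
  have h2 := sum_comp_add k τ
  simp only [h, Finset.sum_neg_distrib] at h2
  linear_combination (-1 / 2 : ℂ) * h2

theorem valtComm_eq : ValtComm q = (sectorAt q 12).map (ofCoord q).toLinearMap := by
  rw [map_sectorAt, valtComm_eq_fiberedOp]
  exact congrArg _ (funext parSpace_neg_one_zero)

/-- The adjoint part over `τ` is spanned by the indicator of the anticommuting labels, and
orthogonality to it is the vanishing of the sum. Together with antisymmetry this characterises `spec
1 0`. -/
theorem vadjAntiPerp_eq : VadjAntiPerp q = (sectorAt q 13).map (ofCoord q).toLinearMap := by
  have hadj : VadjAnti q = fiberedOp true fun τ => (Kind.const 1).space τ := by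
    rw [vadjAnti_eq, map_sectorAt]
    rfl
  rw [map_sectorAt]
  change _ = fiberedOp true fun τ => (Kind.spec 1 0).space τ
  apply le_antisymm
  · rintro v ⟨hv, hv0⟩
    rw [valtAnti_eq_fiberedOp] at hv
    obtain ⟨f, hf, rfl⟩ := hv
    have hf := mem_fibered.1 hf
    refine ⟨f, mem_fibered.2 fun τ => ⟨fun hτ => ?_, (hf τ).2⟩, rfl⟩
    have hk := (hf τ).1 hτ
    refine alt_mem_space hk.1 (fun σ => by rw [parity_of_mem_parSpace hk]; ring) ?_
    have h := hv0 (slice τ (restrict τ 1 1))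
      (hadj ▸ slice_mem_fiberedOp hτ (restrict_one_mem τ 1))
    rw [LinearEquiv.coe_coe, hsInner_slice] at h
    rw [← h]
    refine Finset.sum_congr rfl fun σ _ => ?_
    by_cases hσ : Orb τ 1 σ
    · simp [restrict, hσ]
    · rw [hk.1 σ hσ, mul_zero]
  · rintro v hv
    refine ⟨?_, fun w hw => ?_⟩
    · rw [valtAnti_eq_fiberedOp]
      exact fiberedOp_le (fun τ hτ k hk => slice_mem_fiberedOp hτ (spec_zero_le_parSpace τ hk)) hv
    · obtain ⟨f, hf, rfl⟩ := hv
      rw [hadj] at hw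
      obtain ⟨g, hg, rfl⟩ := hw
      have hf := mem_fibered.1 hf
      have hg := mem_fibered.1 hg
      have hsum : ∀ s : Finset (Lab q),
          hsInner (∑ τ ∈ s, slice τ (g τ)) (ofCoord q f) = 0 := by
        classical
        intro s
        induction s using Finset.induction_on with
        | empty => simp [hsInner]
        | insert τ s hs ih =>
          rw [Finset.sum_insert hs, hsInner_add_left, ih, add_zero, hsInner_slice]
          by_cases hτ : Adm true τ
          · rcases exists_of_mem_const ((hg τ).1 hτ) with h | ⟨-, c, h⟩
            · simp [h]
            · have hk := (hf τ).1 hτ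
              have : ∀ σ, star (g τ σ) * f τ σ = star c * f τ σ := fun σ => by
                by_cases hσ : Orb τ 1 σ
                · simp [h, restrict, hσ]
                · rw [hk.1 σ hσ, mul_zero, mul_zero]
              simp only [this, ← Finset.mul_sum, hk.2.2.1, mul_zero]
          · simp [(hf τ).2 hτ]
      exact hsum Finset.univ

/-! ### One qubit -/

theorem valtAnti_one_eq : ValtAnti 1 = (sectorAt 1 9).map (ofCoord 1).toLinearMap := by
  have hp : parity 1 1 = -1 := by simp [parity]
  rw [map_sectorAt, valtAnti_eq_fiberedOp]
  change fiberedOp true _ = fiberedOp true fun τ => (Kind.const 1).space τ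
  refine congrArg (Submodule.map _) (fibered_congr fun τ hτ => le_antisymm (fun k hk => ?_) ?_)
  · refine ⟨hk.1, fun σ σ' hσ hσ' => ?_⟩
    by_cases h : σ = σ'
    · rw [h]
    -- The sum of two distinct labels anticommuting with `τ` is non-zero and commutes with `τ`, so
    -- for one qubit it is `τ`; antisymmetry then makes the function constant on the orbit.
    · have h1 : σ + σ' = τ := by
        refine eq_of_perp_one (adm_true.1 hτ) (fun h' => h ?_) ?_
        · rwa [Lab.add_eq_iff, zero_add] at h'
        · rw [sp_add_left, hσ.1, hσ'.1, ZMod2.add_self]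
      rw [Lab.add_eq_iff, add_comm] at h1
      rw [h1, parity_of_mem_parSpace hk, hp]
      ring
  · rw [← hp]
    exact const_le_parSpace 1 τ

theorem vsymAnti_one_eq : VsymAnti 1 = (sectorAt 1 10).map (ofCoord 1).toLinearMap := by
  have hp : parity 1 1 = -1 := by simp [parity]
  rw [map_sectorAt, vsymAnti_eq_fiberedOp]
  change fiberedOp true _ = fiberedOp true fun τ => (Kind.spec 1 1).space τ
  refine congrArg (Submodule.map _) (fibered_congr fun τ hτ => le_antisymm (fun k hk => ?_)
    (spec_le_parSpace (by decide) τ))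
  have hpar : ∀ σ, k (σ + τ) = parity 1 1 * k σ := fun σ => by
    rw [parity_of_mem_parSpace hk, one_mul]
  have h0 : ∑ σ, k σ = 0 := by
    have h2 := sum_comp_add k τ
    simp only [hpar, hp, ← Finset.mul_sum] at h2
    linear_combination (-1 / 2 : ℂ) * h2
  have h1 := half_mem_space (e := 1) (Or.inl rfl) hk.1 hpar h0
  have h2 := half_mem_space (e := -1) (Or.inr rfl) hk.1 hpar h0
  have h3 : (sectorAt 1 11 : Submodule ℂ (Coord 1)) = ⊥ := by
    obtain ⟨-, -, -, -, h, -⟩ := sectorAt_one_eq_bot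
    exact h
  -- The projection to eigenvalue `-2^q` lies in sector `11`, which is zero for one qubit; hence `k`
  -- equals its projection to eigenvalue `2^q`.
  have h4 : ∀ ν, (k ν + ((-1 : ℤ) : ℂ) * (fourier k ν / 2 ^ 1)) / 2 = 0 := fun ν => by
    have h5 : (Pi.single τ _ : Coord 1) ∈ sectorAt 1 11 := single_mem_sector hτ h2
    rw [h3, Submodule.mem_bot] at h5
    have h6 := congrFun (congrFun h5 τ) ν
    rwa [Pi.single_eq_same] at h6
  convert h1 using 1
  funext ν
  have h5 := h4 ν
  push_cast at h5 ⊢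
  linear_combination h5

end spaces

/-! ### The decompositions -/

/-- An enumeration of the equivalence classes. -/
def IrrepClass.code : IrrepClass → ℕ
  | triv => 0
  | adjoint => 1
  | diag1 => 2
  | diag2 => 3
  | symComm1 => 4
  | symComm2 => 5
  | symAnti => 6
  | symAnti1 => 7
  | symAnti2 => 8
  | alt => 9

theorem IrrepClass.code_injective : Function.Injective IrrepClass.code := by
  intro a b h
  cases a <;> cases b <;> first | rfl | exact absurd h (by decide)

instance : DecidableEq IrrepClass := fun _ _ =>
  decidable_of_iff _ IrrepClass.code_injective.eq_iff

theorem isIrreducibleDecomposition_twoCopy {q m : ℕ} (hq : 1 ≤ q) (e : Fin m → Fin 14)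
    (he : Function.Injective e) {W : Fin m → Submodule ℂ (Op2 q)} {cls : Fin m → IrrepClass}
    (hW : ∀ i, W i = (sectorAt q (e i)).map (ofCoord q).toLinearMap)
    (hne : ∀ i, sectorAt q (e i) ≠ ⊥) (hbot : ∀ j, (∀ i, e i ≠ j) → sectorAt q j = ⊥)
    (hcls : ∀ i j, cls i = cls j ↔ baseIndex (e i) = baseIndex (e j))
    (hbase : ∀ i, ∃ l, e l = baseIndex (e i)) (h1 : q = 1 → ∀ i, e i ≠ 8 ∧ e i ≠ 11) :
    IsIrreducibleDecomposition (twoCopy q) W cls :=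
  (isMonomial_coordRep hq).isIrreducibleDecomposition (ofCoord q) ofCoord_coordRep e he hW hne hbot
    hcls hbase fun i j h => by
      rw [← invariantCode_invariants hq (e i) fun hq1 => h1 hq1 i, h,
        invariantCode_invariants hq (e j) fun hq1 => h1 hq1 j]

theorem isIrreducibleDecomposition_one : IsIrreducibleDecomposition (twoCopy 1)
    ![Vid 1, Vr 1, Vl 1, V0 1, V1 1, VsymAnti 1, ValtAnti 1]
    ![.triv, .adjoint, .adjoint, .triv, .diag1, .symAnti, .adjoint] := by
  obtain ⟨n0, n1, n2, n3, n4, n9, n10⟩ := sectorAt_ne_bot_of_one_le (0 : Fin 1)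
  obtain ⟨b5, b6, b7, b8, b11, b12, b13⟩ := sectorAt_one_eq_bot
  refine isIrreducibleDecomposition_twoCopy le_rfl ![0, 1, 2, 3, 4, 10, 9] (by decide) (fun i => ?_)
    (fun i => ?_) (fun j hj => ?_) (by decide) (by decide) (fun _ => by decide)
  · fin_cases i
    exacts [vid_eq, vr_eq, vl_eq, v0_eq le_rfl, v1_eq, vsymAnti_one_eq, valtAnti_one_eq]
  · fin_cases i
    exacts [n0, n1, n2, n3, n4, n10, n9]
  · have : j = 5 ∨ j = 6 ∨ j = 7 ∨ j = 8 ∨ j = 11 ∨ j = 12 ∨ j = 13 := by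
      revert j
      decide
    rcases this with rfl | rfl | rfl | rfl | rfl | rfl | rfl <;> assumption

theorem isIrreducibleDecomposition_two : IsIrreducibleDecomposition (twoCopy 2)
    ![Vid 2, Vr 2, Vl 2, V0 2, V1 2, V2 2, VadjComm 2, VsymComm1 2,
      VadjAnti 2, VsymAnti1 2, VsymAnti2 2, ValtComm 2, VadjAntiPerp 2]
    ![.triv, .adjoint, .adjoint, .triv, .diag1, .diag2, .adjoint, .symComm1,
      .adjoint, .symAnti1, .symAnti2, .alt, .alt] := by
  obtain ⟨n0, n1, n2, n3, n4, n9, n10⟩ := sectorAt_ne_bot_of_one_le (0 : Fin 2)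
  obtain ⟨n5, n6, n7, n11, n12, n13⟩ :=
    sectorAt_ne_bot_of_two_le le_rfl (i := (0 : Fin 2)) (j := 1) (by decide)
  refine isIrreducibleDecomposition_twoCopy one_le_two
    ![0, 1, 2, 3, 4, 5, 6, 7, 9, 10, 11, 12, 13] (by decide) (fun i => ?_)
    (fun i => ?_) (fun j hj => ?_) (by decide) (by decide) (fun h => absurd h (by decide))
  · fin_cases i
    exacts [vid_eq, vr_eq, vl_eq, v0_eq one_le_two, v1_eq, v2_eq, vadjComm_eq, vsymComm1_eq le_rfl,
      vadjAnti_eq, vsymAnti1_eq, vsymAnti2_eq, valtComm_eq, vadjAntiPerp_eq]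
  · fin_cases i
    exacts [n0, n1, n2, n3, n4, n5, n6, n7, n9, n10, n11, n12, n13]
  · have : j = 8 := by
      revert j
      decide
    rw [this]
    exact sectorAt_two_eq_bot

theorem isIrreducibleDecomposition_of_three_le (q : ℕ) (hq : 3 ≤ q) :
    IsIrreducibleDecomposition (twoCopy q)
      ![Vid q, Vr q, Vl q, V0 q, V1 q, V2 q, VadjComm q, VsymComm1 q, VsymComm2 q,
        VadjAnti q, VsymAnti1 q, VsymAnti2 q, ValtComm q, VadjAntiPerp q]
      ![.triv, .adjoint, .adjoint, .triv, .diag1, .diag2, .adjoint, .symComm1, .symComm2,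
        .adjoint, .symAnti1, .symAnti2, .alt, .alt] := by
  let j₀ : Fin q := ⟨0, by omega⟩
  let j₁ : Fin q := ⟨1, by omega⟩
  let j₂ : Fin q := ⟨2, by omega⟩
  have h01 : j₀ ≠ j₁ := by simp [j₀, j₁]
  have h02 : j₀ ≠ j₂ := by simp [j₀, j₂]
  have h12 : j₁ ≠ j₂ := by simp [j₁, j₂]
  have hq1 : 1 ≤ q := by omega
  have hq2 : 2 ≤ q := by omega
  obtain ⟨n0, n1, n2, n3, n4, n9, n10⟩ := sectorAt_ne_bot_of_one_le j₀
  obtain ⟨n5, n6, n7, n11, n12, n13⟩ := sectorAt_ne_bot_of_two_le hq2 h01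
  have n8 := sectorAt_ne_bot_of_three_le h01 h02 h12
  refine isIrreducibleDecomposition_twoCopy hq1 id Function.injective_id (fun i => ?_)
    (fun i => ?_) (fun j hj => absurd rfl (hj j)) (by decide) (by decide) (fun h => by omega)
  · fin_cases i
    exacts [vid_eq, vr_eq, vl_eq, v0_eq hq1, v1_eq, v2_eq, vadjComm_eq, vsymComm1_eq hq2,
      vsymComm2_eq hq2, vadjAnti_eq, vsymAnti1_eq, vsymAnti2_eq, valtComm_eq,
      vadjAntiPerp_eq]
  · fin_cases i
    exacts [n0, n1, n2, n3, n4, n5, n6, n7, n8, n9, n10, n11, n12, n13]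

end Clifford

end

open Clifford IrrepClass in
theorem theorem1 :
    IsIrreducibleDecomposition (twoCopy 1)
      ![Vid 1, Vr 1, Vl 1, V0 1, V1 1, VsymAnti 1, ValtAnti 1]
      ![triv, adjoint, adjoint, triv, diag1, symAnti, adjoint] ∧
    IsIrreducibleDecomposition (twoCopy 2)
      ![Vid 2, Vr 2, Vl 2, V0 2, V1 2, V2 2, VadjComm 2, VsymComm1 2,
        VadjAnti 2, VsymAnti1 2, VsymAnti2 2, ValtComm 2, VadjAntiPerp 2]
      ![triv, adjoint, adjoint, triv, diag1, diag2, adjoint, symComm1,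
        adjoint, symAnti1, symAnti2, alt, alt] ∧
    ∀ q : ℕ, 3 ≤ q →
      IsIrreducibleDecomposition (twoCopy q)
        ![Vid q, Vr q, Vl q, V0 q, V1 q, V2 q, VadjComm q, VsymComm1 q, VsymComm2 q,
          VadjAnti q, VsymAnti1 q, VsymAnti2 q, ValtComm q, VadjAntiPerp q]
        ![triv, adjoint, adjoint, triv, diag1, diag2, adjoint, symComm1, symComm2,
          adjoint, symAnti1, symAnti2, alt, alt] := by
  exact ⟨isIrreducibleDecomposition_one, isIrreducibleDecomposition_two,
    isIrreducibleDecomposition_of_three_le⟩
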